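/- **Twisted biquandles and cochains.** A twisted biquandle $(X,f,R)$ consists of a set $X$, a bijection $R=(R_1,R_2):X\times X\to X\times X$ satisfying the set-theoretic Yang–Baxter equation $(R\times\mathrm{id})(\mathrm{id}\times R)(R\times\mathrm{id})=(\mathrm{id}\times R)(R\times\mathrm{id})(\mathrm{id}\times R)$, such that for all $x,z$ there is a unique $y$ with $R_1(x,y)=z$, for all $y,w$ there is a unique $x$ with $R_2(x,y)=w$, and for every $a$ there is a unique $x$ with $R(x,a)=(x,a)$; and a bijection $f:X\to X$ with $(f\times f)R=R(f\times f)$. Let $C_k(X)$ be the free abelian group on $X^k$, a $\mathbb Z[T,T^{-1}]$-module through $T(x_1,\dots,x_k)=(f(x_1),\dots,f(x_k))$. For $n\in\mathbb Z$ let $\partial_k=\sum_{i=1}^k(-1)^i(\partial^l_i-f^n\partial^r_i):C_k(X)\to C_{k-1}(X)$, where $\partial^l_i$ (resp. $\partial^r_i$) moves the entry $x_i$ by means of $R$ past all entries to its left (resp. right) and then deletes it; for example $$\partial_3(x,y,z)=-(y,z)+f^n\big(R_1(x,y),R_1(R_2(x,y),z)\big)+(R_2(x,y),z)-f^n\big(x,R_1(y,z)\big)-\big(R_2(x,R_1(y,z)),R_2(y,z)\big)+f^n(x,y).$$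 Let $C_k^{TD}(X)$ be the submodule spanned by the $(x_1,\dots,x_k)$ with $R(x_i,x_{i+1})=(x_i,x_{i+1})$ for some $i$. For a $\mathbb Z[T,T^{-1}]$-module $M$ put $C^k_{TBQ}(X;M)=\mathrm{Hom}_{\mathbb Z[T,T^{-1}]}(C_k(X)/C_k^{TD}(X),M)$; a cochain $\phi\in C^k_{TBQ}(X;M)$ is a cocycle, $\phi\in Z^k_{TBQ,(0,n)}(X;M)$, if $\phi\circ\partial_{k+1}=0$, and $\delta^3_{(0,n)}(\eta)=\eta\circ\partial_3$ for $\eta\in C^2_{TBQ}(X;M)$. **Broken surface diagrams.** A broken surface diagram $K$ is a smooth embedding in $\mathbb R^4$ of a closed oriented surface whose projection to $\mathbb R^3$ is generic (locally a single sheet, a transverse double curve, a transverse triple point, or an isolated Whitney-umbrella branch point), the fourth coordinate being the height; the orientation is recorded by normals to the projected surface in $\mathbb R^3$. A coloring of $K$ by $(X,f,R)$ assigns an element of $X$ to every semi-sheet (component of the surface after removal of the preimages of all double curves, triple points and branch points) such that along every double curve the following holds: if $x$ is the color of the under-semi-sheet from which the normal of the over-sheet points away, and $y$ the color of the over-semi-sheet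 towards which the normal of the under-sheet points, then the other over-semi-sheet has color $R_1(x,y)$ and the other under-semi-sheet has color $R_2(x,y)$. The Alexander numbering of the regions of the complement of the projected surface in $\mathbb R^3$ is $0$ on the unbounded region and increases by $1$ whenever the surface is crossed in the direction of its normal. For a triple point $\tau$, let $\mathcal L(\tau)$ be the Alexander number of its source region (the one from which all three normals point), and let $\epsilon(\tau)=1$ if the normals of the top, middle and bottom sheets in this order match the orientation of $\mathbb R^3$, $\epsilon(\tau)=-1$ otherwise. For a coloring $\mathcal C$ let $x$ be the color at $\tau$ of the bottom semi-sheet from which the normals of the top and the middle sheets point away, $y$ that of the middle semi-sheet towards which the normal of the bottom sheet points and from which the normal of the top sheet points away, and $z$ that of the top semi-sheet towards which the normals of the middle and bottom sheets point. For $\phi\in Z^3_{TBQ,(0,n)}(X;M)$, with $M$ written multiplicatively, the weight is $B_T(\tau,\mathcal C)=T^{-n\mathcal L(\tau)}\big(\phi(x,y,z)^{\epsilon(\tau)}\big)$, and the state-sum is $$\Phi(K)=\sum_{\mathcal C}\prod_\tau B_T(\tau,\mathcal C)\in\mathbb Z[M].$$ **Proposition.** Let $(X,f,R)$ be a finite twisted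 biquandle, $M$ a finite $\mathbb Z[T,T^{-1}]$-module, $n$ an integer, and $\phi\in Z^3_{TBQ,(0,n)}(X;M)$. If $\phi=\delta^3_{(0,n)}(\eta)$ for some $\eta\in C^2_{TBQ}(X;M)$, then for every broken surface diagram $K$ there are only finitely many triple points and finitely many colorings of $K$ by $(X,f,R)$, and the state-sum $\Phi(K)$ is equal to the number of colorings of $K$ by $(X,f,R)$ (as an integer multiple of $1\in\mathbb Z[M]$). -/

import Mathlib

open scoped Manifold ContDiff LaurentPolynomial

noncomputable section

/-! ### Twisted biquandles -/

/-- A twisted biquandle `(X, f, R)`: a biquandle `(X, R)` with an automorphism `f`. -/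
structure TwistedBiquandle (X : Type*) where
  /-- the invertible operator `R = (R₁, R₂)` -/
  R : X × X ≃ X × X
  /-- the automorphism `f` -/
  f : Equiv.Perm X
  /-- the set-theoretic Yang-Baxter equation
  `(R × id)(id × R)(R × id) = (id × R)(R × id)(id × R)`, componentwise -/
  yang_baxter : ∀ a b c : X,
    (R ((R (a, b)).1, (R ((R (a, b)).2, c)).1),
      (R ((R (a, b)).2, c)).2) =
    (((R (a, (R (b, c)).1)).1,
      (R ((R (a, (R (b, c)).1)).2, (R (b, c)).2)).1),
      (R ((R (a, (R (b, c)).1)).2, (R (b, c)).2)).2)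
  /-- `R₁` is left-invertible -/
  left_invertible : ∀ x z : X, ∃! y, (R (x, y)).1 = z
  /-- `R₂` is right-invertible -/
  right_invertible : ∀ y w : X, ∃! x, (R (x, y)).2 = w
  /-- the type I condition -/
  type_one : ∀ a : X, ∃! x, R (x, a) = (x, a)
  /-- `(f × f) ∘ R = R ∘ (f × f)` -/
  map_R : ∀ x y : X, R (f x, f y) = (f (R (x, y)).1, f (R (x, y)).2)

namespace TwistedBiquandle

variable {X : Type*} (B : TwistedBiquandle X)

/-! ### Twisted biquandle (co)homology -/

/-- The chain group `C_n^{TYB}(X)`: the free abelian group on `X^n`. -/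
def Chain (_B : TwistedBiquandle X) (n : ℕ) : Type _ := (Fin n → X) →₀ ℤ

instance (n : ℕ) : AddCommGroup (B.Chain n) :=
  inferInstanceAs (AddCommGroup ((Fin n → X) →₀ ℤ))

/-- The generator `(x₁, …, x_n)` of the chain group. -/
def gen {n : ℕ} (x : Fin n → X) : B.Chain n := Finsupp.single x (1 : ℤ)

/-- `T^k` acts on chains by `(x₁, …, x_n) ↦ (f^k x₁, …, f^k x_n)`. -/
def powAction (n : ℕ) : Multiplicative ℤ →* Module.End ℤ (B.Chain n) where
  toFun k := Finsupp.lmapDomain ℤ ℤ fun x i => (B.f ^ k.toAdd) (x i)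
  map_one' := by
    refine LinearMap.ext fun c => ?_
    exact Finsupp.mapDomain_id
  map_mul' k l := by
    refine LinearMap.ext fun c => ?_
    change Finsupp.mapDomain _ c = Finsupp.mapDomain _ (Finsupp.mapDomain _ c)
    rw [← Finsupp.mapDomain_comp]
    congr 1
    funext x i
    simp [zpow_add]

/-- The `ℤ[T, T⁻¹]`-module structure of the chain group. -/
instance (n : ℕ) : Module ℤ[T;T⁻¹] (B.Chain n) :=
  Module.compHom (B.Chain n)
    (AddMonoidAlgebra.lift ℤ (Module.End ℤ (B.Chain n)) ℤ (B.powAction n)).toRingHom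

/-- The strand coloured `w` is moved to the right past the strands `x₁, …, x_n`; the new
colours of those strands are returned. -/
def passRight : {n : ℕ} → X → (Fin n → X) → (Fin n → X)
  | 0, _, x => x
  | _ + 1, w, x =>
    Fin.cons (B.R (w, x 0)).1 (passRight (B.R (w, x 0)).2 (Fin.tail x))

/-- The right face map `∂^r_i` (untwisted): move the `i`-th strand to the far right, and
forget it. -/
def rightFace : {n : ℕ} → Fin (n + 1) → (Fin (n + 1) → X) → (Fin n → X)
  | 0, _, _ => Fin.elim0
  | _ + 1, i, x =>
    Fin.cases (B.passRight (x 0) (Fin.tail x))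
      (fun j => Fin.cons (x 0) (rightFace j (Fin.tail x))) i

/-- Move the `i`-th strand to the far left: the colours of the other strands afterwards, and
the colour with which the moving strand arrives. -/
def leftPass : {n : ℕ} → Fin (n + 1) → (Fin (n + 1) → X) → (Fin n → X) × X
  | 0, _, x => (Fin.elim0, x 0)
  | _ + 1, i, x =>
    Fin.cases (Fin.tail x, x 0)
      (fun j =>
        (Fin.cons (B.R (x 0, (leftPass j (Fin.tail x)).2)).2 (leftPass j (Fin.tail x)).1,
          (B.R (x 0, (leftPass j (Fin.tail x)).2)).1)) i

/-- The left face map `∂^l_i` (untwisted): move the `i`-th strand to the far left, and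
forget it. -/
def leftFace {n : ℕ} (i : Fin (n + 1)) (x : Fin (n + 1) → X) : Fin n → X :=
  (B.leftPass i x).1

/-- The boundary `∂^{(m₁,m₂)} = ∑ (-1)^i (T^{m₁} ∂^l_i - T^{m₂} ∂^r_i)`, the sum being over
`i = 1, …, n + 1` (so that the index `i : Fin (n + 1)` has sign `(-1)^(i+1)`). -/
def boundary (m₁ m₂ : ℤ) (n : ℕ) : B.Chain (n + 1) →ₗ[ℤ] B.Chain n :=
  Finsupp.linearCombination ℤ fun x : Fin (n + 1) → X =>
    ∑ i : Fin (n + 1), (-1 : ℤ) ^ (i.val + 1) •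
      (B.gen (fun j => (B.f ^ m₁) (B.leftFace i x j)) -
        B.gen (fun j => (B.f ^ m₂) (B.rightFace i x j)))

/-- The submodule `C_n^{TD}(X)` of degenerate chains. -/
def degenerate (n : ℕ) : Submodule ℤ[T;T⁻¹] (B.Chain n) :=
  Submodule.span ℤ[T;T⁻¹]
    {c | ∃ (x : Fin n → X) (i j : Fin n), j.val = i.val + 1 ∧
      B.R (x i, x j) = (x i, x j) ∧ c = B.gen x}

/-- The chain module `C_n^{TBQ}(X) = C_n^{TYB}(X) / C_n^{TD}(X)`. -/
abbrev BQChain (n : ℕ) : Type _ := B.Chain n ⧸ B.degenerate n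

/-- The cochain group `C^n_{TBQ}(X; M) = Hom_{ℤ[T, T⁻¹]}(C_n^{TBQ}(X), M)`. -/
abbrev Cochain (n : ℕ) (M : Type*) [AddCommGroup M] [Module ℤ[T;T⁻¹] M] : Type _ :=
  B.BQChain n →ₗ[ℤ[T;T⁻¹]] M

variable {M : Type*} [AddCommGroup M] [Module ℤ[T;T⁻¹] M]

/-- The value of a cochain on a chain. -/
def evalChain {n : ℕ} (φ : B.Cochain n M) (c : B.Chain n) : M :=
  φ (Submodule.Quotient.mk c)

/-- `φ = δ_{(m₁,m₂)} η`, that is, `φ(c) = η(∂^{(m₁,m₂)} c)` for all chains `c`. -/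
def IsCoboundaryOf (m₁ m₂ : ℤ) {n : ℕ} (φ : B.Cochain (n + 1) M) (η : B.Cochain n M) : Prop :=
  ∀ c : B.Chain (n + 1), B.evalChain φ c = B.evalChain η (B.boundary m₁ m₂ n c)

/-- `φ ∈ Z^n_{TBQ,(m₁,m₂)}(X; M)`, that is, `δ_{(m₁,m₂)} φ = 0`. -/
def IsCocycle (m₁ m₂ : ℤ) {n : ℕ} (φ : B.Cochain n M) : Prop :=
  ∀ c : B.Chain (n + 1), B.evalChain φ (B.boundary m₁ m₂ n c) = 0

end TwistedBiquandle

/-! ### Knotted surfaces and broken surface diagrams -/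

section Surface

variable {F : Type*} [TopologicalSpace F] [ChartedSpace (EuclideanSpace ℝ (Fin 2)) F]

/-- The projection to `ℝ³` of a map to `ℝ⁴`: the first three coordinates. -/
def projection (emb : F → EuclideanSpace ℝ (Fin 4)) (x : F) : EuclideanSpace ℝ (Fin 3) :=
  WithLp.toLp 2 fun i => emb x i.castSucc

/-- The differential at `x` of the projection to `ℝ³`. -/
def dprojection (emb : F → EuclideanSpace ℝ (Fin 4)) (x : F) :
    EuclideanSpace ℝ (Fin 2) →L[ℝ] EuclideanSpace ℝ (Fin 3) :=
  mfderiv (𝓡 2) (𝓡 3) (projection emb) x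

/-- A knotted surface with underlying closed surface `F`: a smooth embedding of `F` in `ℝ⁴`,
together with normals: a continuous unit normal field, in `ℝ³`, of the projection of `F` to
`ℝ³`, over the points where this projection is an immersion. For a generic projection such a
field is the same as an orientation of `F` (the points where the projection is not an immersion
are isolated, so an orientation of the complement extends over them). -/
structure KnottedSurface (F : Type*) [TopologicalSpace F]
    [ChartedSpace (EuclideanSpace ℝ (Fin 2)) F] where
  /-- the embedding in `ℝ⁴` -/
  emb : F → EuclideanSpace ℝ (Fin 4)
  smoothEmbedding : Manifold.IsSmoothEmbedding (𝓡 2) (𝓡 4) ∞ emb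
  /-- the normal field; its values where the projection is not an immersion are irrelevant -/
  normal : F → EuclideanSpace ℝ (Fin 3)
  norm_normal : ∀ x, Function.Injective (dprojection emb x) → ‖normal x‖ = 1
  normal_orthogonal : ∀ x, Function.Injective (dprojection emb x) →
    ∀ v, inner ℝ (normal x) (dprojection emb x v) = 0
  continuousOn_normal :
    ContinuousOn normal {x | Function.Injective (dprojection emb x)}

namespace KnottedSurface

variable (K : KnottedSurface F)

/-- The projection of the knotted surface to `ℝ³`. -/
def proj (x : F) : EuclideanSpace ℝ (Fin 3) := projection K.emb x

/-- The height of a point of the knotted surface: the fourth coordinate. -/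
def height (x : F) : ℝ := K.emb x (Fin.last 3)

/-- The projection is an immersion at `x`. -/
def ImmersedAt (x : F) : Prop := Function.Injective (dprojection K.emb x)

/-- A local picture of the projected surface in which exactly `k` sheets cross transversally
(`k = 1, 2, 3`): a coordinate system `chart` of `ℝ³` with values in the unit ball, in which the
sheets `0, …, k - 1` are the coordinate planes `y₀ = 0, …, y_{k-1} = 0`. The sheets are numbered
from top to bottom, and the normal of the `i`-th sheet points to the side `y_i > 0`. (Any local
picture of `k` transversal sheets takes this form after permuting and reflecting the
coordinates.) -/
structure SheetChart (k : ℕ) where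
  chart : OpenPartialHomeomorph (EuclideanSpace ℝ (Fin 3)) (EuclideanSpace ℝ (Fin 3))
  contDiffOn : ContDiffOn ℝ ∞ chart chart.source
  contDiffOn_symm : ContDiffOn ℝ ∞ chart.symm chart.target
  target_eq : chart.target = Metric.ball 0 1
  /-- the sheets, as parts of the surface `F` -/
  sheet : Fin 3 → Set F
  sheet_eq_empty : ∀ i : Fin 3, k ≤ i.val → sheet i = ∅
  isOpen_sheet : ∀ i, IsOpen (sheet i)
  disjoint_sheet : ∀ i j, i ≠ j → Disjoint (sheet i) (sheet j)
  iUnion_sheet : ⋃ i, sheet i = K.proj ⁻¹' chart.source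
  bijOn_sheet : ∀ i : Fin 3, i.val < k →
    Set.BijOn K.proj (sheet i) {q | q ∈ chart.source ∧ chart q i = 0}
  immersed : ∀ i, ∀ x ∈ sheet i, K.ImmersedAt x
  /-- the sheets are numbered from top to bottom -/
  height_lt : ∀ i j, i < j → ∀ x ∈ sheet i, ∀ y ∈ sheet j, K.proj x = K.proj y →
    K.height y < K.height x
  /-- the normals point in the direction of increasing coordinates -/
  normal_pos : ∀ i, ∀ x ∈ sheet i, 0 < fderiv ℝ chart (K.proj x) (K.normal x) i

/-- A local picture of the projected surface around an isolated branch point: in suitable smooth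
coordinates of `F` and of `ℝ³`, the projection is the Whitney umbrella
`(u, v) ↦ (u, v², u v)`. -/
structure BranchChart where
  chart : OpenPartialHomeomorph (EuclideanSpace ℝ (Fin 3)) (EuclideanSpace ℝ (Fin 3))
  contDiffOn : ContDiffOn ℝ ∞ chart chart.source
  contDiffOn_symm : ContDiffOn ℝ ∞ chart.symm chart.target
  target_eq : chart.target = Metric.ball 0 1
  /-- the coordinates `(u, v)` of the surface -/
  surfaceChart : OpenPartialHomeomorph F (EuclideanSpace ℝ (Fin 2))
  surfaceChart_mem : surfaceChart ∈ IsManifold.maximalAtlas (𝓡 2) ∞ F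
  source_eq : surfaceChart.source = K.proj ⁻¹' chart.source
  zero_mem : 0 ∈ surfaceChart.target
  umbrella : ∀ x ∈ surfaceChart.source,
    chart (K.proj x) =
      !₂[surfaceChart x 0, (surfaceChart x 1) ^ 2, surfaceChart x 0 * surfaceChart x 1]

/-- The point at the centre of a local picture. -/
def SheetChart.center {K : KnottedSurface F} {k : ℕ} (c : K.SheetChart k) :
    EuclideanSpace ℝ (Fin 3) := c.chart.symm 0

/-- The branch point, in `ℝ³`, at the centre of a local picture. -/
def BranchChart.center {K : KnottedSurface F} (c : K.BranchChart) :
    EuclideanSpace ℝ (Fin 3) := c.chart.symm 0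

/-- The points of the surface that lie on no double curve and are no branch point. -/
def regularSet : Set F := {x | K.ImmersedAt x ∧ ∀ y, K.proj y = K.proj x → y = x}

/-- The semi-sheets: the components into which the double curves (and triple points and branch
points) cut the surface. -/
abbrev SemiSheet : Type _ := ConnectedComponents K.regularSet

/-- The regions: the components of the complement in `ℝ³` of the projected surface. -/
abbrev Region : Type := ConnectedComponents ((Set.range K.proj)ᶜ : Set (EuclideanSpace ℝ (Fin 3)))

namespace SheetChart

variable {K} {k : ℕ} (c : K.SheetChart k)

/-- The coordinates, in a local picture, of the projection of a point of the surface. -/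
def coord (x : F) : EuclideanSpace ℝ (Fin 3) := c.chart (K.proj x)

theorem mem_source {i : Fin 3} {x : F} (hx : x ∈ c.sheet i) : K.proj x ∈ c.chart.source := by
  have h : x ∈ ⋃ i, c.sheet i := Set.mem_iUnion_of_mem i hx
  rw [c.iUnion_sheet] at h
  exact h

theorem lt_of_mem {i : Fin 3} {x : F} (hx : x ∈ c.sheet i) : i.val < k := by
  by_contra h
  rw [c.sheet_eq_empty i (not_lt.mp h)] at hx
  exact hx

theorem coord_eq_zero {i : Fin 3} {x : F} (hx : x ∈ c.sheet i) : c.coord x i = 0 :=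
  ((c.bijOn_sheet i (c.lt_of_mem hx)).mapsTo hx).2

theorem exists_sheet {x : F} (hx : K.proj x ∈ c.chart.source) : ∃ i, x ∈ c.sheet i := by
  have h : x ∈ ⋃ i, c.sheet i := by rw [c.iUnion_sheet]; exact hx
  exact Set.mem_iUnion.mp h

/-- A point of a sheet that lies on no other sheet is regular. -/
theorem mem_regularSet {i : Fin 3} {x : F} (hx : x ∈ c.sheet i)
    (h : ∀ j, j ≠ i → c.coord x j ≠ 0) : x ∈ K.regularSet := by
  refine ⟨c.immersed i x hx, fun y hy => ?_⟩
  obtain ⟨j, hj⟩ := c.exists_sheet (x := y) (hy ▸ c.mem_source hx)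
  by_cases hji : j = i
  · subst hji
    exact (c.bijOn_sheet j (c.lt_of_mem hj)).injOn hj hx hy
  · refine absurd (c.coord_eq_zero hj) ?_
    unfold coord
    rw [hy]
    exact h j hji

theorem exists_point {i : Fin 3} (hi : i.val < k) {v : EuclideanSpace ℝ (Fin 3)}
    (hv : ‖v‖ < 1) (hvi : v i = 0) : ∃ x ∈ c.sheet i, c.coord x = v := by
  have ht : v ∈ c.chart.target := by rw [c.target_eq]; simpa using hv
  obtain ⟨x, hx, hxv⟩ := (c.bijOn_sheet i hi).surjOn
    (show c.chart.symm v ∈ {q | q ∈ c.chart.source ∧ c.chart q i = 0} from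
      ⟨c.chart.map_target ht, by rw [c.chart.right_inv ht]; exact hvi⟩)
  exact ⟨x, hx, by unfold coord; rw [hxv, c.chart.right_inv ht]⟩

/-- The point of the `i`-th sheet with coordinates `v`. -/
def point {i : Fin 3} (hi : i.val < k) {v : EuclideanSpace ℝ (Fin 3)}
    (hv : ‖v‖ < 1) (hvi : v i = 0) : F := (c.exists_point hi hv hvi).choose

/-- The semi-sheet of the `i`-th sheet that contains the point with coordinates `v`, where `v`
lies on no other coordinate plane. -/
def semiSheet {i : Fin 3} (hi : i.val < k) {v : EuclideanSpace ℝ (Fin 3)}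
    (hv : ‖v‖ < 1) (hvi : v i = 0) (h : ∀ j, j ≠ i → v j ≠ 0) : K.SemiSheet :=
  ConnectedComponents.mk ⟨c.point hi hv hvi,
    c.mem_regularSet (c.exists_point hi hv hvi).choose_spec.1 fun j hj => by
      have := (c.exists_point hi hv hvi).choose_spec.2
      unfold point
      rw [this]
      exact h j hj⟩

/-- The region that contains the point with coordinates `v`, where `v` lies on no coordinate
plane. -/
def region {v : EuclideanSpace ℝ (Fin 3)} (hv : ‖v‖ < 1) (h : ∀ j, v j ≠ 0) : K.Region :=
  ConnectedComponents.mk ⟨c.chart.symm v, by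
    rintro ⟨x, hx⟩
    have ht : v ∈ c.chart.target := by rw [c.target_eq]; simpa using hv
    obtain ⟨i, hi⟩ := c.exists_sheet (x := x) (hx ▸ c.chart.map_target ht)
    have := c.coord_eq_zero hi
    unfold coord at this
    rw [hx, c.chart.right_inv ht] at this
    exact h i this⟩

end SheetChart

/-- Two `±1/2` coordinates and a zero, or three `±1/2` coordinates, give a point of the unit
ball. -/
theorem norm_half_lt (a b c : ℝ) (ha : |a| ≤ 1 / 2) (hb : |b| ≤ 1 / 2) (hc : |c| ≤ 1 / 2) :
    ‖(!₂[a, b, c] : EuclideanSpace ℝ (Fin 3))‖ < 1 := by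
  rw [EuclideanSpace.norm_eq, Real.sqrt_lt' one_pos, Fin.sum_univ_three]
  have h := sq_le_sq' (abs_le.mp ha).1 (abs_le.mp ha).2
  have h' := sq_le_sq' (abs_le.mp hb).1 (abs_le.mp hb).2
  have h'' := sq_le_sq' (abs_le.mp hc).1 (abs_le.mp hc).2
  simp
  linarith

namespace SheetChart

variable {K} (c : K.SheetChart 3)

/-- At a triple point: the semi-sheet of the bottom sheet from which the normals of the top and
the middle sheet point away. -/
def bottomSemiSheet : K.SemiSheet :=
  c.semiSheet (i := 2) (v := !₂[-1 / 2, -1 / 2, 0]) (by decide)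
    (norm_half_lt _ _ _ (by norm_num [abs_le]) (by norm_num [abs_le]) (by norm_num)) (by simp)
    (by intro j hj; fin_cases j <;> simp_all)

/-- At a triple point: the semi-sheet of the middle sheet towards which the normal of the bottom
sheet points, and from which the normal of the top sheet points away. -/
def middleSemiSheet : K.SemiSheet :=
  c.semiSheet (i := 1) (v := !₂[-1 / 2, 0, 1 / 2]) (by decide)
    (norm_half_lt _ _ _ (by norm_num [abs_le]) (by norm_num) (by norm_num [abs_le])) (by simp)
    (by intro j hj; fin_cases j <;> simp_all)

/-- At a triple point: the semi-sheet of the top sheet towards which the normals of the middle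
and the bottom sheet point. -/
def topSemiSheet : K.SemiSheet :=
  c.semiSheet (i := 0) (v := !₂[0, 1 / 2, 1 / 2]) (by decide)
    (norm_half_lt _ _ _ (by norm_num) (by norm_num [abs_le]) (by norm_num [abs_le])) (by simp)
    (by intro j hj; fin_cases j <;> simp_all)

/-- At a triple point: the source region, from which the normals of all three sheets point. -/
def sourceRegion : K.Region :=
  c.region (v := !₂[-1 / 2, -1 / 2, -1 / 2])
    (norm_half_lt _ _ _ (by norm_num [abs_le]) (by norm_num [abs_le]) (by norm_num [abs_le]))
    (by intro j; fin_cases j <;> simp)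

/-- The sign of a triple point: it is `1` if the normals of the top, the middle and the bottom
sheet at the triple point, in this order, match the orientation of `ℝ³`, and `-1` otherwise. -/
def tripleSign : ℤ :=
  ((SignType.sign (Matrix.det (Matrix.of fun i : Fin 3 =>
    (K.normal (c.point (i := i) (v := 0) i.isLt (by simp) (by simp))).ofLp)) : SignType) : ℤ)

end SheetChart

end KnottedSurface

/-- A broken surface diagram: a knotted surface (with normals) whose projection to `ℝ³` is
generic, that is, each point of the projected surface is a point of a single sheet, of a double
curve, a triple point or an isolated branch point. The height records which sheet is over. -/
structure BrokenSurfaceDiagram (F : Type*) [TopologicalSpace F]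
    [ChartedSpace (EuclideanSpace ℝ (Fin 2)) F] extends KnottedSurface F where
  generic : ∀ p ∈ Set.range toKnottedSurface.proj,
    (∃ k ∈ Set.Icc 1 3, ∃ c : toKnottedSurface.SheetChart k, c.center = p) ∨
      ∃ c : toKnottedSurface.BranchChart, c.center = p

namespace BrokenSurfaceDiagram

variable (D : BrokenSurfaceDiagram F)

/-- The set of triple points, in `ℝ³`. -/
def triplePoints : Set (EuclideanSpace ℝ (Fin 3)) :=
  {p | ∃ c : D.SheetChart 3, c.center = p}

variable {X : Type*} (B : TwistedBiquandle X)

/-- The colouring rule: where two sheets cross in a double curve, let `x` be the colour of the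
under-semi-sheet from which the normal of the over-sheet points away, and `y` the colour of the
over-semi-sheet towards which the normal of the under-sheet points. Then the other
over-semi-sheet has colour `R₁(x, y)`, and the other under-semi-sheet has colour `R₂(x, y)`. -/
def IsColoring (C : D.SemiSheet → X) : Prop :=
  ∀ (c : D.SheetChart 2) (overPos overNeg underPos underNeg : D.regularSet),
    overPos.val ∈ c.sheet 0 → 0 < c.coord overPos 1 →
    overNeg.val ∈ c.sheet 0 → c.coord overNeg 1 < 0 →
    underPos.val ∈ c.sheet 1 → 0 < c.coord underPos 0 →
    underNeg.val ∈ c.sheet 1 → c.coord underNeg 0 < 0 →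
    B.R (C (ConnectedComponents.mk underNeg), C (ConnectedComponents.mk overPos)) =
      (C (ConnectedComponents.mk overNeg), C (ConnectedComponents.mk underPos))

/-- The colourings of a broken surface diagram by a twisted biquandle. -/
def Coloring : Type _ := {C : D.SemiSheet → X // D.IsColoring B C}

/-- The Alexander numbering of the regions: it vanishes on the region at infinity, and when the
surface is crossed in the direction of its normal, it increases by one. (So its value on a region
is the number of times that an arc from infinity to the region crosses the surface in the
direction of the normal, minus the number of times that it crosses in the opposite direction;
there is exactly one such numbering.) -/
structure AlexanderNumbering where
  toFun : D.Region → ℤ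
  infinity : ∃ r : ℝ, ∀ q : ((Set.range D.proj)ᶜ : Set (EuclideanSpace ℝ (Fin 3))),
    r < ‖q.val‖ → toFun (ConnectedComponents.mk q) = 0
  crossing : ∀ (c : D.SheetChart 1)
    (pos neg : ((Set.range D.proj)ᶜ : Set (EuclideanSpace ℝ (Fin 3)))),
    pos.val ∈ c.chart.source → 0 < c.chart pos.val 0 →
    neg.val ∈ c.chart.source → c.chart neg.val 0 < 0 →
    toFun (ConnectedComponents.mk pos) = toFun (ConnectedComponents.mk neg) + 1

variable {D B} {M : Type*} [AddCommGroup M] [Module ℤ[T;T⁻¹] M]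

/-- The twisted Boltzmann weight `T^{-n L(τ)} (ε(τ) θ(x, y, z))` at the triple point `τ`, where
`L(τ)` is the Alexander number of the source region, `ε(τ)` is the sign of `τ`, and `x`, `y`, `z`
are the colours of the bottom, middle and top semi-sheets. -/
def weight (L : D.AlexanderNumbering) (n : ℤ) (θ : B.Cochain 3 M) (C : D.Coloring B)
    (τ : D.triplePoints) : M :=
  let c : D.SheetChart 3 := τ.property.choose
  (LaurentPolynomial.T (-(n * L.toFun c.sourceRegion)) : ℤ[T;T⁻¹]) •
    (c.tripleSign • B.evalChain θ
      (B.gen ![C.val c.bottomSemiSheet, C.val c.middleSemiSheet, C.val c.topSemiSheet]))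

/-- The state-sum, in the group ring `ℤ[M]`: the sum over all colourings `C` of the group element
given by the "product" of the weights of all triple points. The group `M` is written additively,
and the group element `m` is `AddMonoidAlgebra.single m 1` in the group ring. -/
def stateSum (L : D.AlexanderNumbering) (n : ℤ) (θ : B.Cochain 3 M) : AddMonoidAlgebra ℤ M :=
  ∑ᶠ C : D.Coloring B, AddMonoidAlgebra.single (∑ᶠ τ : D.triplePoints, weight L n θ C τ) (1 : ℤ)

end BrokenSurfaceDiagram

end Surface

end

/-!
The weights of the triple points of a coboundary `φ = δη` cancel, because they can be read as flows
along the double curves. Give every double point the weight `T^{-n(ℓ-1)} η(x, y)`, where `ℓ` is the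
Alexander number of the region from which both normals point, `x` is the colour of the
under-semi-sheet from which the normal of the over-sheet points away, and `y` is the colour of the
over-semi-sheet towards which the normal of the under-sheet points. This weight (`doubleWeight`) is
constant along the double curves, which are oriented by the cross product of the two normals.

* At a triple point with colours `(x, y, z)` the six half-axes carry the six pairs that occur in
  the boundary `∂₃(x, y, z)`, and the power of `T` is the one in `∂₃`, relative to the weight of the
  triple point (`hasLabel_axis_triple`). The sign with which a half-axis leaves the triple point is
  the sign of the triple point times the sign of the pair in `-∂₃`. So the total weight that flows
  out of the triple point is minus its Boltzmann weight (`sum_doubleWeight_axis`).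
* At a branch point a double curve ends. There the over- and the under-semi-sheet on the positive
  sides of the crossing are one and the same, and so are those on the negative sides
  (`exists_paired_sides`), so that the colouring rule says `R(x, y) = (x, y)`. Hence the pair is
  degenerate, and the weight vanishes (`HasLabel.degenerate`, `doubleWeight_branch`).
* What leaves along one end of a double curve enters along the other, so that the flow out of all
  triple points is zero.

The last step needs neither a classification of the double curves nor a triangulation. A *jump* of a
`ℤ`-valued piecewise constant function `g` at a double point is its limit in the direction of the
curve minus its limit against it, and `totalJump w g` is the sum of the jumps, weighted by `w`. The
projected surface is covered by finitely many small coordinate balls (`IsPatch`), each centred at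
the only triple point that it may contain. In a ball the double curves are coordinate axes, and for a
cut-off function `g` on the ball the total jump telescopes along the axes
(`OrientedCurves.totalJump_eq_sum_arcs`): it vanishes unless the centre is a triple point, where it is
minus the flow out of it. Multiplying the functions `1 - 1_U` over all balls `U` of the cover gives
the function that is zero on all double curves, whose total jump is zero; adding the factors one at
a time shows that this total jump is the sum of all flows (`OrientedCurves.sum_flow_eq_zero`).

The colours, the Alexander numbers and the signs are compared between local pictures by
connectedness: semi-sheets and regions meet a local picture in quadrants and octants
(`SheetChart.colorAt_congr`, `SheetChart.regionValue_congr`), and the Jacobian determinant of a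
coordinate system has constant sign. The finiteness statements follow from compactness, since a
local picture contains at most one triple point and meets finitely many semi-sheets.
-/

open Set Filter Topology

/-- Euclidean three-space, in which broken surface diagrams are drawn. -/
abbrev E3 : Type := EuclideanSpace ℝ (Fin 3)

namespace KnottedSurface

variable {F : Type*} [TopologicalSpace F] [ChartedSpace (EuclideanSpace ℝ (Fin 2)) F]

/-! ### The projection of a knotted surface -/

section Projection

variable (K : KnottedSurface F)

theorem contMDiff_proj [IsManifold (𝓡 2) ∞ F] : ContMDiff (𝓡 2) (𝓡 3) ∞ K.proj := by
  have h : ContDiff ℝ ∞ fun y : EuclideanSpace ℝ (Fin 4) =>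
      (WithLp.toLp 2 fun i : Fin 3 => y i.castSucc : E3) :=
    contDiff_euclidean.2 fun i => by
      simp only
      fun_prop
  exact h.contMDiff.comp K.smoothEmbedding.contMDiff

theorem continuous_proj [IsManifold (𝓡 2) ∞ F] : Continuous K.proj :=
  K.contMDiff_proj.continuous

theorem hasMFDerivAt_proj [IsManifold (𝓡 2) ∞ F] (x : F) :
    HasMFDerivAt (𝓡 2) (𝓡 3) K.proj x (dprojection K.emb x) :=
  ((K.contMDiff_proj x).mdifferentiableAt (by simp)).hasMFDerivAt

theorem isClosedMap_proj [IsManifold (𝓡 2) ∞ F] [CompactSpace F] : IsClosedMap K.proj :=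
  K.continuous_proj.isClosedMap

variable {K}

/-- A covector that vanishes on the tangent plane of the projected surface is a multiple of the
inner product with the normal. -/
theorem eq_mul_inner_normal {x : F} (hx : K.ImmersedAt x) (ℓ : E3 →L[ℝ] ℝ)
    (hℓ : ∀ v, ℓ (dprojection K.emb x v) = 0) (w : E3) :
    ℓ w = ℓ (K.normal x) * inner ℝ (K.normal x) w := by
  set V : Submodule ℝ E3 := LinearMap.range (dprojection K.emb x).toLinearMap with hV
  have hfin : Module.finrank ℝ V = 2 := by
    rw [hV, LinearMap.finrank_range_of_inj hx]
    simp
  have hperp : Module.finrank ℝ Vᗮ = 1 := by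
    have := V.finrank_add_finrank_orthogonal
    simp only [finrank_euclideanSpace, Fintype.card_fin] at this
    omega
  have hN : K.normal x ∈ Vᗮ := by
    rw [Submodule.mem_orthogonal']
    rintro _ ⟨v, rfl⟩
    exact K.normal_orthogonal x hx v
  have hN1 : ‖K.normal x‖ = 1 := K.norm_normal x hx
  have hN0 : (⟨K.normal x, hN⟩ : Vᗮ) ≠ 0 := by
    intro h
    have : K.normal x = 0 := congrArg Subtype.val h
    rw [this, norm_zero] at hN1
    exact zero_ne_one hN1
  obtain ⟨y, hy, z, hz, rfl⟩ := V.exists_add_mem_mem_orthogonal w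
  obtain ⟨a, ha⟩ := exists_smul_eq_of_finrank_eq_one hperp hN0 ⟨z, hz⟩
  have hz' : z = a • K.normal x := (congrArg Subtype.val ha).symm
  have hy' : ℓ y = 0 := by
    obtain ⟨v, rfl⟩ := hy
    exact hℓ v
  have hyN : inner ℝ (K.normal x) y = 0 := (Submodule.mem_orthogonal' _ _).1 hN y hy
  rw [map_add, hy', inner_add_right, hyN, hz', map_smul, inner_smul_right,
    real_inner_self_eq_norm_sq, hN1]
  simp [mul_comm]

end Projection

namespace SheetChart

variable {K : KnottedSurface F} {k k' : ℕ} (c : K.SheetChart k) (c' : K.SheetChart k')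

/-! ### Sheets in a local picture -/

theorem mem_target {v : E3} (hv : ‖v‖ < 1) : v ∈ c.chart.target := by
  rw [c.target_eq]
  simpa using hv

theorem norm_chart_lt {q : E3} (hq : q ∈ c.chart.source) : ‖c.chart q‖ < 1 := by
  have := c.chart.map_source hq
  rw [c.target_eq] at this
  simpa using this

theorem contDiffAt_chart {q : E3} (hq : q ∈ c.chart.source) : ContDiffAt ℝ ∞ c.chart q :=
  c.contDiffOn.contDiffAt (c.chart.open_source.mem_nhds hq)

theorem contDiffAt_symm {v : E3} (hv : v ∈ c.chart.target) : ContDiffAt ℝ ∞ c.chart.symm v :=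
  c.contDiffOn_symm.contDiffAt (c.chart.open_target.mem_nhds hv)

theorem hasStrictFDerivAt_chart {q : E3} (hq : q ∈ c.chart.source) :
    HasStrictFDerivAt c.chart (fderiv ℝ c.chart q) q :=
  (c.contDiffAt_chart hq).hasStrictFDerivAt (by simp)

theorem hasStrictFDerivAt_symm {v : E3} (hv : v ∈ c.chart.target) :
    HasStrictFDerivAt c.chart.symm (fderiv ℝ c.chart.symm v) v :=
  (c.contDiffAt_symm hv).hasStrictFDerivAt (by simp)

theorem fderiv_chart_fderiv_symm {v : E3} (hv : v ∈ c.chart.target) (w : E3) :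
    fderiv ℝ c.chart (c.chart.symm v) (fderiv ℝ c.chart.symm v w) = w := by
  have h1 := (c.hasStrictFDerivAt_chart (c.chart.map_target hv)).hasFDerivAt.comp v
    (c.hasStrictFDerivAt_symm hv).hasFDerivAt
  have h2 : HasFDerivAt (c.chart ∘ c.chart.symm) (ContinuousLinearMap.id ℝ E3) v :=
    (hasFDerivAt_id v).congr_of_eventuallyEq <| by
      filter_upwards [c.chart.open_target.mem_nhds hv] with y hy
      simp [c.chart.right_inv hy]
  exact DFunLike.congr_fun (h1.unique h2) w

theorem fderiv_symm_fderiv_chart {q : E3} (hq : q ∈ c.chart.source) (w : E3) :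
    fderiv ℝ c.chart.symm (c.chart q) (fderiv ℝ c.chart q w) = w := by
  have h1 := (c.hasStrictFDerivAt_symm (c.chart.map_source hq)).hasFDerivAt.comp q
    (c.hasStrictFDerivAt_chart hq).hasFDerivAt
  have h2 : HasFDerivAt (c.chart.symm ∘ c.chart) (ContinuousLinearMap.id ℝ E3) q :=
    (hasFDerivAt_id q).congr_of_eventuallyEq <| by
      filter_upwards [c.chart.open_source.mem_nhds hq] with y hy
      simp [c.chart.left_inv hy]
  exact DFunLike.congr_fun (h1.unique h2) w

theorem eq_of_mem_sheet {x : F} {i j : Fin 3} (hi : x ∈ c.sheet i) (hj : x ∈ c.sheet j) :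
    i = j := by
  by_contra h
  exact Set.disjoint_left.1 (c.disjoint_sheet i j h) hi hj

theorem symm_coord {x : F} {i : Fin 3} (hx : x ∈ c.sheet i) :
    c.chart.symm (c.coord x) = K.proj x :=
  c.chart.left_inv (c.mem_source hx)

theorem eq_of_coord_eq {x y : F} {i : Fin 3} (hx : x ∈ c.sheet i) (hy : y ∈ c.sheet i)
    (h : c.coord x = c.coord y) : x = y := by
  refine (c.bijOn_sheet i (c.lt_of_mem hx)).injOn hx hy ?_
  rw [← c.symm_coord hx, h, c.symm_coord hy]

theorem norm_coord_lt {x : F} {i : Fin 3} (hx : x ∈ c.sheet i) : ‖c.coord x‖ < 1 :=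
  c.norm_chart_lt (c.mem_source hx)

theorem continuousAt_chart_apply {q : E3} (hq : q ∈ c.chart.source) (l : Fin 3) :
    ContinuousAt (fun q => c.chart q l) q := by
  have := c.chart.continuousAt hq
  fun_prop

theorem fderiv_chart_dprojection [IsManifold (𝓡 2) ∞ F] {x : F} {i : Fin 3}
    (hx : x ∈ c.sheet i) (v : EuclideanSpace ℝ (Fin 2)) :
    fderiv ℝ c.chart (K.proj x) (dprojection K.emb x v) i = 0 := by
  set A := fderiv ℝ c.chart (K.proj x)
  have h1 : HasFDerivAt (fun q => c.chart q i) ((EuclideanSpace.proj i : E3 →L[ℝ] ℝ) ∘L A)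
      (K.proj x) :=
    (EuclideanSpace.proj i : E3 →L[ℝ] ℝ).hasFDerivAt.comp (K.proj x)
      (c.hasStrictFDerivAt_chart (c.mem_source hx)).hasFDerivAt
  have h2 : HasMFDerivAt (𝓡 2) 𝓘(ℝ, ℝ) ((fun q => c.chart q i) ∘ K.proj) x
      (((EuclideanSpace.proj i : E3 →L[ℝ] ℝ) ∘L A).comp (dprojection K.emb x)) :=
    HasMFDerivAt.comp x (hasMFDerivAt_iff_hasFDerivAt.2 h1) (K.hasMFDerivAt_proj x)
  have h3 : HasMFDerivAt (𝓡 2) 𝓘(ℝ, ℝ) ((fun q => c.chart q i) ∘ K.proj) x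
      (0 : EuclideanSpace ℝ (Fin 2) →L[ℝ] ℝ) :=
    (hasMFDerivAt_const (I := 𝓡 2) (I' := 𝓘(ℝ, ℝ)) (0 : ℝ) x).congr_of_eventuallyEq <| by
      filter_upwards [(c.isOpen_sheet i).mem_nhds hx] with y hy
      exact c.coord_eq_zero hy
  exact DFunLike.congr_fun (hasMFDerivAt_unique h2 h3) v

/-- On the `i`-th sheet, the differential of the `i`-th coordinate is a positive multiple of the
inner product with the normal. -/
theorem fderiv_chart_apply [IsManifold (𝓡 2) ∞ F] {x : F} {i : Fin 3} (hx : x ∈ c.sheet i)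
    (w : E3) : fderiv ℝ c.chart (K.proj x) w i =
      fderiv ℝ c.chart (K.proj x) (K.normal x) i * inner ℝ (K.normal x) w :=
  eq_mul_inner_normal (c.immersed i x hx)
    ((EuclideanSpace.proj i : E3 →L[ℝ] ℝ) ∘L fderiv ℝ c.chart (K.proj x))
    (fun v => c.fderiv_chart_dprojection hx v) w

/-- Since the surface is compact, a sheet carries the topology of its image: the points of the
sheet over points close to `K.proj x` are close to `x`. -/
theorem eventually_sheet_mem [IsManifold (𝓡 2) ∞ F] [CompactSpace F] {x : F} {i : Fin 3}
    (hx : x ∈ c.sheet i) {U : Set F} (hU : U ∈ 𝓝 x) :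
    ∀ᶠ q in 𝓝 (K.proj x), ∀ y ∈ c.sheet i, K.proj y = q → y ∈ U := by
  have h := K.isClosedMap_proj.eventually_nhds_fiber (p := fun y => y ∈ c.sheet i → y ∈ U)
    (K.proj x) ?_
  · filter_upwards [h] with q hq y hy hyq
    exact hq y hyq hy
  intro y hy
  have hy' : K.proj y = K.proj x := hy
  obtain ⟨j, hj⟩ := c.exists_sheet (x := y) (hy' ▸ c.mem_source hx)
  by_cases hij : j = i
  · subst hij
    have : y = x := (c.bijOn_sheet j (c.lt_of_mem hx)).injOn hj hx hy'
    subst this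
    filter_upwards [hU] with z hz _ using hz
  · filter_upwards [(c.isOpen_sheet j).mem_nhds hj] with z hz hz'
    exact absurd (c.eq_of_mem_sheet hz hz') hij

/-- The `i`-th sheet, parametrized by the `i`-th coordinate plane. -/
theorem exists_section [IsManifold (𝓡 2) ∞ F] [CompactSpace F] {i : Fin 3} (hi : i.val < k) :
    ∃ σ : E3 → F, (∀ v : E3, ‖v‖ < 1 → v i = 0 → σ v ∈ c.sheet i ∧ c.coord (σ v) = v) ∧
      ContinuousOn σ {v | ‖v‖ < 1 ∧ v i = 0} := by
  classical
  have hne : ∃ _ : F, True := by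
    obtain ⟨x, -, -⟩ := c.exists_point (i := i) hi (v := 0) (by simp) (by simp)
    exact ⟨x, trivial⟩
  obtain ⟨x₀, -⟩ := hne
  let σ : E3 → F := fun v =>
    if h : ‖v‖ < 1 ∧ v i = 0 then (c.exists_point hi h.1 h.2).choose else x₀
  have hσ : ∀ v : E3, ‖v‖ < 1 → v i = 0 → σ v ∈ c.sheet i ∧ c.coord (σ v) = v := by
    intro v h1 h2
    have h : ‖v‖ < 1 ∧ v i = 0 := ⟨h1, h2⟩
    simp only [σ, dif_pos h]
    exact (c.exists_point hi h1 h2).choose_spec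
  refine ⟨σ, hσ, ?_⟩
  rintro v ⟨h1, h2⟩
  obtain ⟨hs, hc⟩ := hσ v h1 h2
  intro U hU
  have h := c.eventually_sheet_mem hs hU
  have hcont : Tendsto c.chart.symm (𝓝 v) (𝓝 (K.proj (σ v))) := by
    have := c.chart.symm.continuousAt (x := v) (c.mem_target h1)
    rw [← c.symm_coord hs, hc]
    exact this
  have h' : ∀ᶠ w in 𝓝[{v | ‖v‖ < 1 ∧ v i = 0}] v, ∀ y ∈ c.sheet i,
      K.proj y = c.chart.symm w → y ∈ U := (hcont.eventually h).filter_mono nhdsWithin_le_nhds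
  refine mem_map.2 ?_
  filter_upwards [h', self_mem_nhdsWithin] with w hw hw'
  obtain ⟨hs', hc'⟩ := hσ w hw'.1 hw'.2
  exact hw _ hs' (by rw [← c.symm_coord hs', hc'])

/-- Two local pictures agree on which side of a common sheet a nearby point lies: both describe
the side to which the normal points. -/
theorem eventually_sign_eq [IsManifold (𝓡 2) ∞ F] [CompactSpace F] {x : F} {i i' : Fin 3}
    (hx : x ∈ c.sheet i) (hx' : x ∈ c'.sheet i') :
    ∀ᶠ q in 𝓝 (K.proj x), SignType.sign (c.chart q i) = SignType.sign (c'.chart q i') := by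
  set p := K.proj x with hp
  set a := c.chart p with ha
  have hps := c.mem_source hx
  have hps' := c'.mem_source hx'
  have hat : a ∈ c.chart.target := c.chart.map_source hps
  have hap : c.chart.symm a = p := c.chart.left_inv hps
  -- the `i'`-th coordinate of `c'`, expressed in the coordinates of `c`
  set f : E3 → ℝ := fun v => c'.chart (c.chart.symm v) i' with hf
  set f' : E3 →L[ℝ] ℝ := (EuclideanSpace.proj i' : E3 →L[ℝ] ℝ) ∘L
    (fderiv ℝ c'.chart p ∘L fderiv ℝ c.chart.symm a) with hf'
  have hderiv : HasStrictFDerivAt f f' a := by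
    have h1 : HasStrictFDerivAt c'.chart (fderiv ℝ c'.chart p) (c.chart.symm a) := by
      rw [hap]
      exact c'.hasStrictFDerivAt_chart hps'
    exact (EuclideanSpace.proj i' : E3 →L[ℝ] ℝ).hasStrictFDerivAt.comp a
      (h1.comp a (c.hasStrictFDerivAt_symm hat))
  set l := fderiv ℝ c.chart p (K.normal x) i with hl
  set l' := fderiv ℝ c'.chart p (K.normal x) i' with hl'
  have hlpos : 0 < l := c.normal_pos i x hx
  have hlpos' : 0 < l' := c'.normal_pos i' x hx'
  have hf'w : ∀ w : E3, f' w = (l' / l) * w i := by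
    intro w
    have h1 : f' w = l' * inner ℝ (K.normal x) (fderiv ℝ c.chart.symm a w) :=
      c'.fderiv_chart_apply hx' _
    have h2 : w i = l * inner ℝ (K.normal x) (fderiv ℝ c.chart.symm a w) := by
      have := c.fderiv_chart_apply hx (fderiv ℝ c.chart.symm a w)
      have h3 := c.fderiv_chart_fderiv_symm hat w
      rw [hap] at h3
      rw [← hp, h3] at this
      exact this
    rw [h1, h2]
    field_simp
  have hai : a i = 0 := c.coord_eq_zero hx
  -- `r` replaces the `i`-th coordinate by zero
  set r : E3 → E3 := fun v => v - (v i) • EuclideanSpace.single i (1 : ℝ) with hr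
  have hrc : Continuous r := by fun_prop
  have hri : ∀ v, r v i = 0 := by intro v; simp [hr]
  have hra : r a = a := by simp [hr, hai]
  have hzero : ∀ᶠ v in 𝓝 a, f (r v) = 0 := by
    have hU : c'.sheet i' ∈ 𝓝 x := (c'.isOpen_sheet i').mem_nhds hx'
    have h1 := c.eventually_sheet_mem hx hU
    have hcont : Tendsto c.chart.symm (𝓝 a) (𝓝 p) := by
      have := c.chart.symm.continuousAt (x := a) hat
      rw [ContinuousAt, hap] at this
      exact this
    have h2 : ∀ᶠ v in 𝓝 a, v ∈ c.chart.target ∧ ∀ y ∈ c.sheet i,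
        K.proj y = c.chart.symm v → y ∈ c'.sheet i' :=
      Filter.Eventually.and (c.chart.open_target.mem_nhds hat) (hcont.eventually h1)
    have hrt : Tendsto r (𝓝 a) (𝓝 a) := by
      have := hrc.tendsto a
      rwa [hra] at this
    filter_upwards [hrt.eventually h2] with v hv
    obtain ⟨hv1, hv2⟩ := hv
    have hn : ‖r v‖ < 1 := by
      rw [c.target_eq] at hv1
      simpa using hv1
    obtain ⟨y, hy, hyv⟩ := c.exists_point (c.lt_of_mem hx) hn (hri v)
    have hyp : K.proj y = c.chart.symm (r v) := by rw [← c.symm_coord hy, hyv]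
    have := c'.coord_eq_zero (hv2 y hy hyp)
    rw [coord, hyp] at this
    exact this
  have hrt : Tendsto (fun v => (v, r v)) (𝓝 a) (𝓝 (a, a)) := by
    have : Continuous fun v => (v, r v) := by fun_prop
    have := this.tendsto a
    rwa [hra] at this
  have hκ : 0 < l' / l := div_pos hlpos' hlpos
  have hlo := hrt.eventually (hderiv.isLittleO.def (half_pos hκ))
  have hsign : ∀ᶠ v in 𝓝 a, SignType.sign (v i) = SignType.sign (f v) := by
    filter_upwards [hlo, hzero] with v hv hv0
    have h1 : v - r v = (v i) • EuclideanSpace.single i (1 : ℝ) := by simp [hr]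
    simp only [hv0, h1, hf'w] at hv
    simp only [sub_zero, PiLp.smul_apply, PiLp.single_apply, norm_smul] at hv
    simp at hv
    have hv' := abs_le.1 hv
    rcases lt_trichotomy (v i) 0 with h | h | h
    · rw [abs_of_neg h] at hv'
      rw [sign_neg h, sign_neg (by nlinarith [hv'.2])]
    · rw [h] at hv'
      simp only [abs_zero, mul_zero, neg_zero, sub_zero] at hv'
      rw [h, le_antisymm hv'.2 hv'.1]
    · rw [abs_of_pos h] at hv'
      rw [sign_pos h, sign_pos (by nlinarith [hv'.1])]
  have hct : Tendsto c.chart (𝓝 p) (𝓝 a) := c.chart.continuousAt hps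
  filter_upwards [hct.eventually hsign, c.chart.open_source.mem_nhds hps] with q hq hqs
  rw [hq, hf]
  simp only [c.chart.left_inv hqs]

end SheetChart

end KnottedSurface

/-! ### Components met by connected sets -/

theorem ConnectedComponents.mk_eq_mk_of_isPreconnected {α : Type*} [TopologicalSpace α]
    {A S : Set α} (hS : IsPreconnected S) (hSA : S ⊆ A) {x y : α} (hx : x ∈ S) (hy : y ∈ S) :
    (ConnectedComponents.mk (⟨x, hSA hx⟩ : A)) = ConnectedComponents.mk ⟨y, hSA hy⟩ := by
  have h : IsPreconnected ((↑) ⁻¹' S : Set A) := by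
    rw [← Topology.IsInducing.subtypeVal.isPreconnected_image, Subtype.image_preimage_coe,
      inter_eq_right.2 hSA]
    exact hS
  exact ConnectedComponents.coe_eq_coe'.2 (h.subset_connectedComponent hy hx)

namespace KnottedSurface

variable {F : Type*} [TopologicalSpace F] [ChartedSpace (EuclideanSpace ℝ (Fin 2)) F]

section Values

variable (K : KnottedSurface F) {X : Type*}

open Classical in
/-- The value at `q` of a function on the regions; it is `0` if `q` lies on the projected
surface. -/
noncomputable def regionValue (L : K.Region → ℤ) (q : E3) : ℤ :=
  if h : q ∈ (Set.range K.proj)ᶜ then L (ConnectedComponents.mk ⟨q, h⟩) else 0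

open Classical in
/-- The colour of the semi-sheet through `x`; it is arbitrary if `x` is not regular. -/
noncomputable def colorAt [Nonempty X] (C : K.SemiSheet → X) (x : F) : X :=
  if h : x ∈ K.regularSet then C (ConnectedComponents.mk ⟨x, h⟩) else Classical.arbitrary X

variable {K}

theorem regionValue_eq (L : K.Region → ℤ) {q : E3} (h : q ∈ (Set.range K.proj)ᶜ) :
    K.regionValue L q = L (ConnectedComponents.mk ⟨q, h⟩) := dif_pos h

theorem colorAt_eq [Nonempty X] (C : K.SemiSheet → X) {x : F} (h : x ∈ K.regularSet) :
    K.colorAt C x = C (ConnectedComponents.mk ⟨x, h⟩) := dif_pos h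

theorem colorAt_eq_of_isPreconnected [Nonempty X] (C : K.SemiSheet → X) {S : Set F}
    (hS : IsPreconnected S) (hSA : S ⊆ K.regularSet) {x y : F} (hx : x ∈ S) (hy : y ∈ S) :
    K.colorAt C x = K.colorAt C y := by
  rw [colorAt_eq C (hSA hx), colorAt_eq C (hSA hy),
    ConnectedComponents.mk_eq_mk_of_isPreconnected hS hSA hx hy]

end Values

theorem isPreconnected_octant (a : E3) (P Q : Fin 3 → Prop) :
    IsPreconnected {v : E3 | ‖v‖ < 1 ∧ (∀ l, P l → v l = 0) ∧ ∀ l, Q l → 0 < a l * v l} := by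
  refine Convex.isPreconnected ?_
  have h1 : Convex ℝ {v : E3 | ‖v‖ < 1} := by
    have := convex_ball (0 : E3) 1
    simpa [Metric.ball, dist_zero_right] using this
  have h2 : Convex ℝ {v : E3 | ∀ l, P l → v l = 0} := by
    intro x hx y hy s t _ _ _ l hl
    simp [hx l hl, hy l hl]
  have h3 : Convex ℝ {v : E3 | ∀ l, Q l → 0 < a l * v l} := by
    intro x hx y hy s t hs ht hst l hl
    have h1 := hx l hl
    have h2 := hy l hl
    have h3 : a l * (s • x + t • y) l = s * (a l * x l) + t * (a l * y l) := by
      simp only [PiLp.add_apply, PiLp.smul_apply, smul_eq_mul]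
      ring
    rw [h3]
    rcases hs.eq_or_lt with h | h
    · have : t = 1 := by linarith
      subst h this
      simpa using h2
    · have := mul_pos h h1
      have := mul_nonneg ht h2.le
      linarith
  exact h1.inter (h2.inter h3)

theorem mul_pos_of_sign_eq {a b : ℝ} (ha : a ≠ 0) (h : SignType.sign a = SignType.sign b) :
    0 < a * b := by
  rcases lt_or_gt_of_ne ha with h' | h'
  · rw [sign_neg h', eq_comm, sign_eq_neg_one_iff] at h
    exact mul_pos_of_neg_of_neg h' h
  · rw [sign_pos h', eq_comm, sign_eq_one_iff] at h
    exact mul_pos h' h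

namespace SheetChart

variable {K : KnottedSurface F} {k : ℕ} (c : K.SheetChart k)

theorem regular_of_coord_ne_zero {i : Fin 3} {x : F} (hx : x ∈ c.sheet i)
    (h : ∀ l, l.val < k → l ≠ i → c.coord x l ≠ 0) : x ∈ K.regularSet := by
  refine ⟨c.immersed i x hx, fun y hy => ?_⟩
  obtain ⟨j, hj⟩ := c.exists_sheet (x := y) (hy ▸ c.mem_source hx)
  by_cases hji : j = i
  · subst hji
    exact (c.bijOn_sheet j (c.lt_of_mem hj)).injOn hj hx hy
  · refine absurd (c.coord_eq_zero hj) ?_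
    unfold coord
    rw [hy]
    exact h j (c.lt_of_mem hj) hji

theorem coord_ne_zero_of_regular {i : Fin 3} {x : F} (hx : x ∈ c.sheet i)
    (h : x ∈ K.regularSet) {l : Fin 3} (hl : l.val < k) (hli : l ≠ i) : c.coord x l ≠ 0 := by
  intro h0
  obtain ⟨y, hy, hyx⟩ := c.exists_point hl (c.norm_coord_lt hx) h0
  have : K.proj y = K.proj x := by rw [← c.symm_coord hy, hyx, c.symm_coord hx]
  have := h.2 y this
  subst this
  exact hli (c.eq_of_mem_sheet hy hx)

theorem notMem_range_of_coord_ne_zero {q : E3} (hq : q ∈ c.chart.source)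
    (h : ∀ l : Fin 3, l.val < k → c.chart q l ≠ 0) : q ∈ (Set.range K.proj)ᶜ := by
  rintro ⟨x, rfl⟩
  obtain ⟨i, hi⟩ := c.exists_sheet hq
  exact h i (c.lt_of_mem hi) (c.coord_eq_zero hi)

/-- Points of an octant of a local picture lie in the same region. -/
theorem regionValue_congr (L : K.Region → ℤ) {q q' : E3} (hq : q ∈ c.chart.source)
    (hq' : q' ∈ c.chart.source) (h : ∀ l : Fin 3, l.val < k → c.chart q l ≠ 0 ∧
      SignType.sign (c.chart q l) = SignType.sign (c.chart q' l)) :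
    K.regionValue L q = K.regionValue L q' := by
  set S := {v : E3 | ‖v‖ < 1 ∧ (∀ l : Fin 3, False → v l = 0) ∧
    ∀ l : Fin 3, l.val < k → 0 < c.chart q l * v l} with hS
  have hpre : IsPreconnected (c.chart.symm '' S) := by
    refine (isPreconnected_octant (c.chart q) _ _).image _ ?_
    exact c.chart.continuousOn_symm.mono fun v hv => c.mem_target hv.1
  have hsub : c.chart.symm '' S ⊆ (Set.range K.proj)ᶜ := by
    rintro _ ⟨v, hv, rfl⟩
    refine c.notMem_range_of_coord_ne_zero (c.chart.map_target (c.mem_target hv.1)) ?_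
    intro l hl h0
    rw [c.chart.right_inv (c.mem_target hv.1)] at h0
    have := hv.2.2 l hl
    rw [h0, mul_zero] at this
    exact lt_irrefl _ this
  have h1 : q ∈ c.chart.symm '' S := by
    refine ⟨c.chart q, ⟨c.norm_chart_lt hq, by simp, fun l hl => ?_⟩, c.chart.left_inv hq⟩
    exact mul_self_pos.2 (h l hl).1
  have h2 : q' ∈ c.chart.symm '' S :=
    ⟨c.chart q', ⟨c.norm_chart_lt hq', by simp,
      fun l hl => mul_pos_of_sign_eq (h l hl).1 (h l hl).2⟩, c.chart.left_inv hq'⟩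
  rw [regionValue_eq L (hsub h1), regionValue_eq L (hsub h2),
    ConnectedComponents.mk_eq_mk_of_isPreconnected hpre hsub h1 h2]

/-- Points of a quadrant of a sheet in a local picture lie in a connected set of regular
points. -/
theorem exists_isPreconnected_quadrant [IsManifold (𝓡 2) ∞ F] [CompactSpace F] {i : Fin 3}
    {x y : F} (hx : x ∈ c.sheet i) (hy : y ∈ c.sheet i)
    (h : ∀ l : Fin 3, l.val < k → l ≠ i → c.coord x l ≠ 0 ∧
      SignType.sign (c.coord x l) = SignType.sign (c.coord y l)) :
    ∃ S ⊆ K.regularSet, IsPreconnected S ∧ x ∈ S ∧ y ∈ S := by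
  obtain ⟨σ, hσ, hcont⟩ := c.exists_section (c.lt_of_mem hx)
  set S := {v : E3 | ‖v‖ < 1 ∧ (∀ l : Fin 3, l = i → v l = 0) ∧
    ∀ l : Fin 3, (l.val < k ∧ l ≠ i) → 0 < c.coord x l * v l} with hS
  have hmem : ∀ z ∈ c.sheet i, c.coord z ∈ S → z ∈ σ '' S := by
    intro z hz hzS
    refine ⟨c.coord z, hzS, ?_⟩
    obtain ⟨h1, h2⟩ := hσ (c.coord z) hzS.1 (hzS.2.1 i rfl)
    exact c.eq_of_coord_eq h1 hz h2
  refine ⟨σ '' S, ?_, (isPreconnected_octant (c.coord x) _ _).image _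
    (hcont.mono fun v hv => ⟨hv.1, hv.2.1 i rfl⟩), hmem x hx ?_, hmem y hy ?_⟩
  · rintro _ ⟨v, hv, rfl⟩
    obtain ⟨h1, h2⟩ := hσ v hv.1 (hv.2.1 i rfl)
    refine c.regular_of_coord_ne_zero h1 fun l hl hli h0 => ?_
    have := hv.2.2 l ⟨hl, hli⟩
    rw [← h2, h0, mul_zero] at this
    exact lt_irrefl _ this
  · refine ⟨c.norm_coord_lt hx, ?_, fun l hl => mul_self_pos.2 (h l hl.1 hl.2).1⟩
    rintro l rfl
    exact c.coord_eq_zero hx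
  · refine ⟨c.norm_coord_lt hy, ?_, fun l hl =>
      mul_pos_of_sign_eq (h l hl.1 hl.2).1 (h l hl.1 hl.2).2⟩
    rintro l rfl
    exact c.coord_eq_zero hy

theorem colorAt_congr [IsManifold (𝓡 2) ∞ F] [CompactSpace F] {X : Type*} [Nonempty X]
    (C : K.SemiSheet → X) {i : Fin 3} {x y : F} (hx : x ∈ c.sheet i) (hy : y ∈ c.sheet i)
    (h : ∀ l : Fin 3, l.val < k → l ≠ i → c.coord x l ≠ 0 ∧
      SignType.sign (c.coord x l) = SignType.sign (c.coord y l)) :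
    K.colorAt C x = K.colorAt C y := by
  obtain ⟨S, hS, hpre, h1, h2⟩ := c.exists_isPreconnected_quadrant hx hy h
  exact colorAt_eq_of_isPreconnected C hpre hS h1 h2

theorem center_mem_source : c.center ∈ c.chart.source :=
  c.chart.map_target (c.mem_target (by simp))

theorem chart_center : c.chart c.center = 0 :=
  c.chart.right_inv (c.mem_target (by simp))

theorem eq_center {q : E3} (hq : q ∈ c.chart.source) (h : c.chart q = 0) : q = c.center := by
  rw [SheetChart.center, ← h, c.chart.left_inv hq]

theorem exists_preimage {i : Fin 3} (hi : i.val < k) {q : E3} (hq : q ∈ c.chart.source)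
    (h : c.chart q i = 0) : ∃ x ∈ c.sheet i, K.proj x = q := by
  obtain ⟨x, hx, hxq⟩ := c.exists_point hi (c.norm_chart_lt hq) h
  exact ⟨x, hx, by rw [← c.symm_coord hx, hxq, c.chart.left_inv hq]⟩

theorem eq_of_proj_eq {i : Fin 3} {x y : F} (hx : x ∈ c.sheet i) (hy : y ∈ c.sheet i)
    (h : K.proj x = K.proj y) : x = y :=
  (c.bijOn_sheet i (c.lt_of_mem hx)).injOn hx hy h

end SheetChart

/-! ### Double points -/

/-- `p` is a double point of the projected surface, with over-point `xo` and under-point `xu`. -/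
structure IsDouble (K : KnottedSurface F) (p : E3) (xo xu : F) : Prop where
  proj_over : K.proj xo = p
  proj_under : K.proj xu = p
  height_lt : K.height xu < K.height xo
  eq_or : ∀ y, K.proj y = p → y = xo ∨ y = xu

/-- The double points of the projected surface. -/
def doubleLocus (K : KnottedSurface F) : Set E3 := {p | ∃ xo xu, K.IsDouble p xo xu}

variable {K : KnottedSurface F}

theorem IsDouble.ne {p : E3} {xo xu : F} (h : K.IsDouble p xo xu) : xo ≠ xu := by
  rintro rfl
  exact lt_irrefl _ h.height_lt

theorem IsDouble.unique {p : E3} {xo xu yo yu : F} (h : K.IsDouble p xo xu)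
    (h' : K.IsDouble p yo yu) : xo = yo ∧ xu = yu := by
  have hlt := h'.height_lt
  have hlt' := h.height_lt
  rcases h.eq_or yo h'.proj_over with rfl | rfl <;> rcases h.eq_or yu h'.proj_under with rfl | rfl
  · exact absurd hlt (lt_irrefl _)
  · exact ⟨rfl, rfl⟩
  · exact absurd hlt hlt'.not_gt
  · exact absurd hlt (lt_irrefl _)

namespace SheetChart

variable {k : ℕ} (c : K.SheetChart k)

/-- The points of a coordinate axis that is the intersection of two sheets, and of no other
sheet, are double points. -/
theorem isDouble {i j : Fin 3} (hij : i < j) {xo xu : F} (ho : xo ∈ c.sheet i)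
    (hu : xu ∈ c.sheet j) (heq : K.proj xo = K.proj xu)
    (h : ∀ l : Fin 3, l.val < k → l ≠ i → l ≠ j → c.chart (K.proj xo) l ≠ 0) :
    K.IsDouble (K.proj xo) xo xu := by
  refine ⟨rfl, heq.symm, c.height_lt i j hij xo ho xu hu heq, fun y hy => ?_⟩
  obtain ⟨l, hl⟩ := c.exists_sheet (x := y) (hy ▸ c.mem_source ho)
  by_cases hli : l = i
  · subst hli
    exact Or.inl (c.eq_of_proj_eq hl ho hy)
  by_cases hlj : l = j
  · subst hlj
    exact Or.inr (c.eq_of_proj_eq hl hu (hy.trans heq))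
  refine absurd (c.coord_eq_zero hl) ?_
  rw [coord, hy]
  exact h l (c.lt_of_mem hl) hli hlj

theorem exists_isDouble {i j : Fin 3} (hij : i < j) (hj : j.val < k) {q : E3}
    (hq : q ∈ c.chart.source) (hi0 : c.chart q i = 0) (hj0 : c.chart q j = 0)
    (h : ∀ l : Fin 3, l.val < k → l ≠ i → l ≠ j → c.chart q l ≠ 0) :
    ∃ xo ∈ c.sheet i, ∃ xu ∈ c.sheet j, K.IsDouble q xo xu := by
  obtain ⟨xo, ho, rfl⟩ := c.exists_preimage (lt_trans hij hj) hq hi0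
  obtain ⟨xu, hu, hxu⟩ := c.exists_preimage hj hq hj0
  exact ⟨xo, ho, xu, hu, c.isDouble hij ho hu hxu.symm h⟩

/-- In a local picture, the double points are the points on exactly two coordinate planes. -/
theorem exists_of_isDouble {q : E3} {xo xu : F} (hq : q ∈ c.chart.source)
    (hd : K.IsDouble q xo xu) : ∃ i j : Fin 3, i < j ∧ xo ∈ c.sheet i ∧ xu ∈ c.sheet j ∧
      ∀ l : Fin 3, l.val < k → l ≠ i → l ≠ j → c.chart q l ≠ 0 := by
  obtain ⟨i, hi⟩ := c.exists_sheet (x := xo) (hd.proj_over ▸ hq)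
  obtain ⟨j, hj⟩ := c.exists_sheet (x := xu) (hd.proj_under ▸ hq)
  have heq := hd.proj_over.trans hd.proj_under.symm
  refine ⟨i, j, ?_, hi, hj, fun l hl hli hlj h0 => ?_⟩
  · rcases lt_trichotomy i j with h | rfl | h
    · exact h
    · exact absurd (c.eq_of_proj_eq hi hj heq) hd.ne
    · exact absurd (c.height_lt j i h xu hj xo hi heq.symm) hd.height_lt.not_gt
  · obtain ⟨y, hy, hyq⟩ := c.exists_preimage hl hq h0
    rcases hd.eq_or y hyq with rfl | rfl
    · exact hli (c.eq_of_mem_sheet hy hi)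
    · exact hlj (c.eq_of_mem_sheet hy hj)

end SheetChart

namespace BranchChart

variable (b : K.BranchChart)

theorem mem_target {v : E3} (hv : ‖v‖ < 1) : v ∈ b.chart.target := by
  rw [b.target_eq]
  simpa using hv

theorem center_mem_source : b.center ∈ b.chart.source :=
  b.chart.map_target (b.mem_target (by simp))

theorem chart_center : b.chart b.center = 0 :=
  b.chart.right_inv (b.mem_target (by simp))

theorem mem_surfaceChart_source {x : F} (hx : K.proj x ∈ b.chart.source) :
    x ∈ b.surfaceChart.source := by
  rw [b.source_eq]
  exact hx

theorem proj_mem_source {x : F} (hx : x ∈ b.surfaceChart.source) :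
    K.proj x ∈ b.chart.source := by
  rw [b.source_eq] at hx
  exact hx

theorem chart_proj_apply {x : F} (hx : x ∈ b.surfaceChart.source) :
    b.chart (K.proj x) 0 = b.surfaceChart x 0 ∧
    b.chart (K.proj x) 1 = b.surfaceChart x 1 ^ 2 ∧
    b.chart (K.proj x) 2 = b.surfaceChart x 0 * b.surfaceChart x 1 := by
  rw [b.umbrella x hx]
  simp

theorem eq_of_coords {x y : F} (hx : x ∈ b.surfaceChart.source) (hy : y ∈ b.surfaceChart.source)
    (h0 : b.surfaceChart x 0 = b.surfaceChart y 0)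
    (h1 : b.surfaceChart x 1 = b.surfaceChart y 1) : x = y := by
  refine b.surfaceChart.injOn hx hy ?_
  ext l
  fin_cases l
  · exact h0
  · exact h1

theorem proj_eq_of_coords {x y : F} (hx : x ∈ b.surfaceChart.source)
    (hy : y ∈ b.surfaceChart.source) (h0 : b.surfaceChart x 0 = 0)
    (h0' : b.surfaceChart y 0 = 0)
    (h1 : b.surfaceChart x 1 = - b.surfaceChart y 1) : K.proj x = K.proj y := by
  refine b.chart.injOn (b.proj_mem_source hx) (b.proj_mem_source hy) ?_
  rw [b.umbrella x hx, b.umbrella y hy, h0, h0', h1]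
  simp

/-- Two points of a Whitney umbrella with the same image are mirror images of each other on the
double line. -/
theorem coords_of_proj_eq {x y : F} (hx : x ∈ b.surfaceChart.source) (hne : x ≠ y)
    (h : K.proj x = K.proj y) : b.surfaceChart x 0 = 0 ∧ b.surfaceChart y 0 = 0 ∧
      b.surfaceChart y 1 = - b.surfaceChart x 1 ∧ b.surfaceChart x 1 ≠ 0 := by
  have hy : y ∈ b.surfaceChart.source := b.mem_surfaceChart_source (h ▸ b.proj_mem_source hx)
  obtain ⟨h0, h1, h2⟩ := b.chart_proj_apply hx
  obtain ⟨h0', h1', h2'⟩ := b.chart_proj_apply hy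
  rw [h] at h0 h1 h2
  have e0 : b.surfaceChart x 0 = b.surfaceChart y 0 := h0.symm.trans h0'
  have e1 := sq_eq_sq_iff_eq_or_eq_neg.1 (h1.symm.trans h1')
  have e2 := h2.symm.trans h2'
  have hne1 : b.surfaceChart x 1 ≠ b.surfaceChart y 1 :=
    fun h1 => hne (b.eq_of_coords hx hy e0 h1)
  have e3 : b.surfaceChart y 1 = - b.surfaceChart x 1 := by
    rcases e1 with e1 | e1
    · exact absurd e1 hne1
    · rw [e1, neg_neg]
  have hv : b.surfaceChart x 1 ≠ 0 := by
    intro h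
    rw [h, neg_zero] at e3
    exact hne1 (h.trans e3.symm)
  have e4 : b.surfaceChart x 0 = 0 := by
    rw [← e0, e3] at e2
    have : b.surfaceChart x 0 * b.surfaceChart x 1 = 0 := by linarith
    exact (mul_eq_zero.1 this).resolve_right hv
  exact ⟨e4, e0 ▸ e4, e3, hv⟩

theorem eq_of_proj_eq_center {x y : F} (hx : K.proj x = b.center) (hy : K.proj y = b.center) :
    x = y := by
  by_contra hne
  have hxs := b.mem_surfaceChart_source (hx ▸ b.center_mem_source)
  obtain ⟨-, -, -, h⟩ := b.coords_of_proj_eq hxs hne (hx.trans hy.symm)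
  obtain ⟨-, h1, -⟩ := b.chart_proj_apply hxs
  rw [hx, b.chart_center] at h1
  exact h (by simpa using h1.symm)

end BranchChart

end KnottedSurface

/-! ### The Whitney umbrella -/

/-- The parameter plane of the Whitney umbrella. -/
abbrev E2 : Type := EuclideanSpace ℝ (Fin 2)

/-- The Whitney umbrella `(u, v) ↦ (u, v², u v)`. -/
noncomputable def whitneyUmbrella (w : E2) : E3 := !₂[w 0, (w 1) ^ 2, w 0 * w 1]

theorem contDiff_whitneyUmbrella : ContDiff ℝ ∞ whitneyUmbrella := by
  refine contDiff_euclidean.2 fun i => ?_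
  fin_cases i <;> simp only [whitneyUmbrella] <;> simp <;> fun_prop

theorem hasFDerivAt_whitneyUmbrella (w : E2) :
    HasFDerivAt whitneyUmbrella (fderiv ℝ whitneyUmbrella w) w :=
  (contDiff_whitneyUmbrella.differentiable (by simp) w).hasFDerivAt

theorem fderiv_whitneyUmbrella_apply (w v : E2) :
    fderiv ℝ whitneyUmbrella w v = !₂[v 0, 2 * w 1 * v 1, w 1 * v 0 + w 0 * v 1] := by
  have h (i : Fin 3) : HasFDerivAt (fun w => whitneyUmbrella w i)
      ((EuclideanSpace.proj i : E3 →L[ℝ] ℝ) ∘L fderiv ℝ whitneyUmbrella w) w :=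
    (EuclideanSpace.proj i : E3 →L[ℝ] ℝ).hasFDerivAt.comp w (hasFDerivAt_whitneyUmbrella w)
  have p (i : Fin 2) : HasFDerivAt (fun w : E2 => w i) (EuclideanSpace.proj i : E2 →L[ℝ] ℝ) w :=
    (EuclideanSpace.proj i : E2 →L[ℝ] ℝ).hasFDerivAt
  have e0 := DFunLike.congr_fun ((h 0).unique (p 0)) v
  have e1 := DFunLike.congr_fun ((h 1).unique ((p 1).pow 2)) v
  have e2 := DFunLike.congr_fun ((h 2).unique ((p 0).mul (p 1))) v
  ext i
  fin_cases i
  · simpa using e0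
  · simpa using e1
  · simp at e2 ⊢
    linarith

namespace KnottedSurface

variable {F : Type*} [TopologicalSpace F] [ChartedSpace (EuclideanSpace ℝ (Fin 2)) F]
  {K : KnottedSurface F}

namespace BranchChart

variable (b : K.BranchChart)

theorem chart_proj {x : F} (hx : x ∈ b.surfaceChart.source) :
    b.chart (K.proj x) = whitneyUmbrella (b.surfaceChart x) := b.umbrella x hx

theorem umbrella_mem_target {w : E2} (hw : w ∈ b.surfaceChart.target) :
    whitneyUmbrella w ∈ b.chart.target := by
  have hx := b.surfaceChart.map_target hw
  have := b.chart.map_source (b.proj_mem_source hx)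
  rwa [b.chart_proj hx, b.surfaceChart.right_inv hw] at this

theorem proj_symm {w : E2} (hw : w ∈ b.surfaceChart.target) :
    K.proj (b.surfaceChart.symm w) = b.chart.symm (whitneyUmbrella w) := by
  have hx := b.surfaceChart.map_target hw
  have h := b.chart_proj hx
  rw [b.surfaceChart.right_inv hw] at h
  rw [← h, b.chart.left_inv (b.proj_mem_source hx)]

theorem hasFDerivAt_symm {v : E3} (hv : v ∈ b.chart.target) :
    HasFDerivAt b.chart.symm (fderiv ℝ b.chart.symm v) v :=
  ((b.contDiffOn_symm.contDiffAt (b.chart.open_target.mem_nhds hv)).differentiableAt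
    (by simp)).hasFDerivAt

theorem hasFDerivAt_chart {q : E3} (hq : q ∈ b.chart.source) :
    HasFDerivAt b.chart (fderiv ℝ b.chart q) q :=
  ((b.contDiffOn.contDiffAt (b.chart.open_source.mem_nhds hq)).differentiableAt
    (by simp)).hasFDerivAt

theorem fderiv_chart_fderiv_symm {v : E3} (hv : v ∈ b.chart.target) (w : E3) :
    fderiv ℝ b.chart (b.chart.symm v) (fderiv ℝ b.chart.symm v w) = w := by
  have h1 := (b.hasFDerivAt_chart (b.chart.map_target hv)).comp v (b.hasFDerivAt_symm hv)
  have h2 : HasFDerivAt (b.chart ∘ b.chart.symm) (ContinuousLinearMap.id ℝ E3) v :=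
    (hasFDerivAt_id v).congr_of_eventuallyEq <| by
      filter_upwards [b.chart.open_target.mem_nhds hv] with y hy
      simp [b.chart.right_inv hy]
  exact DFunLike.congr_fun (h1.unique h2) w

theorem fderiv_symm_fderiv_chart {v : E3} (hv : v ∈ b.chart.target) (w : E3) :
    fderiv ℝ b.chart.symm v (fderiv ℝ b.chart (b.chart.symm v) w) = w := by
  have hq := b.chart.map_target hv
  have h0 : HasFDerivAt b.chart.symm (fderiv ℝ b.chart.symm v) (b.chart (b.chart.symm v)) := by
    rw [b.chart.right_inv hv]
    exact b.hasFDerivAt_symm hv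
  have h1 := h0.comp (b.chart.symm v) (b.hasFDerivAt_chart hq)
  have h2 : HasFDerivAt (b.chart.symm ∘ b.chart) (ContinuousLinearMap.id ℝ E3)
      (b.chart.symm v) :=
    (hasFDerivAt_id _).congr_of_eventuallyEq <| by
      filter_upwards [b.chart.open_source.mem_nhds hq] with y hy
      simp [b.chart.left_inv hy]
  exact DFunLike.congr_fun (h1.unique h2) w

/-- The projection of the surface, in the coordinates `(u, v)` of the surface. -/
theorem hasFDerivAt_proj_symm {w : E2} (hw : w ∈ b.surfaceChart.target) :
    HasFDerivAt (K.proj ∘ b.surfaceChart.symm)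
      (fderiv ℝ b.chart.symm (whitneyUmbrella w) ∘L fderiv ℝ whitneyUmbrella w) w := by
  refine ((b.hasFDerivAt_symm (b.umbrella_mem_target hw)).comp w
    (hasFDerivAt_whitneyUmbrella w)).congr_of_eventuallyEq ?_
  filter_upwards [b.surfaceChart.open_target.mem_nhds hw] with y hy
  exact b.proj_symm hy

/-- The conormal of the umbrella at `(u, v)`, as a functional of the coordinates of `ℝ³`. -/
noncomputable def conormal (w : E2) (y : E3) : ℝ :=
  inner ℝ (K.normal (b.surfaceChart.symm w)) (fderiv ℝ b.chart.symm (whitneyUmbrella w) y)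

theorem conormal_eq (w : E2) (y : E3) : b.conormal w y =
    y 0 * b.conormal w (EuclideanSpace.single 0 1) + y 1 * b.conormal w (EuclideanSpace.single 1 1)
      + y 2 * b.conormal w (EuclideanSpace.single 2 1) := by
  have h : y = y 0 • EuclideanSpace.single 0 1 + y 1 • EuclideanSpace.single 1 1 +
      y 2 • EuclideanSpace.single 2 1 := by
    ext i
    fin_cases i <;> simp
  conv_lhs => rw [h]
  simp only [conormal, map_add, map_smul, inner_add_right, inner_smul_right]

variable [IsManifold (𝓡 2) ∞ F]

theorem exists_dprojection_eq {w : E2} (hw : w ∈ b.surfaceChart.target) :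
    ∃ S : E2 →L[ℝ] E2, Function.Bijective S ∧ ∀ v,
      dprojection K.emb (b.surfaceChart.symm w) (S v) =
        fderiv ℝ b.chart.symm (whitneyUmbrella w) (fderiv ℝ whitneyUmbrella w v) := by
  have he : b.surfaceChart.MDifferentiable (𝓡 2) (𝓡 2) :=
    ⟨(contMDiffOn_of_mem_maximalAtlas b.surfaceChart_mem).mdifferentiableOn (by simp),
      (contMDiffOn_symm_of_mem_maximalAtlas b.surfaceChart_mem).mdifferentiableOn (by simp)⟩
  obtain ⟨S, hS, hSb⟩ : ∃ S : E2 →L[ℝ] E2,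
      HasMFDerivAt (𝓡 2) (𝓡 2) b.surfaceChart.symm w S ∧ Function.Bijective S :=
    ⟨mfderiv (𝓡 2) (𝓡 2) b.surfaceChart.symm w, (he.mdifferentiableAt_symm hw).hasMFDerivAt,
      he.symm.mfderiv_bijective hw⟩
  refine ⟨S, hSb, fun v => ?_⟩
  have h1 : HasMFDerivAt (𝓡 2) (𝓡 3) (K.proj ∘ b.surfaceChart.symm) w
      ((dprojection K.emb (b.surfaceChart.symm w)).comp S) :=
    HasMFDerivAt.comp w (K.hasMFDerivAt_proj _) hS
  have h2 : HasFDerivAt (K.proj ∘ b.surfaceChart.symm)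
      ((dprojection K.emb (b.surfaceChart.symm w)).comp S) w := hasMFDerivAt_iff_hasFDerivAt.1 h1
  exact DFunLike.congr_fun (h2.unique (b.hasFDerivAt_proj_symm hw)) v

theorem immersedAt {w : E2} (hw : w ∈ b.surfaceChart.target) (h0 : w ≠ 0) :
    K.ImmersedAt (b.surfaceChart.symm w) := by
  obtain ⟨S, hS, h⟩ := b.exists_dprojection_eq hw
  refine (injective_iff_map_eq_zero _).2 fun y hy => ?_
  obtain ⟨v, rfl⟩ := hS.2 y
  rw [h] at hy
  have h1 : fderiv ℝ whitneyUmbrella w v = 0 := by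
    have := b.fderiv_chart_fderiv_symm (b.umbrella_mem_target hw)
      (fderiv ℝ whitneyUmbrella w v)
    rw [hy, map_zero] at this
    exact this.symm
  rw [fderiv_whitneyUmbrella_apply] at h1
  have e0 : v 0 = 0 := by simpa using congrArg (fun y : E3 => y 0) h1
  have e1 : 2 * w 1 * v 1 = 0 := by simpa using congrArg (fun y : E3 => y 1) h1
  have e2 : w 1 * v 0 + w 0 * v 1 = 0 := by simpa using congrArg (fun y : E3 => y 2) h1
  have e3 : v 1 = 0 := by
    by_contra hv
    refine h0 ?_
    rw [e0] at e2
    ext i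
    fin_cases i
    · simpa [hv] using e2
    · simpa [hv] using e1
  have : v = 0 := by
    ext i
    fin_cases i
    · exact e0
    · exact e3
  rw [this, map_zero]

theorem not_immersedAt_center {x : F} (hx : K.proj x = b.center) : ¬ K.ImmersedAt x := by
  intro himm
  have h0 : whitneyUmbrella 0 = 0 := by
    ext i
    fin_cases i <;> simp [whitneyUmbrella]
  have hx0 : x = b.surfaceChart.symm 0 := by
    refine b.eq_of_proj_eq_center hx ?_
    rw [b.proj_symm b.zero_mem, h0, center]
  subst hx0
  obtain ⟨S, hS, h⟩ := b.exists_dprojection_eq b.zero_mem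
  have h1 := h (EuclideanSpace.single 1 1)
  rw [fderiv_whitneyUmbrella_apply] at h1
  have h2 : (!₂[(EuclideanSpace.single 1 1 : E2) 0, 2 * (0 : E2) 1 * (EuclideanSpace.single 1 1 : E2) 1,
      (0 : E2) 1 * (EuclideanSpace.single 1 1 : E2) 0 +
        (0 : E2) 0 * (EuclideanSpace.single 1 1 : E2) 1] : E3) = 0 := by
    ext i
    fin_cases i <;> simp
  rw [h2, map_zero] at h1
  have h3 := hS.1 (himm (h1.trans (map_zero _).symm) |>.trans (map_zero S).symm)
  have h4 := congrArg (fun y : E2 => y 1) h3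
  simp at h4

/-- The conormal vanishes on the tangent plane, which is spanned by `(1, 0, v)` and
`(0, 2 v, u)`. -/
theorem conormal_tangent {w : E2} (hw : w ∈ b.surfaceChart.target) (h0 : w ≠ 0) :
    b.conormal w (EuclideanSpace.single 0 1) = - (w 1 * b.conormal w (EuclideanSpace.single 2 1)) ∧
    2 * w 1 * b.conormal w (EuclideanSpace.single 1 1) =
      - (w 0 * b.conormal w (EuclideanSpace.single 2 1)) := by
  obtain ⟨S, -, h⟩ := b.exists_dprojection_eq hw
  have key (v : E2) : b.conormal w (fderiv ℝ whitneyUmbrella w v) = 0 := by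
    rw [conormal, ← h]
    exact K.normal_orthogonal _ (b.immersedAt hw h0) _
  have k0 := key (EuclideanSpace.single 0 1)
  have k1 := key (EuclideanSpace.single 1 1)
  rw [fderiv_whitneyUmbrella_apply, conormal_eq] at k0 k1
  simp at k0 k1
  constructor <;> linarith

/-- The conormal is a nonzero multiple of the vector `(-2 v², -u, 2 v)`, which is normal to the
umbrella; here it is paired with that vector. -/
theorem conormal_normal_ne_zero {w : E2} (hw : w ∈ b.surfaceChart.target) (h0 : w ≠ 0) :
    b.conormal w !₂[-2 * w 1 ^ 2, - w 0, 2 * w 1] ≠ 0 := by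
  obtain ⟨h1, h2⟩ := b.conormal_tangent hw h0
  intro hn
  rw [conormal_eq] at hn
  simp at hn
  set α0 := b.conormal w (EuclideanSpace.single 0 1)
  set α1 := b.conormal w (EuclideanSpace.single 1 1)
  set α2 := b.conormal w (EuclideanSpace.single 2 1)
  have hα2 : α2 = 0 := by
    have h3 : α2 * (4 * w 1 ^ 4 + w 0 ^ 2 + 4 * w 1 ^ 2) = 0 := by
      rw [h1] at hn
      linear_combination (2 * w 1) * hn + w 0 * h2
    rcases mul_eq_zero.1 h3 with h3 | h3
    · exact h3
    · exfalso
      apply h0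
      have e1 : w 1 = 0 := by nlinarith [sq_nonneg (w 0), sq_nonneg (w 1), sq_nonneg (w 1 ^ 2)]
      have e0 : w 0 = 0 := by
        rw [e1] at h3
        simpa using h3
      ext i
      fin_cases i
      · exact e0
      · exact e1
  have hα0 : α0 = 0 := by rw [h1, hα2]; simp
  have hα1 : α1 = 0 := by
    rw [hα2, mul_zero, neg_zero] at h2
    rw [hα0, hα2] at hn
    by_contra hne
    apply h0
    have e1 : w 1 = 0 := by simpa [hne] using h2
    have e0 : w 0 = 0 := by simpa [hne] using hn
    ext i
    fin_cases i
    · exact e0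
    · exact e1
  have himm := b.immersedAt hw h0
  have hN := K.norm_normal _ himm
  have hz := b.conormal_eq w
    (fderiv ℝ b.chart (b.chart.symm (whitneyUmbrella w)) (K.normal (b.surfaceChart.symm w)))
  change b.conormal w _ = _ * α0 + _ * α1 + _ * α2 at hz
  rw [hα0, hα1, hα2, conormal, b.fderiv_symm_fderiv_chart (b.umbrella_mem_target hw),
    real_inner_self_eq_norm_sq, hN] at hz
  simp at hz

/-- The normal field is continuous on the punctured parameter disc, which is connected, so that
the two sheets that cross at a double point of the umbrella are cooriented by opposite signs of
the third coordinate. -/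
theorem conormal_mul_conormal_neg {v : ℝ} (hv : 0 < v)
    (hball : Metric.ball (0 : E2) (2 * v) ⊆ b.surfaceChart.target) :
    b.conormal !₂[0, v] (EuclideanSpace.single 2 1) *
      b.conormal !₂[0, -v] (EuclideanSpace.single 2 1) < 0 := by
  -- the half circle of radius `v` joins the two points in the punctured disc
  set p : ℝ → E2 := fun θ => !₂[v * Real.cos θ, v * Real.sin θ] with hp
  have hpc : Continuous p := by
    refine (PiLp.continuous_toLp 2 _).comp ?_
    refine continuous_pi fun i => ?_
    fin_cases i <;> simp <;> fun_prop
  have hpn (θ : ℝ) : ‖p θ‖ = v := by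
    rw [EuclideanSpace.norm_eq, Fin.sum_univ_two]
    simp only [hp, Real.norm_eq_abs, sq_abs]
    have : (v * Real.cos θ) ^ 2 + (v * Real.sin θ) ^ 2 = v ^ 2 := by
      linear_combination v ^ 2 * Real.sin_sq_add_cos_sq θ
    simp only [Matrix.cons_val_zero, Matrix.cons_val_one]
    rw [this, Real.sqrt_sq hv.le]
  have hpt (θ : ℝ) : p θ ∈ b.surfaceChart.target := by
    apply hball
    rw [mem_ball_zero_iff, hpn]
    linarith
  have hp0 (θ : ℝ) : p θ ≠ 0 := by
    intro h
    have := hpn θ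
    rw [h, norm_zero] at this
    exact hv.ne this
  set κ : ℝ → ℝ := fun θ =>
    b.conormal (p θ) !₂[-2 * p θ 1 ^ 2, - p θ 0, 2 * p θ 1] with hκ
  have hκ0 (θ : ℝ) : κ θ ≠ 0 := b.conormal_normal_ne_zero (hpt θ) (hp0 θ)
  have hκc : Continuous κ := by
    have h1 : Continuous fun θ => K.normal (b.surfaceChart.symm (p θ)) := by
      rw [continuous_iff_continuousAt]
      intro θ
      have hs : ContinuousAt (fun θ => b.surfaceChart.symm (p θ)) θ :=
        (b.surfaceChart.symm.continuousAt (hpt θ)).comp hpc.continuousAt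
      refine Tendsto.comp (K.continuousOn_normal _ (b.immersedAt (hpt θ) (hp0 θ)))
        (tendsto_nhdsWithin_iff.2 ⟨hs, Filter.Eventually.of_forall fun θ' => ?_⟩)
      exact b.immersedAt (hpt θ') (hp0 θ')
    have h2 : Continuous fun θ => fderiv ℝ b.chart.symm (whitneyUmbrella (p θ)) := by
      refine (b.contDiffOn_symm.continuousOn_fderiv_of_isOpen b.chart.open_target
        (by simp)).comp_continuous (contDiff_whitneyUmbrella.continuous.comp hpc) fun θ => ?_
      exact b.umbrella_mem_target (hpt θ)
    have h3 : Continuous fun θ => (!₂[-2 * p θ 1 ^ 2, - p θ 0, 2 * p θ 1] : E3) := by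
      refine (PiLp.continuous_toLp 2 _).comp ?_
      refine continuous_pi fun i => ?_
      fin_cases i <;> simp <;> fun_prop
    exact h1.inner (h2.clm_apply h3)
  have hsame : 0 < κ (Real.pi / 2) * κ (-(Real.pi / 2)) := by
    by_contra hneg
    have hneg' : κ (Real.pi / 2) * κ (-(Real.pi / 2)) < 0 :=
      lt_of_le_of_ne (not_lt.1 hneg) (mul_ne_zero (hκ0 _) (hκ0 _))
    have hmem : (0 : ℝ) ∈ κ '' univ := by
      have hpre := isPreconnected_univ.image κ hκc.continuousOn
      rcases mul_neg_iff.1 hneg' with ⟨ha, hb⟩ | ⟨ha, hb⟩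
      · exact hpre.ordConnected.out (mem_image_of_mem _ (mem_univ _))
          (mem_image_of_mem _ (mem_univ _)) ⟨hb.le, ha.le⟩
      · exact hpre.ordConnected.out (mem_image_of_mem _ (mem_univ _))
          (mem_image_of_mem _ (mem_univ _)) ⟨ha.le, hb.le⟩
    obtain ⟨θ, -, hθ⟩ := hmem
    exact hκ0 θ hθ
  have e1 : p (Real.pi / 2) = !₂[0, v] := by simp [hp]
  have e2 : p (-(Real.pi / 2)) = !₂[0, -v] := by simp [hp]
  have t1 := (b.conormal_tangent (hpt (Real.pi / 2)) (hp0 _)).1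
  have t2 := (b.conormal_tangent (hpt (-(Real.pi / 2))) (hp0 _)).1
  simp only [hκ] at hsame
  rw [e1] at hsame t1
  rw [e2] at hsame t2
  rw [conormal_eq, b.conormal_eq !₂[0, -v], t1, t2] at hsame
  simp at hsame
  set x := b.conormal !₂[0, v] (EuclideanSpace.single 2 1)
  set y := b.conormal !₂[0, -v] (EuclideanSpace.single 2 1)
  have e : (2 * v ^ 2 * (v * x) + 2 * v * x) * (-(2 * v ^ 2 * (v * y)) + -(2 * v * y)) =
    -((2 * v * (v ^ 2 + 1)) ^ 2 * (x * y)) := by ring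
  rw [e] at hsame
  have hpos : 0 < (2 * v * (v ^ 2 + 1)) ^ 2 := by positivity
  by_contra hxy
  have := mul_nonneg hpos.le (not_lt.1 hxy)
  linarith

end BranchChart

end KnottedSurface

theorem HasDerivAt.eventually_sign_eq {f : ℝ → ℝ} {d t : ℝ} (hf : HasDerivAt f d t)
    (h0 : f t = 0) (hd : d ≠ 0) :
    ∀ᶠ s in 𝓝 t, SignType.sign (f s) = SignType.sign d * SignType.sign (s - t) := by
  have h := hf.isLittleO.def (half_pos (abs_pos.2 hd))
  filter_upwards [h] with s hs
  simp only [h0, sub_zero, smul_eq_mul, Real.norm_eq_abs] at hs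
  rw [← sign_mul]
  rcases eq_or_ne s t with rfl | hst
  · simp [h0]
  have h1 : |f s - d * (s - t)| < |d * (s - t)| := by
    rw [abs_mul]
    have : 0 < |d| * |s - t| := mul_pos (abs_pos.2 hd) (abs_pos.2 (sub_ne_zero.2 hst))
    rw [mul_comm (s - t) d] at hs
    linarith
  rcases lt_trichotomy (d * (s - t)) 0 with h | h | h
  · rw [abs_of_neg h, abs_lt] at h1
    rw [sign_neg h, sign_neg (by linarith [h1.2])]
  · exact absurd h (mul_ne_zero hd (sub_ne_zero.2 hst))
  · rw [abs_of_pos h, abs_lt] at h1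
    rw [sign_pos h, sign_pos (by linarith [h1.1])]

namespace KnottedSurface

variable {F : Type*} [TopologicalSpace F] [ChartedSpace (EuclideanSpace ℝ (Fin 2)) F]
  {K : KnottedSurface F}

theorem eq_of_proj_eq_of_height_eq {x y : F} (h : K.proj x = K.proj y)
    (h' : K.height x = K.height y) : x = y := by
  refine K.smoothEmbedding.isEmbedding.injective ?_
  ext i
  induction i using Fin.lastCases with
  | last => exact h'
  | cast i => exact congrArg (fun q : E3 => q i) h

namespace BranchChart

variable (b : K.BranchChart)

/-- The double points near a branch point form the ray `(0, v², 0)`. -/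
theorem chart_of_isDouble {q : E3} {xo xu : F} (hq : q ∈ b.chart.source)
    (hd : K.IsDouble q xo xu) : xo ∈ b.surfaceChart.source ∧ xu ∈ b.surfaceChart.source ∧
      ∃ v : ℝ, v ≠ 0 ∧ b.surfaceChart xo = !₂[0, v] ∧ b.surfaceChart xu = !₂[0, -v] ∧
        b.chart q = !₂[0, v ^ 2, 0] := by
  have ho := b.mem_surfaceChart_source (x := xo) (hd.proj_over ▸ hq)
  have hu := b.mem_surfaceChart_source (x := xu) (hd.proj_under ▸ hq)
  obtain ⟨h0, h0', h1, hv⟩ := b.coords_of_proj_eq ho hd.ne (hd.proj_over.trans hd.proj_under.symm)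
  refine ⟨ho, hu, b.surfaceChart xo 1, hv, ?_, ?_, ?_⟩
  · ext i
    fin_cases i
    · exact h0
    · rfl
  · ext i
    fin_cases i
    · exact h0'
    · exact h1
  · rw [← hd.proj_over, b.umbrella xo ho, h0]
    simp

theorem mem_doubleLocus {v : ℝ} (hv : v ≠ 0) (h : !₂[0, v] ∈ b.surfaceChart.target)
    (h' : !₂[0, -v] ∈ b.surfaceChart.target) :
    b.chart.symm !₂[0, v ^ 2, 0] ∈ K.doubleLocus := by
  have hp : K.proj (b.surfaceChart.symm !₂[0, v]) = b.chart.symm !₂[0, v ^ 2, 0] := by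
    rw [b.proj_symm h]
    simp [whitneyUmbrella]
  have hp' : K.proj (b.surfaceChart.symm !₂[0, -v]) = b.chart.symm !₂[0, v ^ 2, 0] := by
    rw [b.proj_symm h']
    simp [whitneyUmbrella]
  have hs := b.surfaceChart.map_target h
  have hs' := b.surfaceChart.map_target h'
  have hcoord := b.surfaceChart.right_inv h
  have hcoord' := b.surfaceChart.right_inv h'
  set x := b.surfaceChart.symm !₂[0, v]
  set y := b.surfaceChart.symm !₂[0, -v]
  have hxy : x ≠ y := by
    intro hxy
    rw [hxy, hcoord'] at hcoord
    have : -v = v := by simpa using congrArg (fun w : E2 => w 1) hcoord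
    exact hv (by linarith)
  have hor : ∀ z, K.proj z = b.chart.symm !₂[0, v ^ 2, 0] → z = x ∨ z = y := by
    intro z hz
    by_contra hne
    rw [not_or] at hne
    obtain ⟨-, h1, h2, -⟩ := b.coords_of_proj_eq hs (Ne.symm hne.1) (hp.trans hz.symm)
    have hzs := b.mem_surfaceChart_source (x := z) (by rw [hz, ← hp]; exact b.proj_mem_source hs)
    refine hne.2 (b.eq_of_coords hzs hs' ?_ ?_)
    · rw [h1, hcoord']
      rfl
    · rw [h2, hcoord, hcoord']
      rfl
  rcases lt_trichotomy (K.height x) (K.height y) with hh | hh | hh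
  · exact ⟨y, x, hp', hp, hh, fun z hz => (hor z hz).symm⟩
  · exact absurd (eq_of_proj_eq_of_height_eq (hp.trans hp'.symm) hh) hxy
  · exact ⟨x, y, hp, hp', hh, hor⟩

theorem isPreconnected_half {δ : ℝ} (hball : Metric.ball (0 : E2) δ ⊆ b.surfaceChart.target)
    (s : ℝ) : IsPreconnected (b.surfaceChart.symm '' {w : E2 | ‖w‖ < δ ∧ 0 < s * w 0}) := by
  refine IsPreconnected.image (Convex.isPreconnected ?_) _
    (b.surfaceChart.continuousOn_symm.mono fun w hw => hball (by simpa using hw.1))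
  have h1 : Convex ℝ {w : E2 | ‖w‖ < δ} := by
    have := convex_ball (0 : E2) δ
    simpa [Metric.ball, dist_zero_right] using this
  have h2 : Convex ℝ {w : E2 | 0 < s * w 0} := by
    refine convex_halfSpace_gt (𝕜 := ℝ) (f := fun w : E2 => s * w 0) ⟨?_, ?_⟩ 0
    · intro x y
      simp [mul_add]
    · intro c x
      simp
      ring
  exact h1.inter h2

variable [IsManifold (𝓡 2) ∞ F]

theorem half_subset_regularSet {δ : ℝ}
    (hball : Metric.ball (0 : E2) δ ⊆ b.surfaceChart.target) (s : ℝ) :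
    b.surfaceChart.symm '' {w : E2 | ‖w‖ < δ ∧ 0 < s * w 0} ⊆ K.regularSet := by
  rintro _ ⟨w, ⟨hw, hs⟩, rfl⟩
  have hwt : w ∈ b.surfaceChart.target := hball (by simpa using hw)
  have hw0 : w 0 ≠ 0 := by
    intro h
    rw [h, mul_zero] at hs
    exact lt_irrefl _ hs
  refine ⟨b.immersedAt hwt fun h => hw0 (by rw [h]; rfl), fun y hy => ?_⟩
  by_contra hne
  have := (b.coords_of_proj_eq (b.surfaceChart.map_target hwt) (Ne.symm hne) hy.symm).1
  rw [b.surfaceChart.right_inv hwt] at this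
  exact hw0 this

theorem conormal_opposite {v δ : ℝ} (hv : v ≠ 0) (hvδ : 2 * |v| ≤ δ)
    (hball : Metric.ball (0 : E2) δ ⊆ b.surfaceChart.target) :
    b.conormal !₂[0, v] (EuclideanSpace.single 2 1) *
      b.conormal !₂[0, -v] (EuclideanSpace.single 2 1) < 0 := by
  rcases lt_or_gt_of_ne hv with h | h
  · rw [abs_of_neg h] at hvδ
    have := b.conormal_mul_conormal_neg (v := -v) (by linarith)
      ((Metric.ball_subset_ball hvδ).trans hball)
    rw [neg_neg] at this
    linarith
  · rw [abs_of_pos h] at hvδ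
    exact b.conormal_mul_conormal_neg h ((Metric.ball_subset_ball hvδ).trans hball)

/-- The derivative, at a double point of the umbrella, of the coordinate that vanishes on one sheet
when one moves along the other sheet in the direction of `u`. -/
theorem hasDerivAt_coord_symm (c : K.SheetChart 2) {v δ : ℝ} (hv : v ≠ 0)
    (hvδ : |v| < δ) (hball : Metric.ball (0 : E2) δ ⊆ b.surfaceChart.target) {i : Fin 3} {x : F}
    (hx : x ∈ c.sheet i) (hxv : x = b.surfaceChart.symm !₂[0, v]) :
    HasDerivAt (fun u : ℝ => c.coord (b.surfaceChart.symm !₂[u, -v]) i)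
      (-(2 * v * fderiv ℝ c.chart (K.proj x) (K.normal x) i *
        b.conormal !₂[0, v] (EuclideanSpace.single 2 1))) 0 := by
  have hmem (s : ℝ) (hs : |s| = |v|) : (!₂[0, s] : E2) ∈ b.surfaceChart.target := by
    apply hball
    rw [mem_ball_zero_iff, EuclideanSpace.norm_eq, Fin.sum_univ_two]
    simpa [Real.sqrt_sq_eq_abs, hs] using hvδ
  have hneg := hmem (-v) (abs_neg v)
  have hpos := hmem v rfl
  have hU : whitneyUmbrella !₂[0, -v] = whitneyUmbrella !₂[0, v] := by
    simp [whitneyUmbrella]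
  have hproj : K.proj (b.surfaceChart.symm !₂[0, -v]) = K.proj x := by
    rw [hxv, b.proj_symm hneg, b.proj_symm hpos, hU]
  have hline : HasDerivAt (fun u : ℝ => (!₂[u, -v] : E2)) (EuclideanSpace.single 0 1) 0 := by
    have h1 : HasDerivAt (fun u : ℝ => u • (EuclideanSpace.single 0 1 : E2) + !₂[0, -v])
        ((1 : ℝ) • EuclideanSpace.single 0 1) 0 :=
      ((hasDerivAt_id (0 : ℝ)).smul_const _).add_const _
    rw [one_smul] at h1
    refine h1.congr_of_eventuallyEq (Filter.Eventually.of_forall fun u => ?_)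
    ext l
    fin_cases l <;> simp
  have h1 := (b.hasFDerivAt_proj_symm hneg).comp_hasDerivAt (0 : ℝ) hline
  have h2 : HasFDerivAt c.chart (fderiv ℝ c.chart (K.proj x))
      ((K.proj ∘ b.surfaceChart.symm) !₂[0, -v]) := by
    rw [Function.comp_apply, hproj]
    exact (c.hasStrictFDerivAt_chart (c.mem_source hx)).hasFDerivAt
  have h3 := (EuclideanSpace.proj i : E3 →L[ℝ] ℝ).hasFDerivAt.comp_hasDerivAt (0 : ℝ)
    (h2.comp_hasDerivAt (0 : ℝ) h1)
  refine h3.congr_deriv ?_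
  have h6 := c.fderiv_chart_apply hx (fderiv ℝ b.chart.symm (whitneyUmbrella !₂[0, -v])
    (fderiv ℝ whitneyUmbrella !₂[0, -v] (EuclideanSpace.single 0 1)))
  refine h6.trans ?_
  rw [hU, fderiv_whitneyUmbrella_apply]
  have h4 := b.conormal_eq !₂[0, v] !₂[(EuclideanSpace.single 0 1 : E2) 0,
    2 * (!₂[0, -v] : E2) 1 * (EuclideanSpace.single 0 1 : E2) 1,
    (!₂[0, -v] : E2) 1 * (EuclideanSpace.single 0 1 : E2) 0 +
      (!₂[0, -v] : E2) 0 * (EuclideanSpace.single 0 1 : E2) 1]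
  have h5 := (b.conormal_tangent hpos fun h => hv (by simpa using congrArg (fun w : E2 => w 1) h)).1
  rw [h5] at h4
  rw [conormal, ← hxv] at h4
  rw [h4]
  simp
  ring

/-- At a double point near a branch point, the sides of the two sheets are joined in such a way
that the semi-sheets on the positive sides coincide, and so do those on the negative sides. -/
theorem exists_paired_sides (c : K.SheetChart 2) {δ : ℝ}
    (hball : Metric.ball (0 : E2) δ ⊆ b.surfaceChart.target) {q : E3} {xo xu : F}
    (hd : K.IsDouble q xo xu) (ho : xo ∈ c.sheet 0) (hu : xu ∈ c.sheet 1)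
    (hq : q ∈ b.chart.source) (hδ : 4 * b.chart q 1 < δ ^ 2) (hδ0 : 0 < δ) :
    ∃ oP ∈ c.sheet 0, ∃ oN ∈ c.sheet 0, ∃ uP ∈ c.sheet 1, ∃ uN ∈ c.sheet 1,
      0 < c.coord oP 1 ∧ c.coord oN 1 < 0 ∧ 0 < c.coord uP 0 ∧ c.coord uN 0 < 0 ∧
      (∃ S ⊆ K.regularSet, IsPreconnected S ∧ oP ∈ S ∧ uP ∈ S) ∧
      ∃ S ⊆ K.regularSet, IsPreconnected S ∧ oN ∈ S ∧ uN ∈ S := by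
  obtain ⟨hos, hus, v, hv, hov, huv, hqv⟩ := b.chart_of_isDouble hq hd
  have hq1 : b.chart q 1 = v ^ 2 := by rw [hqv]; rfl
  have hvδ : 2 * |v| < δ := by
    refine lt_of_pow_lt_pow_left₀ 2 hδ0.le ?_
    rw [mul_pow, sq_abs]
    linarith
  have hvδ' : |v| < δ := by linarith [abs_nonneg v]
  have hos' : xo = b.surfaceChart.symm !₂[0, v] := by rw [← hov, b.surfaceChart.left_inv hos]
  have hus' : xu = b.surfaceChart.symm !₂[0, -v] := by rw [← huv, b.surfaceChart.left_inv hus]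
  have d0 := b.hasDerivAt_coord_symm c hv hvδ' hball ho hos'
  have d1 := b.hasDerivAt_coord_symm c (neg_ne_zero.2 hv) (by rwa [abs_neg]) hball hu hus'
  rw [neg_neg] at d1
  set lo := fderiv ℝ c.chart (K.proj xo) (K.normal xo) 0
  set lu := fderiv ℝ c.chart (K.proj xu) (K.normal xu) 1
  have hlo : 0 < lo := c.normal_pos 0 xo ho
  have hlu : 0 < lu := c.normal_pos 1 xu hu
  set α := b.conormal !₂[0, v] (EuclideanSpace.single 2 1)
  set β := b.conormal !₂[0, -v] (EuclideanSpace.single 2 1)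
  have hαβ : α * β < 0 := b.conormal_opposite hv hvδ.le hball
  -- the derivatives, in the direction of `u`, of the coordinate of the over-sheet along the
  -- under-sheet and of the coordinate of the under-sheet along the over-sheet
  set e0 := -(2 * v * lo * α)
  set e1 := -(2 * -v * lu * β)
  have hprod : 0 < e0 * e1 := by
    have : e0 * e1 = (4 * v ^ 2 * lo * lu) * (-(α * β)) := by ring
    rw [this]
    have : 0 < v ^ 2 := by positivity
    have : 0 < -(α * β) := by linarith
    positivity
  have z0 : c.coord (b.surfaceChart.symm !₂[0, -v]) 0 = 0 := by
    have : K.proj xu = K.proj xo := hd.proj_under.trans hd.proj_over.symm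
    rw [← hus', SheetChart.coord, this]
    exact c.coord_eq_zero ho
  have z1 : c.coord (b.surfaceChart.symm !₂[0, v]) 1 = 0 := by
    have : K.proj xo = K.proj xu := hd.proj_over.trans hd.proj_under.symm
    rw [← hos', SheetChart.coord, this]
    exact c.coord_eq_zero hu
  have s0 := d0.eventually_sign_eq z0 (left_ne_zero_of_mul hprod.ne')
  have s1 := d1.eventually_sign_eq z1 (right_ne_zero_of_mul hprod.ne')
  have hsheet (s : ℝ) (hs : |s| = |v|) (i : Fin 3)
      (hi : b.surfaceChart.symm !₂[0, s] ∈ c.sheet i) : ∀ᶠ u : ℝ in 𝓝 0,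
        ‖(!₂[u, s] : E2)‖ < δ ∧ b.surfaceChart.symm !₂[u, s] ∈ c.sheet i := by
    have hc : Continuous fun u : ℝ => (!₂[u, s] : E2) := by
      refine (PiLp.continuous_toLp 2 _).comp ?_
      refine continuous_pi fun i => ?_
      fin_cases i <;> simp <;> fun_prop
    have hn : ‖(!₂[0, s] : E2)‖ < δ := by
      rw [EuclideanSpace.norm_eq, Fin.sum_univ_two]
      simpa [Real.sqrt_sq_eq_abs, hs] using hvδ'
    have h1 : ∀ᶠ u : ℝ in 𝓝 0, ‖(!₂[u, s] : E2)‖ < δ :=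
      hc.norm.continuousAt.eventually_lt continuousAt_const hn
    have h2 : ContinuousAt (fun u : ℝ => b.surfaceChart.symm !₂[u, s]) 0 :=
      (b.surfaceChart.symm.continuousAt (hball (by simpa using hn))).comp
        (f := fun u : ℝ => (!₂[u, s] : E2)) hc.continuousAt
    exact h1.and (h2.eventually ((c.isOpen_sheet i).mem_nhds hi))
  have hall := (s0.and s1).and
    ((hsheet v rfl 0 (hos' ▸ ho)).and (hsheet (-v) (abs_neg v) 1 (hus' ▸ hu)))
  have hneg : Tendsto (fun u : ℝ => -u) (𝓝 0) (𝓝 0) := by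
    simpa using (continuous_neg (G := ℝ)).tendsto 0
  -- a small `u > 0` such that the four points `(±u, ±v)` lie on the four half-sheets
  obtain ⟨u, ⟨⟨⟨a0, a1⟩, ⟨an, as⟩, an', as'⟩, ⟨⟨b0, b1⟩, ⟨bn, bs⟩, bn', bs'⟩⟩, hu0⟩ :=
    (((hall.and (hneg.eventually hall)).filter_mono
      (nhdsWithin_le_nhds (s := Ioi (0 : ℝ)))).and self_mem_nhdsWithin).exists
  have hu0 : 0 < u := hu0
  rw [sub_zero, sign_pos hu0, mul_one] at a0 a1
  rw [sub_zero, sign_neg (neg_lt_zero.2 hu0)] at b0 b1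
  -- no double points have `u ≠ 0`, so that each half-disc lies in one semi-sheet
  have hS (s t : ℝ) (hs : 0 < s * t) (h1 : ‖(!₂[t, v] : E2)‖ < δ)
      (h2 : ‖(!₂[t, -v] : E2)‖ < δ) :
      ∃ S ⊆ K.regularSet, IsPreconnected S ∧ b.surfaceChart.symm !₂[t, v] ∈ S ∧
        b.surfaceChart.symm !₂[t, -v] ∈ S :=
    ⟨_, b.half_subset_regularSet hball s, b.isPreconnected_half hball s,
      mem_image_of_mem _ ⟨h1, by simpa using hs⟩, mem_image_of_mem _ ⟨h2, by simpa using hs⟩⟩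
  rcases pos_and_pos_or_neg_and_neg_of_mul_pos hprod with ⟨p0, p1⟩ | ⟨p0, p1⟩
  · rw [sign_pos p0] at a0 b0
    rw [sign_pos p1] at a1 b1
    exact ⟨_, as, _, bs, _, as', _, bs', sign_eq_one_iff.1 a1,
      sign_eq_neg_one_iff.1 (by simpa using b1), sign_eq_one_iff.1 a0,
      sign_eq_neg_one_iff.1 (by simpa using b0), hS 1 u (by simpa) an an',
      hS (-1) (-u) (by simpa) bn bn'⟩
  · rw [sign_neg p0] at a0 b0
    rw [sign_neg p1] at a1 b1
    exact ⟨_, bs, _, as, _, bs', _, as', sign_eq_one_iff.1 (by simpa using b1),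
      sign_eq_neg_one_iff.1 a1, sign_eq_one_iff.1 (by simpa using b0),
      sign_eq_neg_one_iff.1 a0, hS (-1) (-u) (by simpa) bn bn',
      hS 1 u (by simpa) an an'⟩

end BranchChart

end KnottedSurface

namespace BrokenSurfaceDiagram

variable {F : Type*} [TopologicalSpace F] [ChartedSpace (EuclideanSpace ℝ (Fin 2)) F]
  (D : BrokenSurfaceDiagram F)

/-! ### Local pictures centred at regular, double and triple points -/

theorem exists_chart_two {p : E3} {xo xu : F} (h : D.IsDouble p xo xu) :
    ∃ c : D.SheetChart 2, c.center = p ∧ xo ∈ c.sheet 0 ∧ xu ∈ c.sheet 1 := by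
  rcases D.generic p ⟨xo, h.proj_over⟩ with ⟨k, hk, c, hc⟩ | ⟨b, hb⟩
  · have hs : p ∈ c.chart.source := hc ▸ c.center_mem_source
    have h0 : c.chart p = 0 := by rw [← hc, c.chart_center]
    obtain ⟨i, j, hij, hi, hj, hl⟩ := c.exists_of_isDouble hs h
    have hjk := c.lt_of_mem hj
    obtain rfl : k = 2 := by
      by_contra hk2
      have hk1 := hk.2
      have hk3 : k = 3 := by
        have : i.val < j.val := hij
        omega
      subst hk3
      obtain ⟨l, hli, hlj⟩ : ∃ l : Fin 3, l ≠ i ∧ l ≠ j := by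
        clear * -
        decide +revert
      exact hl l l.isLt hli hlj (by rw [h0]; rfl)
    obtain rfl : j = 1 := by
      have : i.val < j.val := hij
      apply Fin.ext
      simp
      omega
    obtain rfl : i = 0 := by
      have : i.val < 1 := hij
      apply Fin.ext
      simp
      omega
    exact ⟨c, hc, hi, hj⟩
  · exact absurd (b.eq_of_proj_eq_center (h.proj_over.trans hb.symm)
      (h.proj_under.trans hb.symm)) h.ne

theorem exists_chart_one [IsManifold (𝓡 2) ∞ F] {x : F} (hx : x ∈ D.regularSet) :
    ∃ c : D.SheetChart 1, c.center = D.proj x ∧ x ∈ c.sheet 0 := by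
  rcases D.generic (D.proj x) ⟨x, rfl⟩ with ⟨k, hk, c, hc⟩ | ⟨b, hb⟩
  · have hs : D.proj x ∈ c.chart.source := hc ▸ c.center_mem_source
    obtain ⟨i, hi⟩ := c.exists_sheet hs
    have huniq (l : Fin 3) (hl : l.val < k) : l = i := by
      by_contra hli
      refine c.coord_ne_zero_of_regular hi hx hl hli ?_
      rw [KnottedSurface.SheetChart.coord, ← hc, c.chart_center]
      rfl
    have hi0 : i = 0 := (huniq 0 hk.1).symm
    subst hi0
    obtain rfl : k = 1 := by
      by_contra hk1
      have hk2 := hk.1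
      exact absurd (huniq 1 (by simp; omega)) (by decide)
    exact ⟨c, hc, hi⟩
  · exact absurd hx.1 (b.not_immersedAt_center hb.symm)

variable {D}

theorem exists_three_preimages (c : D.SheetChart 3) :
    ∃ x : Fin 3 → F, Function.Injective x ∧ ∀ i, D.proj (x i) = c.center := by
  have h (i : Fin 3) : ∃ x ∈ c.sheet i, D.proj x = c.center :=
    c.exists_preimage i.isLt c.center_mem_source (by rw [c.chart_center]; rfl)
  choose x hx hxc using h
  refine ⟨x, fun i j hij => ?_, hxc⟩
  exact c.eq_of_mem_sheet (hx i) (hij ▸ hx j)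

/-- A triple point in a local picture is its centre. -/
theorem eq_center_of_triple {k : ℕ} (c : D.SheetChart k) {p : E3} (hp : p ∈ D.triplePoints)
    (hs : p ∈ c.chart.source) : 3 ≤ k ∧ p = c.center := by
  obtain ⟨c', rfl⟩ := hp
  obtain ⟨x, hinj, hx⟩ := exists_three_preimages c'
  have h (i : Fin 3) : ∃ j, x i ∈ c.sheet j := c.exists_sheet (by rw [hx i]; exact hs)
  choose j hj using h
  have hjinj : Function.Injective j := by
    intro a b hab
    refine hinj (c.eq_of_proj_eq (hj a) (hab ▸ hj b) ?_)
    rw [hx, hx]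
  have hjsurj : Function.Surjective j := Finite.surjective_of_injective hjinj
  have h0 (l : Fin 3) : l.val < k ∧ c.chart c'.center l = 0 := by
    obtain ⟨i, rfl⟩ := hjsurj l
    refine ⟨c.lt_of_mem (hj i), ?_⟩
    rw [← hx i]
    exact c.coord_eq_zero (hj i)
  refine ⟨(h0 2).1, c.eq_center hs ?_⟩
  ext l
  exact (h0 l).2

theorem triple_notMem_branch (b : D.BranchChart) {p : E3} (hp : p ∈ D.triplePoints) :
    p ∉ b.chart.source := by
  obtain ⟨c', rfl⟩ := hp
  obtain ⟨x, hinj, hx⟩ := exists_three_preimages c'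
  intro hs
  have hxs (i : Fin 3) : x i ∈ b.surfaceChart.source :=
    b.mem_surfaceChart_source (by rw [hx i]; exact hs)
  have h1 := b.coords_of_proj_eq (hxs 0) (hinj.ne (by decide : (0 : Fin 3) ≠ 1))
    ((hx 0).trans (hx 1).symm)
  have h2 := b.coords_of_proj_eq (hxs 0) (hinj.ne (by decide : (0 : Fin 3) ≠ 2))
    ((hx 0).trans (hx 2).symm)
  refine absurd (b.eq_of_coords (hxs 1) (hxs 2) ?_ ?_) (hinj.ne (by decide))
  · rw [h1.2.1, h2.2.1]
  · rw [h1.2.2.1, h2.2.2.1]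

variable (D)

/-! ### Finiteness -/

theorem finite_triplePoints [IsManifold (𝓡 2) ∞ F] [CompactSpace F] :
    D.triplePoints.Finite := by
  have hsub : D.triplePoints ⊆ Set.range D.proj := by
    rintro p ⟨c, rfl⟩
    obtain ⟨x, -, hx⟩ := exists_three_preimages c
    exact ⟨x 0, hx 0⟩
  have hloc : ∀ p ∈ Set.range D.proj, ∃ U ∈ 𝓝 p, D.triplePoints ∩ U ⊆ {p} := by
    intro p hp
    rcases D.generic p hp with ⟨k, -, c, rfl⟩ | ⟨b, rfl⟩
    · exact ⟨c.chart.source, c.chart.open_source.mem_nhds c.center_mem_source,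
        fun q hq => (eq_center_of_triple c hq.1 hq.2).2⟩
    · exact ⟨b.chart.source, b.chart.open_source.mem_nhds b.center_mem_source,
        fun q hq => absurd hq.2 (triple_notMem_branch b hq.1)⟩
  choose! U hU hUp using hloc
  obtain ⟨t, ht, htU⟩ := (isCompact_range D.continuous_proj).elim_nhds_subcover U hU
  refine t.finite_toSet.subset fun q hq => ?_
  obtain ⟨p, hp, hqp⟩ := mem_iUnion₂.1 (htU (hsub hq))
  have : q = p := hUp p (ht p hp) ⟨hq, hqp⟩
  exact this ▸ hp

/-- Near each point of the surface, finitely many data determine the semi-sheet. -/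
theorem exists_local_semiSheet_data [IsManifold (𝓡 2) ∞ F] [CompactSpace F] (x : F) :
    ∃ U ∈ 𝓝 x, ∃ f : F → (Fin 3 → Prop) × (Fin 3 → SignType), ∀ y ∈ U, ∀ z ∈ U,
      y ∈ D.regularSet → z ∈ D.regularSet → f y = f z →
        ∃ S ⊆ D.regularSet, IsPreconnected S ∧ y ∈ S ∧ z ∈ S := by
  rcases D.generic (D.proj x) ⟨x, rfl⟩ with ⟨k, -, c, hc⟩ | ⟨b, hb⟩
  · refine ⟨D.proj ⁻¹' c.chart.source, ?_, fun y => (fun i => y ∈ c.sheet i,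
      fun i => SignType.sign (c.coord y i)), ?_⟩
    · exact D.continuous_proj.continuousAt
        (c.chart.open_source.mem_nhds (hc ▸ c.center_mem_source))
    · intro y hy z hz hyr hzr hf
      obtain ⟨i, hi⟩ := c.exists_sheet hy
      have h1 : (y ∈ c.sheet i) = (z ∈ c.sheet i) := congrFun (congrArg Prod.fst hf) i
      have h2 (l : Fin 3) : SignType.sign (c.coord y l) = SignType.sign (c.coord z l) :=
        congrFun (congrArg Prod.snd hf) l
      exact c.exists_isPreconnected_quadrant hi (h1 ▸ hi) fun l hl hli =>
        ⟨c.coord_ne_zero_of_regular hi hyr hl hli, h2 l⟩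
  · obtain ⟨δ, hδ, hball⟩ := Metric.isOpen_iff.1 b.surfaceChart.open_target 0 b.zero_mem
    have hxs : x ∈ b.surfaceChart.source :=
      b.mem_surfaceChart_source (hb ▸ b.center_mem_source)
    have hx0 : x = b.surfaceChart.symm 0 := by
      refine b.eq_of_proj_eq_center hb.symm ?_
      rw [b.proj_symm b.zero_mem, KnottedSurface.BranchChart.center]
      congr 1
      ext i
      fin_cases i <;> simp [whitneyUmbrella]
    refine ⟨b.surfaceChart.symm '' Metric.ball 0 δ, ?_, fun y => (fun _ => True,
      fun _ => SignType.sign (b.surfaceChart y 0)), ?_⟩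
    · rw [hx0]
      exact b.surfaceChart.symm.image_mem_nhds b.zero_mem (Metric.ball_mem_nhds 0 hδ)
    · rintro _ ⟨v, hv, rfl⟩ _ ⟨w, hw, rfl⟩ hyr hzr hf
      have h2 : SignType.sign (v 0) = SignType.sign (w 0) := by
        have := congrFun (congrArg Prod.snd hf) 0
        simpa only [b.surfaceChart.right_inv (hball hv), b.surfaceChart.right_inv (hball hw)]
          using this
      -- the only point on the line `u = 0` that can be regular is the branch point itself
      have hzero {v : E2} (hv : v ∈ Metric.ball 0 δ)
          (hyr : b.surfaceChart.symm v ∈ D.regularSet) (h0 : v 0 = 0) : v = 0 := by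
        have hn : (!₂[0, -v 1] : E2) ∈ Metric.ball 0 δ := by
          rw [mem_ball_zero_iff, EuclideanSpace.norm_eq, Fin.sum_univ_two] at hv ⊢
          rw [h0] at hv
          simpa using hv
        have h1 := hyr.2 (b.surfaceChart.symm !₂[0, -v 1]) (by
          refine b.proj_eq_of_coords (b.surfaceChart.map_target (hball hn))
            (b.surfaceChart.map_target (hball hv)) ?_ ?_ ?_
          · rw [b.surfaceChart.right_inv (hball hn)]
            rfl
          · rw [b.surfaceChart.right_inv (hball hv)]
            exact h0
          · rw [b.surfaceChart.right_inv (hball hn), b.surfaceChart.right_inv (hball hv)]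
            rfl)
        have h2 := b.surfaceChart.symm.injOn (hball hn) (hball hv) h1
        have h3 : -v 1 = v 1 := by simpa using congrArg (fun w : E2 => w 1) h2
        ext i
        fin_cases i
        · exact h0
        · change v 1 = 0
          linarith
      by_cases h0 : v 0 = 0
      · have h0' : w 0 = 0 := by
          rw [h0, sign_zero, eq_comm, sign_eq_zero_iff] at h2
          exact h2
        have e1 := hzero hv hyr h0
        have e2 := hzero hw hzr h0'
        subst e1 e2
        exact ⟨{b.surfaceChart.symm 0}, singleton_subset_iff.2 hyr, isPreconnected_singleton,
          rfl, rfl⟩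
      · exact ⟨_, b.half_subset_regularSet hball (v 0), b.isPreconnected_half hball (v 0),
          mem_image_of_mem _ ⟨by simpa using hv, mul_self_pos.2 h0⟩,
          mem_image_of_mem _ ⟨by simpa using hw, KnottedSurface.mul_pos_of_sign_eq h0 h2⟩⟩

instance finite_semiSheet [IsManifold (𝓡 2) ∞ F] [CompactSpace F] : Finite D.SemiSheet := by
  choose U hU f hf using D.exists_local_semiSheet_data
  obtain ⟨t, -, htU⟩ := isCompact_univ.elim_nhds_subcover U fun x _ => hU x
  set A : F → Set D.SemiSheet := fun x =>
    ConnectedComponents.mk '' ((↑) ⁻¹' U x : Set D.regularSet) with hA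
  have hfin (x : F) : (A x).Finite := by
    simp only [hA]
    rw [image_eq_range]
    set g : ((↑) ⁻¹' U x : Set D.regularSet) → D.SemiSheet :=
      fun y => ConnectedComponents.mk y.val with hg
    have hfac : g.FactorsThrough fun y => f x y.val.val := by
      intro y z hyz
      obtain ⟨S, hS, hpre, hy, hz⟩ := hf x y.val y.2 z.val z.2 y.val.2 z.val.2 hyz
      exact ConnectedComponents.mk_eq_mk_of_isPreconnected hpre hS hy hz
    rcases isEmpty_or_nonempty D.SemiSheet with hemp | hne
    · exact Set.toFinite _
    obtain ⟨e, he⟩ := (Function.factorsThrough_iff g).1 hfac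
    rw [he]
    exact (Set.finite_range e).subset (Set.range_comp_subset_range _ _)
  have huniv : (univ : Set D.SemiSheet) ⊆ ⋃ x ∈ t, A x := by
    intro s _
    obtain ⟨y, rfl⟩ := ConnectedComponents.surjective_coe s
    obtain ⟨x, hx, hyx⟩ := mem_iUnion₂.1 (htU (mem_univ y.val))
    exact mem_iUnion₂.2 ⟨x, hx, mem_image_of_mem _ hyx⟩
  exact Set.finite_univ_iff.1 ((t.finite_toSet.biUnion fun x _ => hfin x).subset huniv)

theorem finite_coloring [IsManifold (𝓡 2) ∞ F] [CompactSpace F] {X : Type*} [Finite X]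
    (B : TwistedBiquandle X) : Finite (D.Coloring B) :=
  inferInstanceAs (Finite {C : D.SemiSheet → X // D.IsColoring B C})

end BrokenSurfaceDiagram

namespace KnottedSurface.SheetChart

variable {F : Type*} [TopologicalSpace F] [ChartedSpace (EuclideanSpace ℝ (Fin 2)) F]
  {K : KnottedSurface F} {k : ℕ} (c : K.SheetChart k)

/-! ### Moving along coordinate lines -/

theorem tendsto_line {v d : E3} : Tendsto (fun t : ℝ => v + t • d) (𝓝 0) (𝓝 v) := by
  have : Continuous fun t : ℝ => v + t • d := by fun_prop
  simpa using this.tendsto 0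

/-- One can move a little from `q` in any coordinate direction `d`. -/
theorem exists_move {q : E3} (hq : q ∈ c.chart.source) (d : E3) {P : E3 → Prop}
    (hP : ∀ᶠ q' in 𝓝 q, P q') :
    ∃ t : ℝ, 0 < t ∧ ∃ q' ∈ c.chart.source, c.chart q' = c.chart q + t • d ∧ P q' := by
  have h1 : Tendsto (fun t : ℝ => c.chart.symm (c.chart q + t • d)) (𝓝 0) (𝓝 q) := by
    have := (c.chart.symm.continuousAt (c.chart.map_source hq)).tendsto
    rw [c.chart.left_inv hq] at this
    exact this.comp tendsto_line
  have h2 := (tendsto_line (d := d)).eventually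
    (c.chart.open_target.mem_nhds (c.chart.map_source hq))
  obtain ⟨t, ⟨ht1, ht2⟩, ht0⟩ := ((((h1.eventually hP).and h2).filter_mono
    (nhdsWithin_le_nhds (s := Ioi (0 : ℝ)))).and self_mem_nhdsWithin).exists
  exact ⟨t, ht0, _, c.chart.map_target ht2, c.chart.right_inv ht2, ht1⟩

/-- One can move a little on a sheet in any coordinate direction `d` tangent to the sheet. -/
theorem exists_move_sheet [IsManifold (𝓡 2) ∞ F] [CompactSpace F] {i : Fin 3} {x : F}
    (hx : x ∈ c.sheet i) {d : E3} (hd : d i = 0) {P : F → Prop} (hP : ∀ᶠ y in 𝓝 x, P y) :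
    ∃ t : ℝ, 0 < t ∧ ∃ y ∈ c.sheet i, c.coord y = c.coord x + t • d ∧ P y := by
  obtain ⟨t, ht, q, hq, hqd, hqP⟩ :=
    c.exists_move (c.mem_source hx) d (c.eventually_sheet_mem hx hP)
  have hqi : c.chart q i = 0 := by
    rw [hqd]
    have : c.chart (K.proj x) i = 0 := c.coord_eq_zero hx
    simp [this, hd]
  obtain ⟨y, hy, rfl⟩ := c.exists_preimage (c.lt_of_mem hx) hq hqi
  exact ⟨t, ht, y, hy, hqd, hqP y hy rfl⟩

theorem eventually_sign_chart {q : E3} (hq : q ∈ c.chart.source) {l : Fin 3}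
    (h : c.chart q l ≠ 0) :
    ∀ᶠ q' in 𝓝 q, SignType.sign (c.chart q' l) = SignType.sign (c.chart q l) := by
  have hc := c.continuousAt_chart_apply hq l
  rcases lt_or_gt_of_ne h with h | h
  · filter_upwards [hc.eventually_lt continuousAt_const h] with q' hq'
    rw [sign_neg h, sign_neg hq']
  · filter_upwards [continuousAt_const.eventually_lt hc h] with q' hq'
    rw [sign_pos h, sign_pos hq']

end KnottedSurface.SheetChart

namespace BrokenSurfaceDiagram

theorem two_sheets : ∀ l : Fin 3, l.val < 2 → l ≠ 0 → l ≠ 1 → False := by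
  decide

section ColoringRule

variable {F : Type*} [TopologicalSpace F] [ChartedSpace (EuclideanSpace ℝ (Fin 2)) F]
  {D : BrokenSurfaceDiagram F}
  {X : Type*} [Nonempty X] {B : TwistedBiquandle X}

theorem coloring_rule_two (C : D.Coloring B) (c : D.SheetChart 2) {oP oN uP uN : F}
    (hoP : oP ∈ c.sheet 0) (hoP' : 0 < c.coord oP 1) (hoN : oN ∈ c.sheet 0)
    (hoN' : c.coord oN 1 < 0) (huP : uP ∈ c.sheet 1) (huP' : 0 < c.coord uP 0)
    (huN : uN ∈ c.sheet 1) (huN' : c.coord uN 0 < 0) :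
    B.R (D.colorAt C.val uN, D.colorAt C.val oP) =
      (D.colorAt C.val oN, D.colorAt C.val uP) := by
  have h0 {x : F} (hx : x ∈ c.sheet 0) (h : c.coord x 1 ≠ 0) : x ∈ D.regularSet :=
    c.regular_of_coord_ne_zero hx fun l hl hl0 => by
      obtain rfl : l = 1 := by
        clear * - hl hl0
        decide +revert
      exact h
  have h1 {x : F} (hx : x ∈ c.sheet 1) (h : c.coord x 0 ≠ 0) : x ∈ D.regularSet :=
    c.regular_of_coord_ne_zero hx fun l hl hl0 => by
      obtain rfl : l = 0 := by
        clear * - hl hl0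
        decide +revert
      exact h
  rw [KnottedSurface.colorAt_eq _ (h1 huN huN'.ne), KnottedSurface.colorAt_eq _ (h0 hoP hoP'.ne'),
    KnottedSurface.colorAt_eq _ (h0 hoN hoN'.ne), KnottedSurface.colorAt_eq _ (h1 huP huP'.ne')]
  exact C.property c ⟨oP, _⟩ ⟨oN, _⟩ ⟨uP, _⟩ ⟨uN, _⟩ hoP hoP' hoN hoN' huP huP' huN huN'

/-! ### The label of a double point -/

/-- At the double point `p`, the region from which both normals point has Alexander number `ℓ`, the
under-semi-sheet from which the normal of the over-sheet points away has colour `x`, and the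
over-semi-sheet towards which the normal of the under-sheet points has colour `y`. -/
def HasLabel (L : D.AlexanderNumbering) (C : D.Coloring B) (p : E3) (ℓ : ℤ) (x y : X) : Prop :=
  ∃ c : D.SheetChart 2, c.center = p ∧ ∃ q ∈ c.chart.source, ∃ u ∈ c.sheet 1, ∃ o ∈ c.sheet 0,
    c.chart q 0 < 0 ∧ c.chart q 1 < 0 ∧ c.coord u 0 < 0 ∧ 0 < c.coord o 1 ∧
    ℓ = D.regionValue L.toFun q ∧ x = D.colorAt C.val u ∧ y = D.colorAt C.val o

theorem HasLabel.isDouble {L : D.AlexanderNumbering} {C : D.Coloring B} {p : E3} {ℓ : ℤ} {x y : X}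
    (h : HasLabel L C p ℓ x y) : p ∈ D.doubleLocus := by
  obtain ⟨c, rfl, -⟩ := h
  obtain ⟨xo, -, xu, -, hd⟩ := c.exists_isDouble (i := 0) (j := 1) (by decide) (by decide)
    c.center_mem_source (by rw [c.chart_center]; rfl) (by rw [c.chart_center]; rfl)
    (fun l hl h0 h1 => (two_sheets l hl h0 h1).elim)
  exact ⟨xo, xu, hd⟩

end ColoringRule

variable {F : Type*} [TopologicalSpace F] [ChartedSpace (EuclideanSpace ℝ (Fin 2)) F]
  [IsManifold (𝓡 2) ∞ F] [CompactSpace F] {D : BrokenSurfaceDiagram F}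

/-! ### The crossing rule and the colouring rule in an arbitrary local picture -/

theorem regionValue_crossing (L : D.AlexanderNumbering) {k : ℕ} (c : D.SheetChart k) {i : Fin 3}
    (hi : i.val < k) {q q' : E3} (hq : q ∈ c.chart.source) (hq' : q' ∈ c.chart.source)
    (hn : c.chart q i < 0) (hp : 0 < c.chart q' i)
    (h : ∀ l : Fin 3, l.val < k → l ≠ i →
      c.chart q l ≠ 0 ∧ SignType.sign (c.chart q l) = SignType.sign (c.chart q' l)) :
    D.regionValue L.toFun q' = D.regionValue L.toFun q + 1 := by
  set v : E3 := c.chart q - (c.chart q i) • EuclideanSpace.single i (1 : ℝ) with hv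
  have hvi : v i = 0 := by simp [hv]
  have hvl (l : Fin 3) (hl : l ≠ i) : v l = c.chart q l := by simp [hv, hl]
  have hvn : ‖v‖ < 1 := by
    refine lt_of_le_of_lt ?_ (c.norm_chart_lt hq)
    rw [EuclideanSpace.norm_eq, EuclideanSpace.norm_eq]
    refine Real.sqrt_le_sqrt (Finset.sum_le_sum fun l _ => ?_)
    by_cases hl : l = i
    · subst hl
      rw [hvi]
      simp [sq_nonneg]
    · rw [hvl l hl]
  obtain ⟨x, hx, hxv⟩ := c.exists_point hi hvn hvi
  have hreg : x ∈ D.regularSet := c.regular_of_coord_ne_zero hx fun l hl hli => by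
    rw [hxv, hvl l hli]
    exact (h l hl hli).1
  obtain ⟨c₁, hc₁, hx₁⟩ := D.exists_chart_one hreg
  have hs := c.mem_source hx
  have hev : ∀ᶠ r in 𝓝 (D.proj x), r ∈ c₁.chart.source ∧
      SignType.sign (c.chart r i) = SignType.sign (c₁.chart r 0) ∧
      ∀ l : Fin 3, l.val < k → l ≠ i →
        SignType.sign (c.chart r l) = SignType.sign (c.chart q l) := by
    have h1 : ∀ᶠ r in 𝓝 (D.proj x), r ∈ c₁.chart.source :=
      c₁.chart.open_source.mem_nhds (c₁.mem_source hx₁)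
    refine h1.and ((c.eventually_sign_eq c₁ hx hx₁).and ?_)
    refine eventually_all.2 fun l => ?_
    by_cases hl : l.val < k ∧ l ≠ i
    · have hxl : c.chart (D.proj x) l = c.chart q l := by
        rw [← hvl l hl.2, ← hxv]
        rfl
      filter_upwards [c.eventually_sign_chart hs (l := l) (by rw [hxl]; exact (h l hl.1 hl.2).1)]
        with r hr _ _
      rw [hr, hxl]
    · exact Filter.Eventually.of_forall fun r h1 h2 => absurd ⟨h1, h2⟩ hl
  have hxi : c.chart (D.proj x) i = 0 := c.coord_eq_zero hx
  obtain ⟨t, ht, r, hr, hrd, hr1, hrs, hrl⟩ :=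
    c.exists_move hs (-(EuclideanSpace.single i (1 : ℝ))) hev
  obtain ⟨t', ht', r', hr', hrd', hr1', hrs', hrl'⟩ :=
    c.exists_move hs (EuclideanSpace.single i (1 : ℝ)) hev
  have hri : c.chart r i < 0 := by
    rw [hrd]
    simp [hxi, ht]
  have hri' : 0 < c.chart r' i := by
    rw [hrd']
    simp [hxi, ht']
  rw [sign_neg hri, eq_comm, sign_eq_neg_one_iff] at hrs
  rw [sign_pos hri', eq_comm, sign_eq_one_iff] at hrs'
  have hmem := c₁.notMem_range_of_coord_ne_zero hr1 (by
    intro l hl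
    obtain rfl : l = 0 := Fin.ext (by simpa using hl)
    exact hrs.ne)
  have hmem' := c₁.notMem_range_of_coord_ne_zero hr1' (by
    intro l hl
    obtain rfl : l = 0 := Fin.ext (by simpa using hl)
    exact hrs'.ne')
  have hcross := L.crossing c₁ ⟨r', hmem'⟩ ⟨r, hmem⟩ hr1' hrs' hr1 hrs
  rw [← KnottedSurface.regionValue_eq L.toFun hmem,
    ← KnottedSurface.regionValue_eq L.toFun hmem'] at hcross
  have e1 : D.regionValue L.toFun q = D.regionValue L.toFun r := by
    refine c.regionValue_congr L.toFun hq hr fun l hl => ?_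
    by_cases hli : l = i
    · subst hli
      exact ⟨hn.ne, by rw [sign_neg hn, sign_neg hri]⟩
    · exact ⟨(h l hl hli).1, (hrl l hl hli).symm⟩
  have e2 : D.regionValue L.toFun r' = D.regionValue L.toFun q' := by
    refine c.regionValue_congr L.toFun hr' hq' fun l hl => ?_
    by_cases hli : l = i
    · subst hli
      exact ⟨hri'.ne', by rw [sign_pos hp, sign_pos hri']⟩
    · have h1 := hrl' l hl hli
      refine ⟨fun h0 => ?_, by rw [h1, (h l hl hli).2]⟩
      rw [h0, sign_zero, eq_comm, sign_eq_zero_iff] at h1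
      exact (h l hl hli).1 h1
  rw [← e2, hcross, e1]

/-- Near a double point, two local pictures have points in common in the region from which both
normals point and on all four half-sheets, and agree there on the signs of the coordinates that
belong to the two sheets. -/
theorem exists_common_points {k : ℕ} (c : D.SheetChart k) {i j : Fin 3} (hij : i ≠ j)
    {xo xu : F} (ho : xo ∈ c.sheet i) (hu : xu ∈ c.sheet j) (heq : D.proj xo = D.proj xu)
    (h : ∀ l : Fin 3, l.val < k → l ≠ i → l ≠ j → c.chart (D.proj xo) l ≠ 0)
    (c' : D.SheetChart 2) (ho' : xo ∈ c'.sheet 0) (hu' : xu ∈ c'.sheet 1) :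
    (∃ q ∈ c.chart.source, q ∈ c'.chart.source ∧ c.chart q i < 0 ∧ c.chart q j < 0 ∧
      c'.chart q 0 < 0 ∧ c'.chart q 1 < 0 ∧ ∀ l : Fin 3, l.val < k → l ≠ i → l ≠ j →
        SignType.sign (c.chart q l) = SignType.sign (c.chart (D.proj xo) l)) ∧
    (∀ d : ℝ, ∃ o ∈ c.sheet i, o ∈ c'.sheet 0 ∧
      SignType.sign (c.coord o j) = SignType.sign d ∧
      SignType.sign (c'.coord o 1) = SignType.sign d ∧ ∀ l : Fin 3, l.val < k → l ≠ i → l ≠ j →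
        SignType.sign (c.coord o l) = SignType.sign (c.chart (D.proj xo) l)) ∧
    (∀ d : ℝ, ∃ u ∈ c.sheet j, u ∈ c'.sheet 1 ∧
      SignType.sign (c.coord u i) = SignType.sign d ∧
      SignType.sign (c'.coord u 0) = SignType.sign d ∧ ∀ l : Fin 3, l.val < k → l ≠ i → l ≠ j →
        SignType.sign (c.coord u l) = SignType.sign (c.chart (D.proj xo) l)) := by
  have hs := c.mem_source ho
  have hs' := c'.mem_source ho'
  have hi0 : c.chart (D.proj xo) i = 0 := c.coord_eq_zero ho
  have hj0 : c.chart (D.proj xo) j = 0 := by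
    rw [heq]
    exact c.coord_eq_zero hu
  have hev : ∀ᶠ q in 𝓝 (D.proj xo), q ∈ c'.chart.source ∧
      SignType.sign (c.chart q i) = SignType.sign (c'.chart q 0) ∧
      SignType.sign (c.chart q j) = SignType.sign (c'.chart q 1) ∧
      ∀ l : Fin 3, l.val < k → l ≠ i → l ≠ j →
        SignType.sign (c.chart q l) = SignType.sign (c.chart (D.proj xo) l) := by
    have h1 : ∀ᶠ r in 𝓝 (D.proj xo), r ∈ c'.chart.source :=
      c'.chart.open_source.mem_nhds hs'
    have h2 := c.eventually_sign_eq c' hu hu'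
    rw [← heq] at h2
    refine h1.and ((c.eventually_sign_eq c' ho ho').and (h2.and ?_))
    refine eventually_all.2 fun l => ?_
    by_cases hl : l.val < k ∧ l ≠ i ∧ l ≠ j
    · filter_upwards [c.eventually_sign_chart hs (h l hl.1 hl.2.1 hl.2.2)] with r hr _ _ _
      exact hr
    · exact Filter.Eventually.of_forall fun r h1 h2 h3 => absurd ⟨h1, h2, h3⟩ hl
  have hsign (t d : ℝ) (ht : 0 < t) : SignType.sign (t * d) = SignType.sign d := by
    rw [sign_mul, sign_pos ht, one_mul]
  refine ⟨?_, fun d => ?_, fun d => ?_⟩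
  · obtain ⟨t, ht, q, hq, hqd, hq', h0, h1, hl⟩ := c.exists_move hs
      (-(EuclideanSpace.single i (1 : ℝ)) - EuclideanSpace.single j (1 : ℝ)) hev
    have e0 : c.chart q i < 0 := by
      rw [hqd]
      simp [hi0, hij, ht]
    have e1 : c.chart q j < 0 := by
      rw [hqd]
      simp [hj0, hij.symm, ht]
    refine ⟨q, hq, hq', e0, e1, ?_, ?_, hl⟩
    · rwa [sign_neg e0, eq_comm, sign_eq_neg_one_iff] at h0
    · rwa [sign_neg e1, eq_comm, sign_eq_neg_one_iff] at h1
  · have hev' : ∀ᶠ y in 𝓝 xo, y ∈ c'.sheet 0 ∧ _ :=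
      Filter.Eventually.and ((c'.isOpen_sheet 0).mem_nhds ho')
        (D.continuous_proj.continuousAt.eventually hev)
    obtain ⟨t, ht, y, hy, hyd, hy', hys, h0, h1, hl⟩ := c.exists_move_sheet ho
      (d := EuclideanSpace.single j d) (by simp [hij]) hev'
    have e : c.coord y j = t * d := by
      rw [hyd, KnottedSurface.SheetChart.coord]
      simp [hj0]
    have e' : SignType.sign (c.coord y j) = SignType.sign d := by rw [e, hsign t d ht]
    exact ⟨y, hy, hy', e', h1.symm.trans e', hl⟩
  · have hev' : ∀ᶠ y in 𝓝 xu, y ∈ c'.sheet 1 ∧ _ :=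
      Filter.Eventually.and ((c'.isOpen_sheet 1).mem_nhds hu')
        (D.continuous_proj.continuousAt.eventually (heq ▸ hev))
    obtain ⟨t, ht, y, hy, hyd, hy', hys, h0, h1, hl⟩ := c.exists_move_sheet hu
      (d := EuclideanSpace.single i d) (by simp [hij.symm]) hev'
    have e : c.coord y i = t * d := by
      rw [hyd, KnottedSurface.SheetChart.coord, ← heq]
      simp [hi0]
    have e' : SignType.sign (c.coord y i) = SignType.sign d := by rw [e, hsign t d ht]
    exact ⟨y, hy, hy', e', h0.symm.trans e', heq ▸ hl⟩

variable {X : Type*} [Nonempty X] {B : TwistedBiquandle X}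

/-- The colouring rule along a coordinate axis of an arbitrary local picture. -/
theorem coloring_rule (C : D.Coloring B) {k : ℕ} (c : D.SheetChart k) {i j : Fin 3} (hij : i < j)
    (hj : j.val < k) {p : E3} (hp : p ∈ c.chart.source) (hpi : c.chart p i = 0)
    (hpj : c.chart p j = 0)
    (h : ∀ l : Fin 3, l.val < k → l ≠ i → l ≠ j → c.chart p l ≠ 0) {oP oN uP uN : F}
    (hoP : oP ∈ c.sheet i) (hoP' : 0 < c.coord oP j) (hoN : oN ∈ c.sheet i)
    (hoN' : c.coord oN j < 0) (huP : uP ∈ c.sheet j) (huP' : 0 < c.coord uP i)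
    (huN : uN ∈ c.sheet j) (huN' : c.coord uN i < 0)
    (hsign : ∀ x ∈ ({oP, oN, uP, uN} : Set F), ∀ l : Fin 3, l.val < k → l ≠ i → l ≠ j →
      SignType.sign (c.coord x l) = SignType.sign (c.chart p l)) :
    B.R (D.colorAt C.val uN, D.colorAt C.val oP) =
      (D.colorAt C.val oN, D.colorAt C.val uP) := by
  obtain ⟨xo, ho, xu, hu, hd⟩ := c.exists_isDouble hij hj hp hpi hpj h
  obtain ⟨c', -, ho', hu'⟩ := D.exists_chart_two hd
  have hpo := hd.proj_over
  subst hpo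
  obtain ⟨-, hO, hU⟩ := exists_common_points c hij.ne ho hu hd.proj_under.symm h c' ho' hu'
  have key (a : Fin 3) (b : Fin 3) (hab : ∀ l, l ≠ a → l = b ∨ (l ≠ i ∧ l ≠ j)) {x y : F}
      (hx : x ∈ c.sheet a) (hy : y ∈ c.sheet a) {d : ℝ} (hd : d ≠ 0)
      (hxb : SignType.sign (c.coord x b) = SignType.sign d)
      (hyb : SignType.sign (c.coord y b) = SignType.sign d)
      (hxl : ∀ l : Fin 3, l.val < k → l ≠ i → l ≠ j →
        SignType.sign (c.coord x l) = SignType.sign (c.chart (D.proj xo) l))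
      (hyl : ∀ l : Fin 3, l.val < k → l ≠ i → l ≠ j →
        SignType.sign (c.coord y l) = SignType.sign (c.chart (D.proj xo) l)) :
      D.colorAt C.val x = D.colorAt C.val y := by
    refine c.colorAt_congr C.val hx hy fun l hl hla => ?_
    rcases hab l hla with rfl | ⟨hli, hlj⟩
    · refine ⟨fun h0 => ?_, hxb.trans hyb.symm⟩
      rw [h0, sign_zero, eq_comm, sign_eq_zero_iff] at hxb
      exact hd hxb
    · refine ⟨fun h0 => ?_, (hxl l hl hli hlj).trans (hyl l hl hli hlj).symm⟩
      have h1 := hxl l hl hli hlj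
      rw [h0, sign_zero, eq_comm, sign_eq_zero_iff] at h1
      exact h l hl hli hlj h1
  have hi' : ∀ l, l ≠ i → l = j ∨ (l ≠ i ∧ l ≠ j) := fun l hl => by tauto
  have hj' : ∀ l, l ≠ j → l = i ∨ (l ≠ i ∧ l ≠ j) := fun l hl => by tauto
  obtain ⟨oP₁, a1, a2, a3, a4, a5⟩ := hO 1
  obtain ⟨oN₁, b1, b2, b3, b4, b5⟩ := hO (-1)
  obtain ⟨uP₁, d1, d2, d3, d4, d5⟩ := hU 1
  obtain ⟨uN₁, e1, e2, e3, e4, e5⟩ := hU (-1)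
  rw [key i j hi' hoP a1 one_ne_zero (by rw [sign_pos hoP', sign_one]) a3
      (hsign oP (by simp)) a5,
    key i j hi' hoN b1 (neg_ne_zero.2 one_ne_zero)
      (by rw [sign_neg hoN', sign_neg (by norm_num)]) b3 (hsign oN (by simp)) b5,
    key j i hj' huP d1 one_ne_zero (by rw [sign_pos huP', sign_one]) d3
      (hsign uP (by simp)) d5,
    key j i hj' huN e1 (neg_ne_zero.2 one_ne_zero)
      (by rw [sign_neg huN', sign_neg (by norm_num)]) e3 (hsign uN (by simp)) e5]
  have hneg : SignType.sign (-1 : ℝ) = -1 := sign_neg (by norm_num)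
  rw [sign_one] at a4 d4
  rw [hneg] at b4 e4
  exact coloring_rule_two C c' a2 (sign_eq_one_iff.1 a4) b2 (sign_eq_neg_one_iff.1 b4)
    d2 (sign_eq_one_iff.1 d4) e2 (sign_eq_neg_one_iff.1 e4)

theorem exists_hasLabel (L : D.AlexanderNumbering) (C : D.Coloring B) {p : E3} {xo xu : F}
    (hd : D.IsDouble p xo xu) : ∃ ℓ x y, HasLabel L C p ℓ x y := by
  obtain ⟨c, hc, ho, hu⟩ := D.exists_chart_two hd
  have hpo := hd.proj_over
  subst hpo
  obtain ⟨⟨q, hq, -, q0, q1, -⟩, hO, hU⟩ := exists_common_points c (by decide : (0 : Fin 3) ≠ 1)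
    ho hu hd.proj_under.symm (fun l hl h0 h1 => (two_sheets l hl h0 h1).elim) c ho hu
  obtain ⟨o, o1, -, o2, -⟩ := hO 1
  obtain ⟨u, u1, -, u2, -⟩ := hU (-1)
  rw [sign_one, sign_eq_one_iff] at o2
  rw [sign_neg (by norm_num : (-1 : ℝ) < 0), sign_eq_neg_one_iff] at u2
  exact ⟨_, _, _, c, hc, q, hq, u, u1, o, o1, q0, q1, u2, o2, rfl, rfl, rfl⟩

/-- The label of a double point can be read off in any local picture. -/
theorem HasLabel.eq {L : D.AlexanderNumbering} {C : D.Coloring B} {p : E3} {ℓ : ℤ} {x y : X}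
    (hlab : HasLabel L C p ℓ x y) {k : ℕ} (c : D.SheetChart k) {i j : Fin 3} (hij : i < j)
    (hj : j.val < k) (hp : p ∈ c.chart.source) (hpi : c.chart p i = 0) (hpj : c.chart p j = 0)
    (h : ∀ l : Fin 3, l.val < k → l ≠ i → l ≠ j → c.chart p l ≠ 0) {q : E3} {o u : F}
    (hq : q ∈ c.chart.source) (hqi : c.chart q i < 0) (hqj : c.chart q j < 0)
    (hql : ∀ l : Fin 3, l.val < k → l ≠ i → l ≠ j →
      SignType.sign (c.chart q l) = SignType.sign (c.chart p l))
    (hu : u ∈ c.sheet j) (hui : c.coord u i < 0)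
    (hul : ∀ l : Fin 3, l.val < k → l ≠ i → l ≠ j →
      SignType.sign (c.coord u l) = SignType.sign (c.chart p l))
    (ho : o ∈ c.sheet i) (hoj : 0 < c.coord o j)
    (hol : ∀ l : Fin 3, l.val < k → l ≠ i → l ≠ j →
      SignType.sign (c.coord o l) = SignType.sign (c.chart p l)) :
    ℓ = D.regionValue L.toFun q ∧ x = D.colorAt C.val u ∧ y = D.colorAt C.val o := by
  obtain ⟨xo, hxo, xu, hxu, hd⟩ := c.exists_isDouble hij hj hp hpi hpj h
  obtain ⟨c', hc', r, hr, w, hw, z, hz, r0, r1, w0, z1, rfl, rfl, rfl⟩ := hlab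
  have hp' : p ∈ c'.chart.source := hc' ▸ c'.center_mem_source
  obtain ⟨a, b, hab, ha, hb, -⟩ := c'.exists_of_isDouble hp' hd
  have hb2 := c'.lt_of_mem hb
  have hab' : a.val < b.val := hab
  obtain rfl : a = 0 := Fin.ext (by simp; omega)
  obtain rfl : b = 1 := Fin.ext (by simp; simp at hab'; omega)
  have hpo := hd.proj_over
  subst hpo
  obtain ⟨⟨s, hs, hs', s0, s1, s0', s1', hsl⟩, hO, hU⟩ :=
    exists_common_points c hij.ne hxo hxu hd.proj_under.symm h c' ha hb
  obtain ⟨o₁, o1, o2, o3, o4, o5⟩ := hO 1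
  obtain ⟨u₁, u1, u2, u3, u4, u5⟩ := hU (-1)
  rw [sign_one, sign_eq_one_iff] at o3 o4
  rw [sign_neg (by norm_num : (-1 : ℝ) < 0), sign_eq_neg_one_iff] at u3 u4
  have hne {s : ℝ} {l : Fin 3} (hl : l.val < k) (hli : l ≠ i) (hlj : l ≠ j)
      (hs : SignType.sign s = SignType.sign (c.chart (D.proj xo) l)) : s ≠ 0 := by
    intro h0
    rw [h0, sign_zero, eq_comm, sign_eq_zero_iff] at hs
    exact h l hl hli hlj hs
  refine ⟨?_, ?_, ?_⟩
  · refine (c'.regionValue_congr L.toFun hr hs' fun l hl => ?_).trans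
      (c.regionValue_congr L.toFun hs hq fun l hl => ?_)
    · obtain rfl | rfl : l = 0 ∨ l = 1 := by
        clear * - hl
        decide +revert
      · exact ⟨r0.ne, by rw [sign_neg r0, sign_neg s0']⟩
      · exact ⟨r1.ne, by rw [sign_neg r1, sign_neg s1']⟩
    · by_cases hli : l = i
      · subst hli
        exact ⟨s0.ne, by rw [sign_neg s0, sign_neg hqi]⟩
      by_cases hlj : l = j
      · subst hlj
        exact ⟨s1.ne, by rw [sign_neg s1, sign_neg hqj]⟩
      have := hsl l hl hli hlj
      exact ⟨hne hl hli hlj this, this.trans (hql l hl hli hlj).symm⟩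
  · refine (c'.colorAt_congr C.val hw u2 fun l hl hl1 => ?_).trans
      (c.colorAt_congr C.val u1 hu fun l hl hlj => ?_)
    · obtain rfl : l = 0 := by
        clear * - hl hl1
        decide +revert
      exact ⟨w0.ne, by rw [sign_neg w0, sign_neg u4]⟩
    · by_cases hli : l = i
      · subst hli
        exact ⟨u3.ne, by rw [sign_neg u3, sign_neg hui]⟩
      have := u5 l hl hli hlj
      exact ⟨hne hl hli hlj this, this.trans (hul l hl hli hlj).symm⟩
  · refine (c'.colorAt_congr C.val hz o2 fun l hl hl1 => ?_).trans
      (c.colorAt_congr C.val o1 ho fun l hl hli => ?_)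
    · obtain rfl : l = 1 := by
        clear * - hl hl1
        decide +revert
      exact ⟨z1.ne', by rw [sign_pos z1, sign_pos o4]⟩
    · by_cases hlj : l = j
      · subst hlj
        exact ⟨o3.ne', by rw [sign_pos o3, sign_pos hoj]⟩
      have := o5 l hl hli hlj
      exact ⟨hne hl hli hlj this, this.trans (hol l hl hli hlj).symm⟩

theorem HasLabel.unique {L : D.AlexanderNumbering} {C : D.Coloring B} {p : E3} {ℓ ℓ' : ℤ}
    {x x' y y' : X} (h : HasLabel L C p ℓ x y) (h' : HasLabel L C p ℓ' x' y') :
    ℓ = ℓ' ∧ x = x' ∧ y = y' := by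
  obtain ⟨c, rfl, q, hq, u, hu, o, ho, q0, q1, u0, o1, rfl, rfl, rfl⟩ := h
  have := h'.eq c (i := 0) (j := 1) (by decide) (by decide) c.center_mem_source
    (by rw [c.chart_center]; rfl) (by rw [c.chart_center]; rfl)
    (fun l h1 h2 h3 => (two_sheets l h1 h2 h3).elim) hq q0 q1
    (fun l h1 h2 h3 => (two_sheets l h1 h2 h3).elim) hu u0
    (fun l h1 h2 h3 => (two_sheets l h1 h2 h3).elim) ho o1
    (fun l h1 h2 h3 => (two_sheets l h1 h2 h3).elim)
  exact ⟨this.1.symm, this.2.1.symm, this.2.2.symm⟩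

/-- Near a branch point, the two colours of a label form a degenerate pair. -/
theorem HasLabel.degenerate {L : D.AlexanderNumbering} {C : D.Coloring B} {p : E3} {ℓ : ℤ}
    {x y : X} (h : HasLabel L C p ℓ x y) (b : D.BranchChart) {δ : ℝ} (hδ : 0 < δ)
    (hball : Metric.ball (0 : E2) δ ⊆ b.surfaceChart.target) (hp : p ∈ b.chart.source)
    (hpδ : 4 * b.chart p 1 < δ ^ 2) : B.R (x, y) = (x, y) := by
  obtain ⟨xo, xu, hd⟩ := h.isDouble
  obtain ⟨c, hc, ho, hu⟩ := D.exists_chart_two hd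
  obtain ⟨oP, hoP, oN, hoN, uP, huP, uN, huN, h1, h2, h3, h4, ⟨S, hS, hSc, hS1, hS2⟩,
    S', hS', hSc', hS1', hS2'⟩ := b.exists_paired_sides c hball hd ho hu hp hpδ hδ
  have hrule := coloring_rule_two C c hoP h1 hoN h2 huP h3 huN h4
  rw [← KnottedSurface.colorAt_eq_of_isPreconnected C.val hSc hS hS1 hS2,
    KnottedSurface.colorAt_eq_of_isPreconnected C.val hSc' hS' hS1' hS2'] at hrule
  obtain ⟨⟨q, hq, -, q0, q1, -⟩, -⟩ := exists_common_points c (by decide : (0 : Fin 3) ≠ 1)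
    ho hu (hd.proj_over.trans hd.proj_under.symm) (fun l hl h0 h1 => (two_sheets l hl h0 h1).elim) c ho hu
  obtain ⟨-, rfl, rfl⟩ := h.unique
    ⟨c, hc, q, hq, uN, huN, oP, hoP, q0, q1, h4, h1, rfl, rfl, rfl⟩
  exact hrule

end BrokenSurfaceDiagram

/-! ### Jumps of piecewise constant functions along oriented curves -/

theorem eventually_nhdsWithin_Ioi_iff_exists_Ioo {t : ℝ} {P : ℝ → Prop} :
    (∀ᶠ u in 𝓝[>] t, P u) ↔ ∃ c > t, ∀ u ∈ Ioo t c, P u := by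
  rw [Filter.Eventually, mem_nhdsGT_iff_exists_Ioo_subset]
  rfl

theorem eventually_nhdsWithin_Iio_iff_exists_Ioo {t : ℝ} {P : ℝ → Prop} :
    (∀ᶠ u in 𝓝[<] t, P u) ↔ ∃ c < t, ∀ u ∈ Ioo c t, P u := by
  rw [Filter.Eventually, mem_nhdsLT_iff_exists_Ioo_subset]
  rfl

/-- For a piecewise constant function on an interval, the sum of the jumps is the difference of the
values at the two ends. -/
theorem sum_jump_Ioo {g ρ lam : ℝ → ℤ} {a b : ℝ} (hab : a < b) {α β : ℤ} (T : Finset ℝ)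
    (hT : ∀ t ∈ T, t ∈ Ioo a b)
    (hρ : ∀ t ∈ Ioo a b, ∀ᶠ u in 𝓝[>] t, g u = ρ t)
    (hl : ∀ t ∈ Ioo a b, ∀ᶠ u in 𝓝[<] t, g u = lam t)
    (hTc : ∀ t ∈ Ioo a b, t ∉ T → ρ t = lam t)
    (hα : ∀ᶠ u in 𝓝[>] a, g u = α) (hβ : ∀ᶠ u in 𝓝[<] b, g u = β) :
    ∑ t ∈ T, (ρ t - lam t) = β - α := by
  classical
  have hconst {c d : ℝ} {x : ℤ} (h : ∀ u ∈ Ioo c d, g u = x) {t : ℝ} (ht : t ∈ Ioo c d)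
      (ht' : t ∈ Ioo a b) : ρ t = x ∧ lam t = x := by
    have hn : Ioo c d ∈ 𝓝 t := Ioo_mem_nhds ht.1 ht.2
    obtain ⟨u, hu1, hu2⟩ := ((hρ t ht').and (mem_nhdsWithin_of_mem_nhds hn)).exists
    obtain ⟨v, hv1, hv2⟩ := ((hl t ht').and (mem_nhdsWithin_of_mem_nhds hn)).exists
    exact ⟨hu1.symm.trans (h u hu2), hv1.symm.trans (h v hv2)⟩
  -- the right limit, corrected by the jumps up to `t`, does not depend on `t`
  set Df : ℝ → ℤ := fun t => ∑ u ∈ T, if u ≤ t then ρ u - lam u else 0 with hDf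
  have hloc : ∀ t ∈ Ioo a b, ∀ᶠ u in 𝓝 t, ρ u - Df u = ρ t - Df t := by
    intro t ht
    have hmem : Ioo a b ∈ 𝓝 t := Ioo_mem_nhds ht.1 ht.2
    obtain ⟨c, hc, hgc⟩ := eventually_nhdsWithin_Ioi_iff_exists_Ioo.1 (hρ t ht)
    obtain ⟨d, hd, hgd⟩ := eventually_nhdsWithin_Iio_iff_exists_Ioo.1 (hl t ht)
    filter_upwards [hmem, Ioo_mem_nhds hd hc] with u hu hu'
    rcases lt_trichotomy u t with hut | rfl | hut
    · have e1 : ρ u = lam t := (hconst hgd ⟨hu'.1, hut⟩ hu).1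
      have e2 : Df t = Df u + ∑ v ∈ T, if v = t then ρ t - lam t else 0 := by
        rw [hDf, ← Finset.sum_add_distrib]
        refine Finset.sum_congr rfl fun v hv => ?_
        rcases lt_trichotomy v t with h | rfl | h
        · rcases le_or_gt v u with h' | h'
          · simp [h.le, h', h.ne]
          · have := hconst hgd ⟨hu'.1.trans h', h⟩ (hT v hv)
            simp [h.le, h'.not_ge, h.ne, this.1, this.2]
        · simp [hut]
        · simp [h.not_ge, (hut.trans h).not_ge, h.ne']
      have e3 : (∑ v ∈ T, if v = t then ρ t - lam t else 0) = ρ t - lam t := by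
        rw [Finset.sum_ite_eq']
        split_ifs with h
        · rfl
        · rw [hTc t ht h, sub_self]
      rw [e1, e2, e3]
      ring
    · rfl
    · have e1 : ρ u = ρ t := (hconst hgc ⟨hut, hu'.2⟩ hu).1
      have e2 : Df u = Df t := by
        rw [hDf]
        refine Finset.sum_congr rfl fun v hv => ?_
        rcases le_or_gt v t with h | h
        · simp [h, h.trans hut.le]
        · rcases le_or_gt v u with h' | h'
          · have := hconst hgc ⟨h, h'.trans_lt hu'.2⟩ (hT v hv)
            simp [this.1, this.2]
          · simp [h.not_ge, h'.not_ge]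
      rw [e1, e2]
  have hcont : ContinuousOn (fun t => ρ t - Df t) (Ioo a b) := fun t ht =>
    ((continuousAt_const (y := ρ t - Df t)).congr
      ((hloc t ht).mono fun u hu => hu.symm)).continuousWithinAt
  obtain ⟨c, hc, hgc⟩ := eventually_nhdsWithin_Ioi_iff_exists_Ioo.1 hα
  obtain ⟨d, hd, hgd⟩ := eventually_nhdsWithin_Iio_iff_exists_Ioo.1 hβ
  obtain ⟨s, hs1, hs2⟩ := exists_between (lt_min hc hab)
  obtain ⟨t, ht1, ht2⟩ := exists_between (max_lt hd hab)
  have hsab : s ∈ Ioo a b := ⟨hs1, hs2.trans_le (min_le_right _ _)⟩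
  have htab : t ∈ Ioo a b := ⟨(le_max_right _ _).trans_lt ht1, ht2⟩
  have hsc : s < c := hs2.trans_le (min_le_left _ _)
  have htd : d < t := (le_max_left _ _).trans_lt ht1
  have e := isPreconnected_Ioo.constant hcont hsab htab
  have es : ρ s = α := (hconst hgc ⟨hs1, hsc⟩ hsab).1
  have et : ρ t = β := (hconst hgd ⟨htd, ht2⟩ htab).1
  have eDs : Df s = 0 := by
    refine Finset.sum_eq_zero fun v hv => ?_
    split_ifs with h
    · have := hconst hgc ⟨(hT v hv).1, h.trans_lt hsc⟩ (hT v hv)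
      rw [this.1, this.2, sub_self]
    · rfl
  have eDt : Df t = ∑ u ∈ T, (ρ u - lam u) := by
    refine Finset.sum_congr rfl fun v hv => ?_
    split_ifs with h
    · rfl
    · have := hconst hgd ⟨htd.trans (not_le.1 h), (hT v hv).2⟩ (hT v hv)
      rw [this.1, this.2, sub_self]
  simp only [es, et, eDs, eDt] at e
  linarith

/-- A family of curves in a space, given by the set `carrier` of its points, together with an
orientation: for each point, the filters of the nearby points in front of it and behind it. -/
structure OrientedCurves (E : Type*) [TopologicalSpace E] where
  carrier : Set E
  fwd : E → Filter E
  bwd : E → Filter E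
  fwd_le : ∀ q ∈ carrier, fwd q ≤ 𝓝 q
  bwd_le : ∀ q ∈ carrier, bwd q ≤ 𝓝 q
  fwd_neBot : ∀ q ∈ carrier, (fwd q).NeBot
  bwd_neBot : ∀ q ∈ carrier, (bwd q).NeBot

namespace OrientedCurves

open Classical in
/-- The value that a function takes eventually along a filter, and `0` if there is none. -/
noncomputable def eventualValue {E : Type*} (f : Filter E) (g : E → ℤ) : ℤ :=
  if h : ∃ a, ∀ᶠ x in f, g x = a then h.choose else 0

theorem eventualValue_eq {E : Type*} {f : Filter E} [f.NeBot] {g : E → ℤ} {a : ℤ}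
    (h : ∀ᶠ x in f, g x = a) : eventualValue f g = a := by
  have h' : ∃ a, ∀ᶠ x in f, g x = a := ⟨a, h⟩
  rw [eventualValue, dif_pos h']
  obtain ⟨x, h1, h2⟩ := (h'.choose_spec.and h).exists
  exact h1.symm.trans h2

variable {E : Type*} [TopologicalSpace E] (S : OrientedCurves E)

/-- The jump of `g` when the curve is traversed at `q` in its direction. -/
noncomputable def jump (g : E → ℤ) (q : E) : ℤ :=
  eventualValue (S.fwd q) g - eventualValue (S.bwd q) g

/-- A function is piecewise constant along the curves if at each point it is constant on both
sides, and if it jumps only at finitely many points. -/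
structure PiecewiseConstant (g : E → ℤ) : Prop where
  exists_fwd : ∀ q ∈ S.carrier, ∃ a, ∀ᶠ x in S.fwd q, g x = a
  exists_bwd : ∀ q ∈ S.carrier, ∃ a, ∀ᶠ x in S.bwd q, g x = a
  finite_jump : {q ∈ S.carrier | S.jump g q ≠ 0}.Finite

variable {S}

theorem jump_eq {g : E → ℤ} {q : E} (hq : q ∈ S.carrier) {a b : ℤ}
    (ha : ∀ᶠ x in S.fwd q, g x = a) (hb : ∀ᶠ x in S.bwd q, g x = b) : S.jump g q = a - b := by
  have := S.fwd_neBot q hq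
  have := S.bwd_neBot q hq
  rw [jump, eventualValue_eq ha, eventualValue_eq hb]

theorem jump_eq_zero_of_eventually {g : E → ℤ} {q : E} (hq : q ∈ S.carrier) {a : ℤ}
    (ha : ∀ᶠ x in 𝓝 q, g x = a) : S.jump g q = 0 := by
  rw [jump_eq hq (ha.filter_mono (S.fwd_le q hq)) (ha.filter_mono (S.bwd_le q hq)), sub_self]

theorem PiecewiseConstant.map₂ {g h : E → ℤ} (hg : S.PiecewiseConstant g)
    (hh : S.PiecewiseConstant h) (op : ℤ → ℤ → ℤ) :
    S.PiecewiseConstant fun x => op (g x) (h x) := by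
  refine ⟨fun q hq => ?_, fun q hq => ?_, (hg.finite_jump.union hh.finite_jump).subset ?_⟩
  · obtain ⟨a, ha⟩ := hg.exists_fwd q hq
    obtain ⟨b, hb⟩ := hh.exists_fwd q hq
    exact ⟨op a b, by filter_upwards [ha, hb] with x h1 h2; rw [h1, h2]⟩
  · obtain ⟨a, ha⟩ := hg.exists_bwd q hq
    obtain ⟨b, hb⟩ := hh.exists_bwd q hq
    exact ⟨op a b, by filter_upwards [ha, hb] with x h1 h2; rw [h1, h2]⟩
  · rintro q ⟨hq, hj⟩
    by_contra hne
    simp only [mem_union, mem_ofPred_eq, not_or, not_and, not_not] at hne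
    obtain ⟨a, ha⟩ := hg.exists_fwd q hq
    obtain ⟨a', ha'⟩ := hg.exists_bwd q hq
    obtain ⟨b, hb⟩ := hh.exists_fwd q hq
    obtain ⟨b', hb'⟩ := hh.exists_bwd q hq
    have e1 := hne.1 hq
    have e2 := hne.2 hq
    rw [jump_eq hq ha ha', sub_eq_zero] at e1
    rw [jump_eq hq hb hb', sub_eq_zero] at e2
    subst e1 e2
    refine hj ?_
    rw [jump_eq hq (a := op a b) (b := op a b)
      (by filter_upwards [ha, hb] with x h1 h2; rw [h1, h2])
      (by filter_upwards [ha', hb'] with x h1 h2; rw [h1, h2]), sub_self]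

theorem piecewiseConstant_const (a : ℤ) : S.PiecewiseConstant fun _ => a := by
  have h0 : {q ∈ S.carrier | S.jump (fun _ => a) q ≠ 0} = ∅ := by
    ext q
    simp only [mem_ofPred_eq, mem_empty_iff_false, iff_false, not_and, not_not]
    exact fun hq => jump_eq_zero_of_eventually hq (Filter.Eventually.of_forall fun _ => rfl)
  exact ⟨fun _ _ => ⟨a, Filter.Eventually.of_forall fun _ => rfl⟩,
    fun _ _ => ⟨a, Filter.Eventually.of_forall fun _ => rfl⟩, h0 ▸ Set.finite_empty⟩

variable {M : Type*} [AddCommGroup M]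

variable (S) in
/-- The sum of the jumps of `g`, weighted by `w`. -/
noncomputable def totalJump (w : E → M) (g : E → ℤ) : M :=
  ∑ᶠ q : S.carrier, S.jump g q • w q

theorem PiecewiseConstant.finite_support {g : E → ℤ} (hg : S.PiecewiseConstant g) (w : E → M) :
    (Function.support fun q : S.carrier => S.jump g q • w q).Finite := by
  refine Set.Finite.subset (hg.finite_jump.preimage Subtype.val_injective.injOn) fun q hq => ?_
  refine ⟨q.2, fun h => hq ?_⟩
  simp only [h, zero_smul]

theorem totalJump_sub {g h : E → ℤ} (hg : S.PiecewiseConstant g) (hh : S.PiecewiseConstant h)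
    (w : E → M) : S.totalJump w (fun x => g x - h x) = S.totalJump w g - S.totalJump w h := by
  rw [totalJump, totalJump, totalJump,
    ← finsum_sub_distrib (hg.finite_support w) (hh.finite_support w)]
  refine finsum_congr fun q => ?_
  rw [← sub_smul]
  congr 1
  obtain ⟨a, ha⟩ := hg.exists_fwd q q.2
  obtain ⟨a', ha'⟩ := hg.exists_bwd q q.2
  obtain ⟨b, hb⟩ := hh.exists_fwd q q.2
  obtain ⟨b', hb'⟩ := hh.exists_bwd q q.2
  rw [jump_eq q.2 ha ha', jump_eq q.2 hb hb', jump_eq q.2 (a := a - b) (b := a' - b')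
      (by filter_upwards [ha, hb] with x h1 h2; rw [h1, h2])
      (by filter_upwards [ha', hb'] with x h1 h2; rw [h1, h2])]
  ring

theorem totalJump_eq_zero {g : E → ℤ} {w : E → M}
    (h : ∀ q ∈ S.carrier, S.jump g q = 0 ∨ w q = 0) : S.totalJump w g = 0 := by
  rw [totalJump, ← finsum_zero (α := S.carrier)]
  refine finsum_congr fun q => ?_
  rcases h q q.2 with h | h <;> simp [h]

variable (S) in
/-- The curve `γ`, on the open interval from `a` to `b`, runs along the curves of `S`, in their
direction if `s = 1` and in the opposite direction if `s = -1`. -/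
structure IsArc (γ : ℝ → E) (a b : ℝ) (s : ℤ) : Prop where
  lt : a < b
  mem : ∀ t ∈ Ioo a b, γ t ∈ S.carrier
  injOn : InjOn γ (Ioo a b)
  side : ∀ t ∈ Ioo a b,
    (s = 1 ∧ S.fwd (γ t) = map γ (𝓝[>] t) ∧ S.bwd (γ t) = map γ (𝓝[<] t)) ∨
    (s = -1 ∧ S.fwd (γ t) = map γ (𝓝[<] t) ∧ S.bwd (γ t) = map γ (𝓝[>] t))

open Classical in
theorem IsArc.sum_jump {γ : ℝ → E} {a b : ℝ} {s : ℤ} (hγ : S.IsArc γ a b s) {g : E → ℤ}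
    (hg : S.PiecewiseConstant g) {α β : ℤ} (hα : ∀ᶠ t in 𝓝[>] a, g (γ t) = α)
    (hβ : ∀ᶠ t in 𝓝[<] b, g (γ t) = β) (P : Finset E)
    (hP : ∀ q ∈ S.carrier, q ∉ P → S.jump g q = 0) :
    ∑ q ∈ P with q ∈ γ '' Ioo a b, S.jump g q = s * (β - α) := by
  have hside (t : ℝ) (ht : t ∈ Ioo a b) : ∃ x y : ℤ, (∀ᶠ u in 𝓝[>] t, g (γ u) = x) ∧
      (∀ᶠ u in 𝓝[<] t, g (γ u) = y) ∧ S.jump g (γ t) = s * (x - y) := by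
    obtain ⟨x, hx⟩ := hg.exists_fwd _ (hγ.mem t ht)
    obtain ⟨y, hy⟩ := hg.exists_bwd _ (hγ.mem t ht)
    have hj := jump_eq (hγ.mem t ht) hx hy
    rcases hγ.side t ht with ⟨hs, h1, h2⟩ | ⟨hs, h1, h2⟩
    · rw [h1, eventually_map] at hx
      rw [h2, eventually_map] at hy
      exact ⟨x, y, hx, hy, by rw [hj, hs, one_mul]⟩
    · rw [h1, eventually_map] at hx
      rw [h2, eventually_map] at hy
      exact ⟨y, x, hy, hx, by rw [hj, hs]; ring⟩
  choose! ρ lam hρ hl hj using hside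
  have hs : s * s = 1 := by
    obtain ⟨t, ht⟩ := nonempty_Ioo.2 hγ.lt
    rcases hγ.side t ht with ⟨rfl, -⟩ | ⟨rfl, -⟩ <;> rfl
  have hfin : (Ioo a b ∩ γ ⁻¹' (P : Set E)).Finite :=
    Set.Finite.of_finite_image ((P.finite_toSet).subset (by
      rintro _ ⟨t, ⟨-, ht⟩, rfl⟩
      exact ht)) (hγ.injOn.mono inter_subset_left)
  have hsum := sum_jump_Ioo (g := g ∘ γ) hγ.lt hfin.toFinset
    (fun t ht => ((hfin.mem_toFinset).1 ht).1) hρ hl (fun t ht htn => by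
      have h0 := hP _ (hγ.mem t ht) fun h => htn ((hfin.mem_toFinset).2 ⟨ht, h⟩)
      rw [hj t ht] at h0
      have : s ≠ 0 := by
        rintro rfl
        simp at hs
      exact sub_eq_zero.1 ((mul_eq_zero.1 h0).resolve_left this)) hα hβ
  rw [← hsum, Finset.mul_sum]
  symm
  refine Finset.sum_bij (fun t _ => γ t) ?_ ?_ ?_ ?_
  · intro t ht
    have ht' := (hfin.mem_toFinset).1 ht
    exact Finset.mem_filter.2 ⟨ht'.2, mem_image_of_mem _ ht'.1⟩
  · intro t ht u hu htu
    exact hγ.injOn ((hfin.mem_toFinset).1 ht).1 ((hfin.mem_toFinset).1 hu).1 htu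
  · intro q hq
    obtain ⟨hqP, t, ht, rfl⟩ := Finset.mem_filter.1 hq
    exact ⟨t, (hfin.mem_toFinset).2 ⟨ht, hqP⟩, rfl⟩
  · intro t ht
    exact (hj t ((hfin.mem_toFinset).1 ht).1).symm

/-- If all jumps of `g` lie on disjoint arcs of constant weights, the sum of the jumps is determined
by the values of `g` at the ends of the arcs. -/
theorem totalJump_eq_sum_arcs {ι : Type*} [Fintype ι] {γ : ι → ℝ → E} {a b : ℝ} {s : ι → ℤ}
    (hγ : ∀ i, S.IsArc (γ i) a b (s i))
    (hdisj : ∀ i j, ∀ t ∈ Ioo a b, ∀ u ∈ Ioo a b, γ i t = γ j u → i = j) {w : E → M} {W : ι → M}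
    (hw : ∀ i, ∀ t ∈ Ioo a b, w (γ i t) = W i) {g : E → ℤ} (hg : S.PiecewiseConstant g)
    {α β : ι → ℤ} (hα : ∀ i, ∀ᶠ t in 𝓝[>] a, g (γ i t) = α i)
    (hβ : ∀ i, ∀ᶠ t in 𝓝[<] b, g (γ i t) = β i)
    (hsupp : ∀ q ∈ S.carrier, S.jump g q ≠ 0 → ∃ i, q ∈ γ i '' Ioo a b) :
    S.totalJump w g = ∑ i, (s i * (β i - α i)) • W i := by
  classical
  set P := hg.finite_jump.toFinset with hP
  have hPmem (q : E) : q ∈ P ↔ q ∈ S.carrier ∧ S.jump g q ≠ 0 := by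
    rw [hP, Set.Finite.mem_toFinset]
    rfl
  have h1 : S.totalJump w g = ∑ q ∈ P, S.jump g q • w q := by
    rw [totalJump, finsum_eq_sum_of_support_subset _ (s := P.subtype (· ∈ S.carrier)),
      Finset.sum_subtype_of_mem (fun q => S.jump g q • w q)]
    · exact fun q hq => ((hPmem q).1 hq).1
    · intro q hq
      refine Finset.mem_coe.2 (Finset.mem_subtype.2 ((hPmem q).2 ⟨q.2, fun h => hq ?_⟩))
      simp only [h, zero_smul]
  have h2 : ∀ q ∈ P, S.jump g q • w q =
      ∑ i, if q ∈ γ i '' Ioo a b then S.jump g q • W i else 0 := by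
    intro q hq
    obtain ⟨i, t, ht, rfl⟩ := hsupp q ((hPmem q).1 hq).1 ((hPmem q).1 hq).2
    rw [Finset.sum_eq_single i]
    · rw [if_pos (mem_image_of_mem _ ht), hw i t ht]
    · intro j _ hji
      rw [if_neg]
      rintro ⟨u, hu, huq⟩
      exact hji (hdisj j i u hu t ht huq)
    · simp
  rw [h1, Finset.sum_congr rfl h2, Finset.sum_comm]
  refine Finset.sum_congr rfl fun i _ => ?_
  rw [← (hγ i).sum_jump hg (hα i) (hβ i) P fun q hq hqP => ?_]
  · rw [← Finset.sum_filter, Finset.sum_smul]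
  · by_contra h
    exact hqP ((hPmem q).2 ⟨hq, h⟩)

/-- The flows out of the vertices sum to zero. The curves are covered by open sets `B p`, and
`flow p` is minus the sum of the jumps of a function that vanishes outside `B p` and, if `p` is one
of the vertices `V`, is `1` near `p`; the constant function `1`, which does not jump, is cut into
such functions. -/
theorem sum_flow_eq_zero {w : E → M} (t : Finset E) (V : Set E) {B : E → Set E} {flow : E → M}
    (hopen : ∀ p ∈ t, IsOpen (B p)) (hcover : S.carrier ⊆ ⋃ p ∈ t, B p)
    (hpc : ∀ p ∈ t, S.PiecewiseConstant ((B p).indicator 1))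
    (hflow : ∀ p ∈ t, ∀ g : E → ℤ, S.PiecewiseConstant g →
      (p ∈ V → ∀ᶠ x in 𝓝 p, g x = 1) →
      S.totalJump w (fun x => g x * (B p).indicator 1 x) = - flow p)
    (hsep : ∀ p ∈ t, p ∈ V → ∀ p' ∈ t, p' ≠ p → p ∉ closure (B p')) :
    ∑ p ∈ t, flow p = 0 := by
  classical
  -- `h s` vanishes on `B p` for `p ∈ s`, and is `1` near the vertices outside `s`
  set h : Finset E → E → ℤ := fun s x => ∏ p ∈ s, (1 - (B p).indicator 1 x) with hh
  have key : ∀ s ⊆ t, S.PiecewiseConstant (h s) ∧ S.totalJump w (h s) = ∑ p ∈ s, flow p := by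
    intro s
    induction s using Finset.induction_on with
    | empty =>
      intro _
      simp only [hh, Finset.prod_empty, Finset.sum_empty]
      refine ⟨piecewiseConstant_const 1, totalJump_eq_zero fun q hq => Or.inl ?_⟩
      exact jump_eq_zero_of_eventually hq (Filter.Eventually.of_forall fun _ => rfl)
    | insert p s hp ih =>
      intro hst
      obtain ⟨hpt, hst'⟩ := Finset.insert_subset_iff.1 hst
      obtain ⟨ih1, ih2⟩ := ih hst'
      have hmul := ih1.map₂ (hpc p hpt) (· * ·)
      have e : h (insert p s) = fun x => h s x - h s x * (B p).indicator 1 x := by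
        funext x
        simp only [hh, Finset.prod_insert hp]
        ring
      rw [e]
      refine ⟨ih1.map₂ hmul (· - ·), ?_⟩
      rw [totalJump_sub ih1 hmul, ih2, hflow p hpt _ ih1, Finset.sum_insert hp]
      · abel
      · intro hne
        have hev : ∀ p' ∈ s, ∀ᶠ x in 𝓝 p, x ∉ closure (B p') := fun p' hp' =>
          isClosed_closure.isOpen_compl.mem_nhds
            (hsep p hpt hne p' (hst' hp') fun h => hp (h ▸ hp'))
        filter_upwards [(Finset.eventually_all s).2 hev] with x hx
        refine Finset.prod_eq_one fun p' hp' => ?_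
        rw [indicator_of_notMem fun hxB => hx p' hp' (subset_closure hxB), sub_zero]
  rw [← (key t subset_rfl).2]
  refine totalJump_eq_zero fun q hq => Or.inl ?_
  obtain ⟨p, hp, hqp⟩ := mem_iUnion₂.1 (hcover hq)
  refine jump_eq_zero_of_eventually hq (a := 0) ?_
  filter_upwards [(hopen p hp).mem_nhds hqp] with x hx
  refine Finset.prod_eq_zero hp ?_
  rw [indicator_of_mem hx, Pi.one_apply, sub_self]

end OrientedCurves

/-! ### Orientation of the double curves -/

/-- The cross product in `ℝ³`. -/
noncomputable def crossE3 (a b : E3) : E3 :=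
  !₂[a 1 * b 2 - a 2 * b 1, a 2 * b 0 - a 0 * b 2, a 0 * b 1 - a 1 * b 0]

theorem crossE3_smul_smul (s t : ℝ) (a b : E3) :
    crossE3 (s • a) (t • b) = (s * t) • crossE3 a b := by
  ext l
  fin_cases l <;> simp [crossE3] <;> ring

/-- The sign with which the axis `a` occurs in the cross product of the two other coordinate
covectors, taken in increasing order. -/
def axisSign (a : Fin 3) : ℤ := if a = 1 then -1 else 1

theorem axisSign_mul_self (a : Fin 3) : axisSign a * axisSign a = 1 := by
  fin_cases a <;> rfl

/-- Cramer's rule: two rows of a matrix have as cross product the determinant times the vector that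
is dual to the third row. -/
theorem crossE3_rows {A : Matrix (Fin 3) (Fin 3) ℝ} {v : E3} {a i j : Fin 3} (hij : i < j)
    (hai : a ≠ i) (haj : a ≠ j) (h : A.mulVec v.ofLp = Pi.single a 1) :
    crossE3 (WithLp.toLp 2 (A i)) (WithLp.toLp 2 (A j)) = ((axisSign a : ℝ) * A.det) • v := by
  have h1 : A.adjugate.mulVec (A.mulVec v.ofLp) = A.det • v.ofLp := by
    rw [Matrix.mulVec_mulVec, Matrix.adjugate_mul, Matrix.smul_mulVec, Matrix.one_mulVec]
  rw [h, Matrix.mulVec_single_one] at h1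
  have h2 (m : Fin 3) : A.det * v m = A.adjugate m a := (congrFun h1 m).symm
  ext m
  rw [PiLp.smul_apply, smul_eq_mul, mul_assoc, h2, Matrix.adjugate_fin_three]
  clear h1 h2 h
  fin_cases a <;> fin_cases i <;> fin_cases j <;>
    first
    | exact absurd hij (by decide)
    | exact absurd rfl hai
    | exact absurd rfl haj
    | (fin_cases m <;> simp [crossE3, axisSign] <;> ring)

namespace KnottedSurface

variable {F : Type*} [TopologicalSpace F] [ChartedSpace (EuclideanSpace ℝ (Fin 2)) F]
  {K : KnottedSurface F}

section Orientation

variable (K)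

open Classical in
/-- The direction of the double curve at a double point: the cross product of the normals of the
over-sheet and the under-sheet. -/
noncomputable def doubleDirection (p : E3) : E3 :=
  if h : ∃ xo xu, K.IsDouble p xo xu then
    crossE3 (K.normal h.choose) (K.normal h.choose_spec.choose) else 0

variable {K}

theorem doubleDirection_eq {p : E3} {xo xu : F} (h : K.IsDouble p xo xu) :
    K.doubleDirection p = crossE3 (K.normal xo) (K.normal xu) := by
  have h' : ∃ xo xu, K.IsDouble p xo xu := ⟨xo, xu, h⟩
  rw [doubleDirection, dif_pos h']
  obtain ⟨e1, e2⟩ := h'.choose_spec.choose_spec.unique h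
  rw [e2, e1]

theorem nhdsWithin_halfspace_eq {p ν γ' : E3} {γ : ℝ → E3} {t₀ : ℝ} {A : Set E3}
    (hp : γ t₀ = p) (hγ : HasDerivAt γ γ' t₀) (hmap : map γ (𝓝 t₀) = 𝓝[A] p) {s : ℝ}
    (hs : s * inner ℝ ν γ' ≠ 0) :
    𝓝[A ∩ {q | 0 < s * inner ℝ ν (q - p)}] p =
      map γ (𝓝[{t | 0 < s * inner ℝ ν γ' * (t - t₀)}] t₀) := by
  rw [nhdsWithin_inter', ← hmap, ← map_inf_principal_preimage]
  congr 1
  change 𝓝[_] t₀ = _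
  rw [nhdsWithin_eq_iff_eventuallyEq]
  have h1 : HasDerivAt (fun t => s * inner ℝ ν (γ t - p)) (s * inner ℝ ν γ') t₀ := by
    have h2 : HasDerivAt (fun t => inner ℝ ν (γ t - p)) (inner ℝ ν γ') t₀ := by
      have := (hasDerivAt_const t₀ ν).inner ℝ (hγ.sub_const p)
      simpa using this
    exact h2.const_mul s
  filter_upwards [h1.eventually_sign_eq (by simp [hp]) hs] with t ht
  rw [← sign_mul] at ht
  refine propext ?_
  change 0 < s * inner ℝ ν (γ t - p) ↔ 0 < s * inner ℝ ν γ' * (t - t₀)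
  rw [← sign_eq_one_iff, ht, sign_eq_one_iff]

variable (K) in
/-- The nearby double points in front of `p` (for `s = 1`) or behind `p` (for `s = -1`). -/
noncomputable def doubleSide (s : ℝ) (p : E3) : Filter E3 :=
  𝓝[K.doubleLocus ∩ {q | 0 < s * inner ℝ (K.doubleDirection p) (q - p)}] p

theorem doubleSide_eq_of_pos {p γ' : E3} {γ : ℝ → E3} {t₀ : ℝ} (hp : γ t₀ = p)
    (hγ : HasDerivAt γ γ' t₀) (hmap : map γ (𝓝 t₀) = 𝓝[K.doubleLocus] p)
    (h : 0 < inner ℝ (K.doubleDirection p) γ') :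
    K.doubleSide 1 p = map γ (𝓝[>] t₀) ∧ K.doubleSide (-1) p = map γ (𝓝[<] t₀) := by
  constructor
  · rw [doubleSide, nhdsWithin_halfspace_eq hp hγ hmap (by simpa using h.ne')]
    congr 2
    ext t
    change 0 < 1 * inner ℝ (K.doubleDirection p) γ' * (t - t₀) ↔ t₀ < t
    rw [one_mul, mul_pos_iff_of_pos_left h, sub_pos]
  · rw [doubleSide, nhdsWithin_halfspace_eq hp hγ hmap (by simpa using h.ne')]
    congr 2
    ext t
    change 0 < -1 * inner ℝ (K.doubleDirection p) γ' * (t - t₀) ↔ t < t₀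
    have : -1 * inner ℝ (K.doubleDirection p) γ' * (t - t₀) =
      inner ℝ (K.doubleDirection p) γ' * (t₀ - t) := by ring
    rw [this, mul_pos_iff_of_pos_left h, sub_pos]

theorem doubleSide_eq_of_neg {p γ' : E3} {γ : ℝ → E3} {t₀ : ℝ} (hp : γ t₀ = p)
    (hγ : HasDerivAt γ γ' t₀) (hmap : map γ (𝓝 t₀) = 𝓝[K.doubleLocus] p)
    (h : inner ℝ (K.doubleDirection p) γ' < 0) :
    K.doubleSide 1 p = map γ (𝓝[<] t₀) ∧ K.doubleSide (-1) p = map γ (𝓝[>] t₀) := by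
  have h' : 0 < - inner ℝ (K.doubleDirection p) γ' := by linarith
  constructor
  · rw [doubleSide, nhdsWithin_halfspace_eq hp hγ hmap (by simpa using h.ne)]
    congr 2
    ext t
    change 0 < 1 * inner ℝ (K.doubleDirection p) γ' * (t - t₀) ↔ t < t₀
    have : 1 * inner ℝ (K.doubleDirection p) γ' * (t - t₀) =
      - inner ℝ (K.doubleDirection p) γ' * (t₀ - t) := by ring
    rw [this, mul_pos_iff_of_pos_left h', sub_pos]
  · rw [doubleSide, nhdsWithin_halfspace_eq hp hγ hmap (by simpa using h.ne)]
    congr 2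
    ext t
    change 0 < -1 * inner ℝ (K.doubleDirection p) γ' * (t - t₀) ↔ t₀ < t
    have : -1 * inner ℝ (K.doubleDirection p) γ' * (t - t₀) =
      - inner ℝ (K.doubleDirection p) γ' * (t - t₀) := by ring
    rw [this, mul_pos_iff_of_pos_left h', sub_pos]

end Orientation

namespace SheetChart

variable {k : ℕ} (c : K.SheetChart k)

/-- The Jacobian matrix of a local picture. -/
noncomputable def jacobian (q : E3) : Matrix (Fin 3) (Fin 3) ℝ :=
  Matrix.of fun l m => fderiv ℝ c.chart q (EuclideanSpace.single m 1) l

theorem jacobian_mulVec (q w : E3) :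
    (c.jacobian q).mulVec w.ofLp = (fderiv ℝ c.chart q w).ofLp := by
  have h : w = ∑ m, w m • EuclideanSpace.single m (1 : ℝ) := by
    ext l
    simp [Fin.sum_univ_three]
    fin_cases l <;> simp
  ext l
  conv_rhs => rw [h, map_sum]
  simp [Matrix.mulVec, dotProduct, jacobian, mul_comm]

theorem det_jacobian_ne_zero {q : E3} (hq : q ∈ c.chart.source) : (c.jacobian q).det ≠ 0 := by
  intro h
  obtain ⟨v, hv, hv0⟩ := Matrix.exists_mulVec_eq_zero_iff.2 h
  have h1 := c.jacobian_mulVec q (WithLp.toLp 2 v)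
  rw [WithLp.ofLp_toLp, hv0] at h1
  have h2 : fderiv ℝ c.chart q (WithLp.toLp 2 v) = 0 := by
    ext l
    exact (congrFun h1 l).symm
  have h3 := c.fderiv_symm_fderiv_chart hq (WithLp.toLp 2 v)
  rw [h2, map_zero] at h3
  exact hv (by simpa using (congrArg WithLp.ofLp h3).symm)

theorem sign_det_jacobian_eq {q q' : E3} (hq : q ∈ c.chart.source) (hq' : q' ∈ c.chart.source) :
    SignType.sign (c.jacobian q).det = SignType.sign (c.jacobian q').det := by
  have hpre : IsPreconnected c.chart.source := by
    have h1 : c.chart.symm '' c.chart.target = c.chart.source := c.chart.symm_image_target_eq_source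
    rw [← h1]
    refine IsPreconnected.image ?_ _ c.chart.continuousOn_symm
    rw [c.target_eq]
    exact (convex_ball _ _).isPreconnected
  have hcont : ContinuousOn (fun q => (c.jacobian q).det) c.chart.source := by
    have h1 : ContinuousOn (fderiv ℝ c.chart) c.chart.source :=
      c.contDiffOn.continuousOn_fderiv_of_isOpen c.chart.open_source (by simp)
    have h2 (l m : Fin 3) :
        ContinuousOn (fun q => fderiv ℝ c.chart q (EuclideanSpace.single m 1) l)
          c.chart.source := by
      have h3 : ContinuousOn (fun q => fderiv ℝ c.chart q (EuclideanSpace.single m 1))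
        c.chart.source := h1.clm_apply continuousOn_const
      exact (EuclideanSpace.proj l : E3 →L[ℝ] ℝ).continuous.comp_continuousOn h3
    simp only [Matrix.det_fin_three, jacobian, Matrix.of_apply]
    fun_prop
  refine hpre.constant (f := fun q => SignType.sign (c.jacobian q).det) ?_ hq hq'
  intro q hq
  have h0 := c.det_jacobian_ne_zero hq
  have h1 : ContinuousAt SignType.sign (c.jacobian q).det := continuousAt_sign_of_ne_zero h0
  exact ContinuousAt.comp_continuousWithinAt (f := fun q => (c.jacobian q).det) h1 (hcont q hq)

variable [IsManifold (𝓡 2) ∞ F]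

theorem jacobian_row {i : Fin 3} {x : F} (hx : x ∈ c.sheet i) :
    WithLp.toLp 2 (c.jacobian (K.proj x) i) =
      fderiv ℝ c.chart (K.proj x) (K.normal x) i • K.normal x := by
  ext m
  have := c.fderiv_chart_apply hx (EuclideanSpace.single m 1)
  rw [EuclideanSpace.inner_single_right] at this
  simpa [jacobian] using this

/-- The coordinate axis along which two sheets cross runs in the direction of the double curve or
against it, depending on the sign of the Jacobian determinant. -/
theorem sign_inner_doubleDirection {a i j : Fin 3} (hij : i < j) (hai : a ≠ i) (haj : a ≠ j)
    {q : E3} {xo xu : F} (hd : K.IsDouble q xo xu) (ho : xo ∈ c.sheet i) (hu : xu ∈ c.sheet j) :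
    SignType.sign (inner ℝ (K.doubleDirection q)
      (fderiv ℝ c.chart.symm (c.chart q) (EuclideanSpace.single a 1))) =
      SignType.sign ((axisSign a : ℝ) * (c.jacobian q).det) := by
  have hs : q ∈ c.chart.source := hd.proj_over ▸ c.mem_source ho
  set v := fderiv ℝ c.chart.symm (c.chart q) (EuclideanSpace.single a 1) with hv
  have hAv : fderiv ℝ c.chart q v = EuclideanSpace.single a 1 := by
    have := c.fderiv_chart_fderiv_symm (c.chart.map_source hs) (EuclideanSpace.single a 1)
    rwa [c.chart.left_inv hs] at this
  have h1 := crossE3_rows (A := c.jacobian q) (v := v) hij hai haj (by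
    rw [c.jacobian_mulVec, hAv]
    rfl)
  have ho' := c.jacobian_row ho
  have hu' := c.jacobian_row hu
  have hlo := c.normal_pos i xo ho
  have hlu := c.normal_pos j xu hu
  rw [hd.proj_over] at ho' hlo
  rw [hd.proj_under] at hu' hlu
  rw [ho', hu', crossE3_smul_smul, ← doubleDirection_eq hd] at h1
  set l := fderiv ℝ c.chart q (K.normal xo) i * fderiv ℝ c.chart q (K.normal xu) j
  have hl : 0 < l := mul_pos hlo hlu
  clear_value l
  have h2 : l * inner ℝ (K.doubleDirection q) v =
      ((axisSign a : ℝ) * (c.jacobian q).det) * inner ℝ v v := by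
    have := congrArg (fun w => inner ℝ w v) h1
    simpa only [inner_smul_left, conj_trivial] using this
  have hv0 : v ≠ 0 := by
    intro h
    rw [h, map_zero] at hAv
    have := congrArg (fun w : E3 => w a) hAv
    simp at this
  have hvv : 0 < inner ℝ v v := real_inner_self_pos.2 hv0
  have h3 := congrArg SignType.sign h2
  rwa [sign_mul, sign_mul, sign_pos hl, sign_pos hvv, one_mul, mul_one] at h3

end SheetChart

end KnottedSurface

namespace KnottedSurface

variable {F : Type*} [TopologicalSpace F] [ChartedSpace (EuclideanSpace ℝ (Fin 2)) F]
  {K : KnottedSurface F}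

/-! ### Coordinate axes as arcs of double curves -/

/-- The signed line in coordinate direction `a`. -/
noncomputable def axisVector (a : Fin 3) (s : ℝ) (t : ℝ) : E3 :=
  (s * t) • EuclideanSpace.single a (1 : ℝ)

theorem axisVector_apply_self (a : Fin 3) (s t : ℝ) : axisVector a s t a = s * t := by
  simp [axisVector]

theorem axisVector_apply_of_ne {a l : Fin 3} (h : l ≠ a) (s t : ℝ) : axisVector a s t l = 0 := by
  simp [axisVector, h]

theorem norm_axisVector {a : Fin 3} {s : ℝ} (hs : s * s = 1) (t : ℝ) :
    ‖axisVector a s t‖ = |t| := by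
  have : |s| = 1 := by
    rcases mul_self_eq_one_iff.1 hs with rfl | rfl <;> simp
  rw [axisVector, norm_smul, Real.norm_eq_abs, abs_mul, this]
  simp

theorem eq_axisVector {a : Fin 3} {v : E3} (h : ∀ l, l ≠ a → v l = 0) {s : ℝ} (hs : s * s = 1) :
    v = axisVector a s (s * v a) := by
  ext l
  by_cases hl : l = a
  · subst hl
    rw [axisVector_apply_self, ← mul_assoc, hs, one_mul]
  · rw [h l hl, axisVector_apply_of_ne hl]

theorem continuous_axisVector (a : Fin 3) (s : ℝ) : Continuous (axisVector a s) := by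
  unfold axisVector
  fun_prop

theorem map_axisVector_nhds (a : Fin 3) {s : ℝ} (hs : s * s = 1) (t : ℝ) :
    map (axisVector a s) (𝓝 t) = 𝓝[{v | ∀ l, l ≠ a → v l = 0}] axisVector a s t := by
  have h1 : Function.LeftInverse (fun v : E3 => s * v a) (axisVector a s) := by
    intro t
    change s * axisVector a s t a = t
    rw [axisVector_apply_self, ← mul_assoc, hs, one_mul]
  have h2 := (h1.isEmbedding (by fun_prop) (continuous_axisVector a s)).map_nhds_eq t
  rw [h2]
  congr 1
  ext v
  constructor
  · rintro ⟨t, rfl⟩ l hl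
    exact axisVector_apply_of_ne hl s t
  · intro h
    exact ⟨_, (eq_axisVector h hs).symm⟩

theorem hasDerivAt_axisVector (a : Fin 3) (s t : ℝ) :
    HasDerivAt (axisVector a s) (s • EuclideanSpace.single a (1 : ℝ)) t := by
  have h1 : HasDerivAt (fun t : ℝ => s * t) s t := by
    simpa using (hasDerivAt_id t).const_mul s
  exact h1.smul_const _

/-- If the double points correspond to the axis `a` near a point of that axis in some coordinates,
then the axis parametrizes the double points. -/
theorem map_axis_nhds {e : OpenPartialHomeomorph E3 E3} {a : Fin 3} {s t : ℝ} (hs : s * s = 1)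
    (ht : axisVector a s t ∈ e.target)
    (h : ∀ᶠ q in 𝓝 (e.symm (axisVector a s t)),
      q ∈ K.doubleLocus ↔ ∀ l, l ≠ a → e q l = 0) :
    map (fun t => e.symm (axisVector a s t)) (𝓝 t) =
      𝓝[K.doubleLocus] e.symm (axisVector a s t) := by
  have h1 : map (fun t => e.symm (axisVector a s t)) (𝓝 t) =
      map e.symm (map (axisVector a s) (𝓝 t)) := rfl
  rw [h1, map_axisVector_nhds a hs, e.symm.map_nhdsWithin_eq ht, nhdsWithin_eq_iff_eventuallyEq]
  filter_upwards [h, e.open_source.mem_nhds (e.map_target ht)] with q hq hqs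
  refine propext (Iff.trans ?_ hq.symm)
  constructor
  · rintro ⟨v, ⟨hv, hv'⟩, rfl⟩ l hl
    rw [e.right_inv hv]
    exact hv' l hl
  · intro h
    exact ⟨e q, ⟨e.map_source hqs, h⟩, e.left_inv hqs⟩

namespace SheetChart

variable {k : ℕ} (c : K.SheetChart k)

/-- Around the axis `a`, away from the sheet `a` if there is one, the double points are the points
of the axis. -/
theorem mem_doubleLocus_iff {a i j : Fin 3} (hij : i < j) (hai : a ≠ i) (haj : a ≠ j)
    (hj : j.val < k) {q : E3} (hq : q ∈ c.chart.source) (ha : a.val < k → c.chart q a ≠ 0) :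
    q ∈ K.doubleLocus ↔ ∀ l, l ≠ a → c.chart q l = 0 := by
  have hthird : ∀ l, l ≠ a → l = i ∨ l = j := by
    clear * - hij hai haj
    decide +revert
  constructor
  · rintro ⟨xo, xu, hd⟩ l hl
    obtain ⟨i', j', hij', ho, hu, -⟩ := c.exists_of_isDouble hq hd
    have hzo : c.chart q i' = 0 := hd.proj_over ▸ c.coord_eq_zero ho
    have hzu : c.chart q j' = 0 := hd.proj_under ▸ c.coord_eq_zero hu
    have hi'a : i' ≠ a := by
      rintro rfl
      exact ha (c.lt_of_mem ho) hzo
    have hj'a : j' ≠ a := by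
      rintro rfl
      exact ha (c.lt_of_mem hu) hzu
    have : l = i' ∨ l = j' := by
      clear * - hl hij' hi'a hj'a
      decide +revert
    rcases this with rfl | rfl
    · exact hzo
    · exact hzu
  · intro h
    obtain ⟨xo, -, xu, -, hd⟩ := c.exists_isDouble hij hj hq (h i hai.symm) (h j haj.symm)
      fun l hl hli hlj => by
        by_cases hla : l = a
        · subst hla
          exact ha hl
        · rcases hthird l hla with rfl | rfl
          · exact absurd rfl hli
          · exact absurd rfl hlj
    exact ⟨xo, xu, hd⟩

theorem eventually_mem_doubleLocus_iff {a i j : Fin 3} (hij : i < j) (hai : a ≠ i) (haj : a ≠ j)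
    (hj : j.val < k) {q : E3} (hq : q ∈ c.chart.source) (ha : a.val < k → c.chart q a ≠ 0) :
    ∀ᶠ q' in 𝓝 q, q' ∈ K.doubleLocus ↔ ∀ l, l ≠ a → c.chart q' l = 0 := by
  have h1 : ∀ᶠ q' in 𝓝 q, a.val < k → c.chart q' a ≠ 0 := by
    by_cases hak : a.val < k
    · filter_upwards [(c.continuousAt_chart_apply hq a).eventually_ne (ha hak)] with q' h _
      exact h
    · exact Filter.Eventually.of_forall fun q' h => absurd h hak
  filter_upwards [h1, c.chart.open_source.mem_nhds hq] with q' h hq'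
  exact c.mem_doubleLocus_iff hij hai haj hj hq' h

/-- The axis `a` of a local picture, traversed in direction `s = ± 1`. -/
noncomputable def axis (a : Fin 3) (s t : ℝ) : E3 := c.chart.symm (axisVector a s t)

theorem axisVector_mem_target {a : Fin 3} {s t : ℝ} (hs : s * s = 1) (ht : |t| < 1) :
    axisVector a s t ∈ c.chart.target :=
  c.mem_target (by rwa [norm_axisVector hs])

theorem axis_mem_source {a : Fin 3} {s t : ℝ} (hs : s * s = 1) (ht : |t| < 1) :
    c.axis a s t ∈ c.chart.source :=
  c.chart.map_target (c.axisVector_mem_target hs ht)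

theorem chart_axis {a : Fin 3} {s t : ℝ} (hs : s * s = 1) (ht : |t| < 1) :
    c.chart (c.axis a s t) = axisVector a s t :=
  c.chart.right_inv (c.axisVector_mem_target hs ht)

theorem hasDerivAt_axis {a : Fin 3} {s t : ℝ} (hs : s * s = 1) (ht : |t| < 1) :
    HasDerivAt (c.axis a s)
      (s • fderiv ℝ c.chart.symm (axisVector a s t) (EuclideanSpace.single a 1)) t := by
  have h1 := (c.hasStrictFDerivAt_symm (c.axisVector_mem_target (a := a) hs ht)).hasFDerivAt
  have h2 := h1.comp_hasDerivAt t (hasDerivAt_axisVector a s t)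
  rw [map_smul] at h2
  exact h2

theorem axis_mem_doubleLocus {a i j : Fin 3} (hij : i < j) (hai : a ≠ i) (haj : a ≠ j)
    (hj : j.val < k) {s t : ℝ} (hs : s * s = 1) (ht : |t| < 1) (ha : a.val < k → t ≠ 0) :
    c.axis a s t ∈ K.doubleLocus ∧
      map (c.axis a s) (𝓝 t) = 𝓝[K.doubleLocus] c.axis a s t := by
  have hmem := c.axis_mem_source (a := a) hs ht
  have hne : a.val < k → c.chart (c.axis a s t) a ≠ 0 := by
    intro hak
    rw [c.chart_axis hs ht, axisVector_apply_self]
    have : s ≠ 0 := left_ne_zero_of_mul (hs.symm ▸ one_ne_zero)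
    exact mul_ne_zero this (ha hak)
  refine ⟨(c.mem_doubleLocus_iff hij hai haj hj hmem hne).2 fun l hl => ?_,
    map_axis_nhds hs (c.axisVector_mem_target hs ht)
      (c.eventually_mem_doubleLocus_iff hij hai haj hj hmem hne)⟩
  rw [c.chart_axis hs ht, axisVector_apply_of_ne hl]

/-- The sign of the Jacobian determinant: it is `1` if the local picture preserves the orientation
of `ℝ³`, and `-1` otherwise. The axis `a`, traversed in the direction `s`, runs along the double
curve in the direction `s * axisSign a * orientationSign`. -/
noncomputable def orientationSign : ℤ := (SignType.sign (c.jacobian c.center).det : SignType)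

variable [IsManifold (𝓡 2) ∞ F]

theorem sign_axis {a i j : Fin 3} (hij : i < j) (hai : a ≠ i) (haj : a ≠ j)
    (hj : j.val < k) {s t : ℝ} (hs : s * s = 1) (ht : |t| < 1) (ha : a.val < k → t ≠ 0) :
    SignType.sign (inner ℝ (K.doubleDirection (c.axis a s t))
      (s • fderiv ℝ c.chart.symm (axisVector a s t) (EuclideanSpace.single a 1))) =
      SignType.sign (s * axisSign a * (c.jacobian c.center).det) := by
  obtain ⟨xo, xu, hd⟩ := (c.axis_mem_doubleLocus hij hai haj hj hs ht ha).1
  have hmem := c.axis_mem_source (a := a) hs ht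
  obtain ⟨i', j', hij', ho, hu, -⟩ := c.exists_of_isDouble hmem hd
  have hne : a.val < k → c.chart (c.axis a s t) a ≠ 0 := by
    intro hak
    rw [c.chart_axis hs ht, axisVector_apply_self]
    have : s ≠ 0 := left_ne_zero_of_mul (hs.symm ▸ one_ne_zero)
    exact mul_ne_zero this (ha hak)
  have hi'a : a ≠ i' := by
    rintro rfl
    exact hne (c.lt_of_mem ho) (hd.proj_over ▸ c.coord_eq_zero ho)
  have hj'a : a ≠ j' := by
    rintro rfl
    exact hne (c.lt_of_mem hu) (hd.proj_under ▸ c.coord_eq_zero hu)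
  have h1 := c.sign_inner_doubleDirection hij' hi'a hj'a hd ho hu
  rw [c.chart_axis hs ht] at h1
  rw [inner_smul_right, sign_mul, h1, sign_mul, sign_mul, sign_mul,
    c.sign_det_jacobian_eq hmem c.center_mem_source, mul_assoc]

/-- The two sides of a double point on an axis are the two directions of the axis. -/
theorem doubleSide_axis {a i j : Fin 3} (hij : i < j) (hai : a ≠ i) (haj : a ≠ j)
    (hj : j.val < k) {s : ℤ} (hs : s * s = 1) {t : ℝ} (ht : |t| < 1) (ha : a.val < k → t ≠ 0) :
    (s * axisSign a * c.orientationSign = 1 ∧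
      K.doubleSide 1 (c.axis a s t) = map (c.axis a s) (𝓝[>] t) ∧
      K.doubleSide (-1) (c.axis a s t) = map (c.axis a s) (𝓝[<] t)) ∨
    (s * axisSign a * c.orientationSign = -1 ∧
      K.doubleSide 1 (c.axis a s t) = map (c.axis a s) (𝓝[<] t) ∧
      K.doubleSide (-1) (c.axis a s t) = map (c.axis a s) (𝓝[>] t)) := by
  have hs' : (s : ℝ) * s = 1 := by exact_mod_cast hs
  have hsign := c.sign_axis hij hai haj hj hs' ht ha
  have hmap := (c.axis_mem_doubleLocus hij hai haj hj hs' ht ha).2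
  have hder := c.hasDerivAt_axis (a := a) hs' ht
  have hε : axisSign a = 1 ∨ axisSign a = -1 := mul_self_eq_one_iff.1 (axisSign_mul_self a)
  have hdet := c.det_jacobian_ne_zero c.center_mem_source
  have hO : (s * axisSign a * c.orientationSign : ℤ) =
      ((SignType.sign ((s : ℝ) * axisSign a * (c.jacobian c.center).det) : SignType) : ℤ) := by
    rw [orientationSign]
    rcases mul_self_eq_one_iff.1 hs with rfl | rfl <;> rcases hε with h | h <;>
      rw [h] <;> rcases lt_or_gt_of_ne hdet with h' | h' <;>
      simp [h', sign_pos, sign_neg]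
  rw [hO]
  have hne : (s : ℝ) * axisSign a * (c.jacobian c.center).det ≠ 0 := by
    refine mul_ne_zero (mul_ne_zero (left_ne_zero_of_mul (hs'.symm ▸ one_ne_zero)) ?_) hdet
    rcases hε with h | h <;> rw [h] <;> simp
  rcases lt_or_gt_of_ne hne with h | h
  · rw [sign_neg h, sign_eq_neg_one_iff] at hsign
    exact Or.inr ⟨by rw [sign_neg h]; rfl, doubleSide_eq_of_neg rfl hder hmap hsign⟩
  · rw [sign_pos h, sign_eq_one_iff] at hsign
    exact Or.inl ⟨by rw [sign_pos h]; rfl, doubleSide_eq_of_pos rfl hder hmap hsign⟩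

end SheetChart

end KnottedSurface

namespace BrokenSurfaceDiagram

variable {F : Type*} [TopologicalSpace F] [ChartedSpace (EuclideanSpace ℝ (Fin 2)) F]
  (D : BrokenSurfaceDiagram F)

theorem exists_chart_center {p : E3} (hp : p ∈ D.doubleLocus) :
    ∃ c : D.SheetChart 2, c.center = p := by
  obtain ⟨xo, xu, hd⟩ := hp
  obtain ⟨c, hc, -⟩ := D.exists_chart_two hd
  exact ⟨c, hc⟩

theorem axis_zero {D : BrokenSurfaceDiagram F} {k : ℕ} (c : D.SheetChart k) (a : Fin 3) (s : ℝ) :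
    c.axis a s 0 = c.center := by
  rw [KnottedSurface.SheetChart.axis, KnottedSurface.SheetChart.center]
  simp [KnottedSurface.axisVector]

variable [IsManifold (𝓡 2) ∞ F]

/-- The double curves of a broken surface diagram, oriented by the cross product of the normals of
the over-sheet and the under-sheet. -/
noncomputable def doubleCurves : OrientedCurves E3 where
  carrier := D.doubleLocus
  fwd := D.doubleSide 1
  bwd := D.doubleSide (-1)
  fwd_le _ _ := nhdsWithin_le_nhds
  bwd_le _ _ := nhdsWithin_le_nhds
  fwd_neBot q hq := by
    obtain ⟨c, rfl⟩ := D.exists_chart_center hq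
    have h := c.doubleSide_axis (a := 2) (i := 0) (j := 1) (by decide) (by decide) (by decide)
      (by decide) (s := 1) rfl (t := 0) (by simp) (fun h => absurd h (by decide))
    rw [axis_zero] at h
    rcases h with ⟨-, h, -⟩ | ⟨-, h, -⟩ <;> rw [h] <;> infer_instance
  bwd_neBot q hq := by
    obtain ⟨c, rfl⟩ := D.exists_chart_center hq
    have h := c.doubleSide_axis (a := 2) (i := 0) (j := 1) (by decide) (by decide) (by decide)
      (by decide) (s := 1) rfl (t := 0) (by simp) (fun h => absurd h (by decide))
    rw [axis_zero] at h
    rcases h with ⟨-, -, h⟩ | ⟨-, -, h⟩ <;> rw [h] <;> infer_instance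

variable {D}

theorem isArc_axis {k : ℕ} (c : D.SheetChart k) {a i j : Fin 3} (hij : i < j) (hai : a ≠ i)
    (haj : a ≠ j) (hj : j.val < k) {s : ℤ} (hs : s * s = 1) {α β : ℝ} (hαβ : α < β)
    (hα : -1 ≤ α) (hβ : β ≤ 1) (ha : a.val < k → 0 ≤ α) :
    D.doubleCurves.IsArc (c.axis a s) α β (s * axisSign a * c.orientationSign) := by
  have hs' : (s : ℝ) * s = 1 := by exact_mod_cast hs
  have hlt (t : ℝ) (ht : t ∈ Ioo α β) : |t| < 1 :=
    abs_lt.2 ⟨hα.trans_lt ht.1, ht.2.trans_le hβ⟩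
  have hne (t : ℝ) (ht : t ∈ Ioo α β) : a.val < k → t ≠ 0 := fun h =>
    ((ha h).trans_lt ht.1).ne'
  refine ⟨hαβ, fun t ht =>
      (c.axis_mem_doubleLocus hij hai haj hj hs' (hlt t ht) (hne t ht)).1,
    fun t ht u hu htu => ?_, fun t ht =>
      c.doubleSide_axis hij hai haj hj hs (hlt t ht) (hne t ht)⟩
  have h := congrArg c.chart htu
  rw [c.chart_axis hs' (hlt t ht), c.chart_axis hs' (hlt u hu)] at h
  have h' := congrArg (fun v : E3 => s * v a) h
  simp only [KnottedSurface.axisVector_apply_self, ← mul_assoc, hs', one_mul] at h'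
  exact h'

end BrokenSurfaceDiagram

/-! ### Balls in local pictures -/

/-- The ball of radius `r` in a coordinate system of `ℝ³`. -/
def chartBall (e : OpenPartialHomeomorph E3 E3) (r : ℝ) : Set E3 := e.symm '' Metric.ball 0 r

section ChartBall

variable {e : OpenPartialHomeomorph E3 E3} (he : e.target = Metric.ball 0 1) {r : ℝ} (hr : r < 1)

include he hr

theorem ball_subset_target : Metric.ball 0 r ⊆ e.target :=
  he ▸ Metric.ball_subset_ball hr.le

theorem isOpen_chartBall : IsOpen (chartBall e r) :=
  e.symm.isOpen_image_of_subset_source Metric.isOpen_ball (ball_subset_target he hr)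

theorem mem_chartBall_iff {q : E3} (hq : q ∈ e.source) : q ∈ chartBall e r ↔ ‖e q‖ < r := by
  constructor
  · rintro ⟨v, hv, rfl⟩
    rw [e.right_inv (ball_subset_target he hr hv)]
    simpa using hv
  · intro h
    exact ⟨e q, by simpa using h, e.left_inv hq⟩

theorem closure_chartBall_subset :
    closure (chartBall e r) ⊆ {q | q ∈ e.source ∧ ‖e q‖ ≤ r} := by
  have hsub : Metric.closedBall (0 : E3) r ⊆ e.target :=
    he ▸ Metric.closedBall_subset_ball hr
  have hcpt : IsCompact (e.symm '' Metric.closedBall (0 : E3) r) :=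
    (isCompact_closedBall 0 r).image_of_continuousOn (e.continuousOn_symm.mono hsub)
  have h1 : closure (chartBall e r) ⊆ e.symm '' Metric.closedBall (0 : E3) r :=
    closure_minimal (image_mono Metric.ball_subset_closedBall) hcpt.isClosed
  refine h1.trans ?_
  rintro _ ⟨v, hv, rfl⟩
  refine ⟨e.map_target (hsub hv), ?_⟩
  rw [e.right_inv (hsub hv)]
  simpa using hv

/-- Away from the sphere of radius `r`, the indicator function of the ball is locally constant. -/
theorem eventually_indicator_chartBall {q : E3} (hq : q ∈ e.source → ‖e q‖ ≠ r) :
    ∃ a : ℤ, ∀ᶠ x in 𝓝 q, (chartBall e r).indicator 1 x = a := by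
  by_cases h : q ∈ closure (chartBall e r)
  · obtain ⟨hqs, hqr⟩ := closure_chartBall_subset he hr h
    have hmem : q ∈ chartBall e r := (mem_chartBall_iff he hr hqs).2 (lt_of_le_of_ne hqr (hq hqs))
    refine ⟨1, ?_⟩
    filter_upwards [(isOpen_chartBall he hr).mem_nhds hmem] with x hx
    rw [indicator_of_mem hx, Pi.one_apply]
  · refine ⟨0, ?_⟩
    filter_upwards [isClosed_closure.isOpen_compl.mem_nhds h] with x hx
    rw [indicator_of_notMem fun hx' => hx (subset_closure hx')]

end ChartBall

namespace BrokenSurfaceDiagram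

variable {F : Type*} [TopologicalSpace F] [ChartedSpace (EuclideanSpace ℝ (Fin 2)) F]
  {D : BrokenSurfaceDiagram F}

/-- A double point in a local picture lies on a coordinate axis. -/
theorem exists_axis_of_mem_doubleLocus {k : ℕ} (c : D.SheetChart k) {q : E3}
    (hq : q ∈ D.doubleLocus) (hs : q ∈ c.chart.source) :
    ∃ a i j : Fin 3, i < j ∧ a ≠ i ∧ a ≠ j ∧ j.val < k ∧ (∀ l, l ≠ a → c.chart q l = 0) ∧
      (a.val < k → c.chart q a ≠ 0) := by
  obtain ⟨xo, xu, hd⟩ := hq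
  obtain ⟨i, j, hij, ho, hu, hl⟩ := c.exists_of_isDouble hs hd
  obtain ⟨a, hai, haj, hthird⟩ :
      ∃ a : Fin 3, a ≠ i ∧ a ≠ j ∧ ∀ l, l ≠ a → l = i ∨ l = j := by
    clear * - hij
    decide +revert
  refine ⟨a, i, j, hij, hai, haj, c.lt_of_mem hu, fun l hla => ?_, fun hak => hl a hak hai haj⟩
  rcases hthird l hla with rfl | rfl
  · exact hd.proj_over ▸ c.coord_eq_zero ho
  · exact hd.proj_under ▸ c.coord_eq_zero hu

/-- The sign `±1` given by a Boolean. -/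
def boolSign (s : Bool) : ℤ := if s then 1 else -1

theorem boolSign_mul_self (s : Bool) : boolSign s * boolSign s = 1 := by
  cases s <;> rfl

theorem boolSign_mul_self_real (s : Bool) : (boolSign s : ℝ) * boolSign s = 1 := by
  exact_mod_cast boolSign_mul_self s

theorem exists_boolSign_mul_eq_abs (x : ℝ) : ∃ s : Bool, (boolSign s : ℝ) * x = |x| := by
  rcases le_total 0 x with h | h
  · exact ⟨true, by simp [boolSign, abs_of_nonneg h]⟩
  · exact ⟨false, by simp [boolSign, abs_of_nonpos h]⟩

/-- A point of an axis, in terms of the parameter of the axis. -/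
theorem eq_axis {k : ℕ} (c : D.SheetChart k) {q : E3} (hs : q ∈ c.chart.source) {a : Fin 3}
    (h : ∀ l, l ≠ a → c.chart q l = 0) :
    ∃ s : Bool, q = c.axis a (boolSign s) |c.chart q a| ∧ |c.chart q a| = ‖c.chart q‖ := by
  obtain ⟨s, hsx⟩ := exists_boolSign_mul_eq_abs (c.chart q a)
  have h1 := KnottedSurface.eq_axisVector h (boolSign_mul_self_real s)
  rw [hsx] at h1
  refine ⟨s, ?_, ?_⟩
  · rw [KnottedSurface.SheetChart.axis, ← h1, c.chart.left_inv hs]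
  · conv_rhs => rw [h1, KnottedSurface.norm_axisVector (boolSign_mul_self_real s), abs_abs]

theorem branch_mem_doubleLocus_iff (b : D.BranchChart) {δ : ℝ} (hδ : 0 < δ)
    (hball : Metric.ball (0 : E2) δ ⊆ b.surfaceChart.target) {q : E3} (hq : q ∈ b.chart.source)
    (h0 : 0 < b.chart q 1) (h1 : b.chart q 1 < δ ^ 2) :
    q ∈ D.doubleLocus ↔ ∀ l, l ≠ 1 → b.chart q l = 0 := by
  constructor
  · rintro ⟨xo, xu, hd⟩ l hl
    obtain ⟨-, -, v, -, -, -, hqv⟩ := b.chart_of_isDouble hq hd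
    rw [hqv]
    fin_cases l
    · rfl
    · exact absurd rfl hl
    · rfl
  · intro h
    set v := Real.sqrt (b.chart q 1) with hv
    have hv2 : v ^ 2 = b.chart q 1 := Real.sq_sqrt h0.le
    have hvpos : 0 < v := Real.sqrt_pos.2 h0
    have hvδ : v < δ := lt_of_pow_lt_pow_left₀ 2 hδ.le (hv2 ▸ h1)
    have hmem (s : ℝ) (hs : |s| = v) : (!₂[0, s] : E2) ∈ b.surfaceChart.target := by
      apply hball
      rw [mem_ball_zero_iff, EuclideanSpace.norm_eq, Fin.sum_univ_two]
      simpa [Real.sqrt_sq_eq_abs, hs, abs_of_pos hvpos] using hvδ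
    have h2 := b.mem_doubleLocus hvpos.ne' (hmem v (abs_of_pos hvpos))
      (hmem (-v) (by rw [abs_neg, abs_of_pos hvpos]))
    have h3 : (!₂[0, v ^ 2, 0] : E3) = b.chart q := by
      ext l
      fin_cases l
      · exact (h 0 (by decide)).symm
      · exact hv2
      · exact (h 2 (by decide)).symm
    rwa [h3, b.chart.left_inv hq] at h2

variable [IsManifold (𝓡 2) ∞ F]

/-- The indicator function of a ball is piecewise constant if the double curves cross its boundary
sphere in finitely many points, at each of which the radius is a parameter of the curve. -/
theorem piecewiseConstant_indicator {e : OpenPartialHomeomorph E3 E3}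
    (he : e.target = Metric.ball 0 1) {r : ℝ} (hr : r < 1) {ι : Type*} [Finite ι]
    (γ : ι → ℝ → E3)
    (h : ∀ q ∈ D.doubleLocus, q ∈ e.source → ‖e q‖ = r → ∃ i, q = γ i r ∧
      ((D.doubleSide 1 q = map (γ i) (𝓝[>] r) ∧ D.doubleSide (-1) q = map (γ i) (𝓝[<] r)) ∨
       (D.doubleSide 1 q = map (γ i) (𝓝[<] r) ∧ D.doubleSide (-1) q = map (γ i) (𝓝[>] r))) ∧
      ∀ᶠ t in 𝓝 r, γ i t ∈ e.source ∧ ‖e (γ i t)‖ = t) :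
    D.doubleCurves.PiecewiseConstant ((chartBall e r).indicator 1) := by
  have hboth : ∀ q ∈ D.doubleLocus,
      (∃ a : ℤ, ∀ᶠ x in D.doubleSide 1 q, (chartBall e r).indicator 1 x = a) ∧
      ∃ a : ℤ, ∀ᶠ x in D.doubleSide (-1) q, (chartBall e r).indicator 1 x = a := by
    intro q hq
    by_cases hqr : q ∈ e.source ∧ ‖e q‖ = r
    · obtain ⟨i, rfl, hside, hev⟩ := h q hq hqr.1 hqr.2
      have hout : ∀ᶠ x in map (γ i) (𝓝[>] r), (chartBall e r).indicator 1 x = (0 : ℤ) := by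
        rw [eventually_map]
        filter_upwards [hev.filter_mono nhdsWithin_le_nhds, self_mem_nhdsWithin] with t ht htr
        refine indicator_of_notMem (fun hmem => ?_) _
        rw [mem_chartBall_iff he hr ht.1, ht.2] at hmem
        exact lt_asymm hmem htr
      have hin : ∀ᶠ x in map (γ i) (𝓝[<] r), (chartBall e r).indicator 1 x = (1 : ℤ) := by
        rw [eventually_map]
        filter_upwards [hev.filter_mono nhdsWithin_le_nhds, self_mem_nhdsWithin] with t ht htr
        refine indicator_of_mem ?_ _
        rw [mem_chartBall_iff he hr ht.1, ht.2]
        exact htr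
      rcases hside with ⟨h1, h2⟩ | ⟨h1, h2⟩ <;> rw [h1, h2]
      · exact ⟨⟨0, hout⟩, ⟨1, hin⟩⟩
      · exact ⟨⟨1, hin⟩, ⟨0, hout⟩⟩
    · obtain ⟨a, ha⟩ := eventually_indicator_chartBall he hr (q := q) fun h1 h2 => hqr ⟨h1, h2⟩
      exact ⟨⟨a, ha.filter_mono (D.doubleCurves.fwd_le q hq)⟩,
        ⟨a, ha.filter_mono (D.doubleCurves.bwd_le q hq)⟩⟩
  refine ⟨fun q hq => (hboth q hq).1, fun q hq => (hboth q hq).2,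
    (Set.finite_range fun i => γ i r).subset ?_⟩
  rintro q ⟨hq, hj⟩
  by_contra hne
  refine hj ?_
  obtain ⟨a, ha⟩ := eventually_indicator_chartBall he hr (q := q) fun h1 h2 => hne (by
    obtain ⟨i, rfl, -⟩ := h q hq h1 h2
    exact mem_range_self i)
  exact OrientedCurves.jump_eq_zero_of_eventually hq ha

theorem jump_mul_indicator_eq_zero {B : Set E3} {q : E3} (hq : q ∈ D.doubleLocus)
    (hqB : q ∉ closure B) (g : E3 → ℤ) :
    D.doubleCurves.jump (fun x => g x * B.indicator 1 x) q = 0 := by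
  refine OrientedCurves.jump_eq_zero_of_eventually hq (a := 0) ?_
  filter_upwards [isClosed_closure.isOpen_compl.mem_nhds hqB] with x hx
  rw [indicator_of_notMem fun hx' => hx (subset_closure hx'), mul_zero]

theorem piecewiseConstant_indicator_sheetChart {k : ℕ} (c : D.SheetChart k) {r : ℝ}
    (hr0 : 0 < r) (hr : r < 1) :
    D.doubleCurves.PiecewiseConstant ((chartBall c.chart r).indicator 1) := by
  refine piecewiseConstant_indicator c.target_eq hr
    (fun x : Fin 3 × Bool => c.axis x.1 (boolSign x.2)) fun q hq hs hqr => ?_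
  obtain ⟨a, i, j, hij, hai, haj, hj, hl, ha⟩ := exists_axis_of_mem_doubleLocus c hq hs
  obtain ⟨s, hqs, habs⟩ := eq_axis c hs hl
  rw [habs, hqr] at hqs
  have hr' : |r| < 1 := by rwa [abs_of_pos hr0]
  refine ⟨(a, s), hqs, ?_, ?_⟩
  · rw [hqs]
    rcases c.doubleSide_axis hij hai haj hj (boolSign_mul_self s) hr' fun _ => hr0.ne' with
      ⟨-, h⟩ | ⟨-, h⟩
    · exact Or.inl h
    · exact Or.inr h
  · filter_upwards [Ioo_mem_nhds hr0 hr] with t ht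
    have ht' : |t| < 1 := by rw [abs_of_pos ht.1]; exact ht.2
    refine ⟨c.axis_mem_source (boolSign_mul_self_real s) ht', ?_⟩
    rw [c.chart_axis (boolSign_mul_self_real s) ht',
      KnottedSurface.norm_axisVector (boolSign_mul_self_real s), abs_of_pos ht.1]

/-- A regular parametrization of a double curve is transversal to the plane orthogonal to the
direction of the double curve. -/
theorem inner_doubleDirection_ne_zero {γ : ℝ → E3} {γ' : E3} {t : ℝ}
    (hmem : γ t ∈ D.doubleLocus) (hγ : HasDerivAt γ γ' t) (h0 : γ' ≠ 0)
    (hmap : map γ (𝓝 t) = 𝓝[D.doubleLocus] γ t) :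
    inner ℝ (D.doubleDirection (γ t)) γ' ≠ 0 := by
  obtain ⟨xo, xu, hd⟩ := hmem
  obtain ⟨c, hc, ho, hu⟩ := D.exists_chart_two hd
  have hs : γ t ∈ c.chart.source := hc ▸ c.center_mem_source
  have hder := (c.hasStrictFDerivAt_chart hs).hasFDerivAt.comp_hasDerivAt t hγ
  have hzero (l : Fin 3) (hl : l ≠ 2) : fderiv ℝ c.chart (γ t) γ' l = 0 := by
    have h1 := (EuclideanSpace.proj l : E3 →L[ℝ] ℝ).hasFDerivAt.comp_hasDerivAt t hder
    refine h1.unique ((hasDerivAt_const t (0 : ℝ)).congr_of_eventuallyEq ?_)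
    have h2 : ∀ᶠ q in map γ (𝓝 t), q ∈ D.doubleLocus ∧ q ∈ c.chart.source := by
      rw [hmap]
      exact Filter.Eventually.and self_mem_nhdsWithin
        (nhdsWithin_le_nhds (c.chart.open_source.mem_nhds hs))
    rw [eventually_map] at h2
    filter_upwards [h2] with u hu
    exact (c.mem_doubleLocus_iff (a := 2) (i := 0) (j := 1) (by decide) (by decide) (by decide)
      (by decide) hu.2 (fun h => absurd h (by decide))).1 hu.1 l hl
  set μ := fderiv ℝ c.chart (γ t) γ' 2 with hμ
  have h2 : fderiv ℝ c.chart (γ t) γ' = μ • EuclideanSpace.single 2 1 := by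
    ext l
    by_cases hl : l = 2
    · subst hl
      simp [hμ]
    · simp [hzero l hl, hl]
  have h3 : γ' = μ • fderiv ℝ c.chart.symm (c.chart (γ t)) (EuclideanSpace.single 2 1) := by
    rw [← map_smul, ← h2, c.fderiv_symm_fderiv_chart hs]
  have hμ0 : μ ≠ 0 := by
    intro h
    rw [h, zero_smul] at h3
    exact h0 h3
  rw [h3, inner_smul_right]
  refine mul_ne_zero hμ0 fun h => ?_
  have h4 := c.sign_inner_doubleDirection (a := 2) (by decide : (0 : Fin 3) < 1) (by decide)
    (by decide) hd ho hu
  rw [h, sign_zero, eq_comm, sign_eq_zero_iff] at h4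
  refine mul_ne_zero ?_ (c.det_jacobian_ne_zero hs) h4
  simp [axisSign]

theorem piecewiseConstant_indicator_branchChart (b : D.BranchChart) {δ r : ℝ} (hδ : 0 < δ)
    (hball : Metric.ball (0 : E2) δ ⊆ b.surfaceChart.target) (hr0 : 0 < r) (hr : r < 1)
    (hrδ : r < δ ^ 2) :
    D.doubleCurves.PiecewiseConstant ((chartBall b.chart r).indicator 1) := by
  have hone : (1 : ℝ) * 1 = 1 := one_mul 1
  set γ : ℝ → E3 := fun t => b.chart.symm (KnottedSurface.axisVector 1 1 t) with hγdef
  have htar (t : ℝ) (ht : |t| < 1) : KnottedSurface.axisVector 1 1 t ∈ b.chart.target :=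
    b.mem_target (by rwa [KnottedSurface.norm_axisVector hone])
  refine piecewiseConstant_indicator b.target_eq hr (fun _ : Unit => γ)
    fun q hq hs hqr => ⟨(), ?_⟩
  have habs : |r| < 1 := by rwa [abs_of_pos hr0]
  have hqγ : q = γ r := by
    obtain ⟨xo, xu, hd⟩ := hq
    obtain ⟨-, -, v, -, -, -, hqv⟩ := b.chart_of_isDouble hs hd
    have h1 : b.chart q = KnottedSurface.axisVector 1 1 (v ^ 2) := by
      rw [hqv]
      ext l
      fin_cases l <;> simp [KnottedSurface.axisVector]
    have h2 : v ^ 2 = r := by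
      rw [h1, KnottedSurface.norm_axisVector hone, abs_of_nonneg (sq_nonneg v)] at hqr
      exact hqr
    rw [hγdef]
    simp only
    rw [← h2, ← h1, b.chart.left_inv hs]
  have hchart (t : ℝ) (ht : |t| < 1) : b.chart (γ t) = KnottedSurface.axisVector 1 1 t :=
    b.chart.right_inv (htar t ht)
  have hγr : b.chart (γ r) 1 = r := by
    rw [hchart r habs, KnottedSurface.axisVector_apply_self, one_mul]
  have hsr : γ r ∈ b.chart.source := b.chart.map_target (htar r habs)
  have hmap : map γ (𝓝 r) = 𝓝[D.doubleLocus] γ r := by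
    refine KnottedSurface.map_axis_nhds hone (htar r habs) ?_
    have hc : ContinuousAt (fun q => b.chart q 1) (γ r) := by
      have := b.chart.continuousAt hsr
      fun_prop
    have h1 : ∀ᶠ q in 𝓝 (γ r), 0 < b.chart q 1 :=
      continuousAt_const.eventually_lt hc (by rwa [hγr])
    have h2 : ∀ᶠ q in 𝓝 (γ r), b.chart q 1 < δ ^ 2 :=
      hc.eventually_lt continuousAt_const (by rwa [hγr])
    filter_upwards [h1, h2, b.chart.open_source.mem_nhds hsr] with q h1 h2 h3
    exact branch_mem_doubleLocus_iff b hδ hball h3 h1 h2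
  have hder := (b.hasFDerivAt_symm (htar r habs)).comp_hasDerivAt r
    (KnottedSurface.hasDerivAt_axisVector 1 1 r)
  rw [one_smul] at hder
  set γ' := fderiv ℝ b.chart.symm (KnottedSurface.axisVector 1 1 r) (EuclideanSpace.single 1 1)
  have h0 : γ' ≠ 0 := by
    intro h
    have h1 := b.fderiv_chart_fderiv_symm (htar r habs) (EuclideanSpace.single 1 1)
    change fderiv ℝ b.chart _ γ' = _ at h1
    rw [h, map_zero] at h1
    have := congrArg (fun w : E3 => w 1) h1
    simp at this
  have hne := inner_doubleDirection_ne_zero (γ := γ) (hqγ ▸ hq) hder h0 hmap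
  refine ⟨hqγ, ?_, ?_⟩
  · rw [hqγ]
    rcases lt_or_gt_of_ne hne with h | h
    · exact Or.inr (KnottedSurface.doubleSide_eq_of_neg rfl hder hmap h)
    · exact Or.inl (KnottedSurface.doubleSide_eq_of_pos rfl hder hmap h)
  · filter_upwards [Ioo_mem_nhds hr0 hr] with t ht
    have ht' : |t| < 1 := by rw [abs_of_pos ht.1]; exact ht.2
    exact ⟨b.chart.map_target (htar t ht'), by
      rw [hchart t ht', KnottedSurface.norm_axisVector hone, abs_of_pos ht.1]⟩

end BrokenSurfaceDiagram

/-! ### Chains of twisted biquandles -/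

namespace TwistedBiquandle

variable {X : Type*} (B : TwistedBiquandle X)

theorem T_smul_gen {m : ℕ} (k : ℤ) (x : Fin m → X) :
    (LaurentPolynomial.T k : ℤ[T;T⁻¹]) • B.gen x = B.gen fun i => (B.f ^ k) (x i) := by
  have h1 : (LaurentPolynomial.T k : ℤ[T;T⁻¹]) • B.gen x =
      AddMonoidAlgebra.lift ℤ (Module.End ℤ (B.Chain m)) ℤ (B.powAction m)
        (AddMonoidAlgebra.single k 1) (B.gen x) := rfl
  rw [h1, AddMonoidAlgebra.lift_single, one_smul]
  exact Finsupp.mapDomain_single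

theorem boundary_gen {m₁ m₂ : ℤ} {m : ℕ} (x : Fin (m + 1) → X) :
    B.boundary m₁ m₂ m (B.gen x) =
      ∑ i : Fin (m + 1), (-1 : ℤ) ^ (i.val + 1) •
        (B.gen (fun j => (B.f ^ m₁) (B.leftFace i x j)) -
          B.gen (fun j => (B.f ^ m₂) (B.rightFace i x j))) := by
  refine (Finsupp.linearCombination_single ℤ _ _).trans ?_
  rw [one_smul]

theorem boundary_gen_three (n : ℤ) (x y z : X) :
    B.boundary 0 n 2 (B.gen ![x, y, z]) =
      -(B.gen ![y, z]) +
      (LaurentPolynomial.T n : ℤ[T;T⁻¹]) • B.gen ![(B.R (x, y)).1, (B.R ((B.R (x, y)).2, z)).1] +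
      B.gen ![(B.R (x, y)).2, z] -
      (LaurentPolynomial.T n : ℤ[T;T⁻¹]) • B.gen ![x, (B.R (y, z)).1] -
      B.gen ![(B.R (x, (B.R (y, z)).1)).2, (B.R (y, z)).2] +
      (LaurentPolynomial.T n : ℤ[T;T⁻¹]) • B.gen ![x, y] := by
  have l0 : B.leftFace 0 ![x, y, z] = ![y, z] := by
    funext j; fin_cases j <;> rfl
  have l1 : B.leftFace 1 ![x, y, z] = ![(B.R (x, y)).2, z] := by
    funext j; fin_cases j <;> rfl
  have l2 : B.leftFace 2 ![x, y, z] = ![(B.R (x, (B.R (y, z)).1)).2, (B.R (y, z)).2] := by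
    funext j; fin_cases j <;> rfl
  have r0 : B.rightFace 0 ![x, y, z] = ![(B.R (x, y)).1, (B.R ((B.R (x, y)).2, z)).1] := by
    funext j; fin_cases j <;> rfl
  have r1 : B.rightFace 1 ![x, y, z] = ![x, (B.R (y, z)).1] := by
    funext j; fin_cases j <;> rfl
  have r2 : B.rightFace 2 ![x, y, z] = ![x, y] := by
    funext j; fin_cases j <;> rfl
  rw [boundary_gen, Fin.sum_univ_three, l0, l1, l2, r0, r1, r2]
  simp only [T_smul_gen, zpow_zero, Equiv.Perm.coe_one, id_eq, Fin.val_zero, Fin.val_one,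
    Fin.val_two]
  norm_num
  abel

variable {M : Type*} [AddCommGroup M] [Module ℤ[T;T⁻¹] M] {m : ℕ} (θ : B.Cochain m M)

theorem evalChain_add (c c' : B.Chain m) :
    B.evalChain θ (c + c') = B.evalChain θ c + B.evalChain θ c' :=
  θ.map_add (Submodule.Quotient.mk c) (Submodule.Quotient.mk c')

theorem evalChain_neg (c : B.Chain m) : B.evalChain θ (-c) = -B.evalChain θ c :=
  θ.map_neg (Submodule.Quotient.mk c)

theorem evalChain_sub (c c' : B.Chain m) :
    B.evalChain θ (c - c') = B.evalChain θ c - B.evalChain θ c' :=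
  θ.map_sub (Submodule.Quotient.mk c) (Submodule.Quotient.mk c')

theorem evalChain_smul (r : ℤ[T;T⁻¹]) (c : B.Chain m) :
    B.evalChain θ (r • c) = r • B.evalChain θ c :=
  θ.map_smul r (Submodule.Quotient.mk c)

variable {B} in
theorem evalChain_degenerate (θ : B.Cochain 2 M) {x y : X} (h : B.R (x, y) = (x, y)) :
    B.evalChain θ (B.gen ![x, y]) = 0 := by
  have : Submodule.Quotient.mk (B.gen ![x, y]) = (0 : B.BQChain 2) := by
    rw [Submodule.Quotient.mk_eq_zero]
    exact Submodule.subset_span ⟨![x, y], 0, 1, rfl, h, rfl⟩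
  rw [evalChain, this, map_zero]

end TwistedBiquandle

namespace BrokenSurfaceDiagram

variable {F : Type*} [TopologicalSpace F] [ChartedSpace (EuclideanSpace ℝ (Fin 2)) F]
  [IsManifold (𝓡 2) ∞ F] [CompactSpace F] {D : BrokenSurfaceDiagram F}
  {X : Type*} [Nonempty X] {B : TwistedBiquandle X}
  {M : Type*} [AddCommGroup M] [Module ℤ[T;T⁻¹] M]

/-! ### The weight of a double point -/

open Classical in
/-- The weight `T^{-n(ℓ-1)} η(x, y)` of a double point with label `(ℓ, x, y)`; it is zero at the
points that are not double points. -/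
noncomputable def doubleWeight (L : D.AlexanderNumbering) (n : ℤ) (η : B.Cochain 2 M)
    (C : D.Coloring B) (p : E3) : M :=
  if h : ∃ a : ℤ × X × X, HasLabel L C p a.1 a.2.1 a.2.2 then
    (LaurentPolynomial.T (-(n * (h.choose.1 - 1))) : ℤ[T;T⁻¹]) •
      B.evalChain η (B.gen ![h.choose.2.1, h.choose.2.2])
  else 0

theorem HasLabel.doubleWeight_eq {L : D.AlexanderNumbering} {C : D.Coloring B} {p : E3} {ℓ : ℤ}
    {x y : X} (h : HasLabel L C p ℓ x y) (n : ℤ) (η : B.Cochain 2 M) :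
    doubleWeight L n η C p =
      (LaurentPolynomial.T (-(n * (ℓ - 1))) : ℤ[T;T⁻¹]) • B.evalChain η (B.gen ![x, y]) := by
  have h' : ∃ a : ℤ × X × X, HasLabel L C p a.1 a.2.1 a.2.2 := ⟨(ℓ, x, y), h⟩
  obtain ⟨h1, h2, h3⟩ := h'.choose_spec.unique h
  rw [doubleWeight, dif_pos h', h1, h2, h3]

/-- The label of a point of a coordinate axis of a local picture, read off from points of the
local picture with suitable signs of the coordinates. -/
theorem hasLabel_axis (L : D.AlexanderNumbering) (C : D.Coloring B) {k : ℕ} (c : D.SheetChart k)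
    {a i j : Fin 3} (hij : i < j) (hai : a ≠ i) (haj : a ≠ j) (hj : j.val < k) {p : E3}
    (hp : p ∈ c.chart.source) (hpl : ∀ l, l ≠ a → c.chart p l = 0)
    (hpa : a.val < k → c.chart p a ≠ 0) {q : E3} {o u : F}
    (hq : q ∈ c.chart.source) (hqi : c.chart q i < 0) (hqj : c.chart q j < 0)
    (hqa : a.val < k → SignType.sign (c.chart q a) = SignType.sign (c.chart p a))
    (hu : u ∈ c.sheet j) (hui : c.coord u i < 0)
    (hua : a.val < k → SignType.sign (c.coord u a) = SignType.sign (c.chart p a))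
    (ho : o ∈ c.sheet i) (hoj : 0 < c.coord o j)
    (hoa : a.val < k → SignType.sign (c.coord o a) = SignType.sign (c.chart p a)) :
    HasLabel L C p (D.regionValue L.toFun q) (D.colorAt C.val u) (D.colorAt C.val o) := by
  have hthird : ∀ l, l ≠ i → l ≠ j → l = a := by
    clear * - hij hai haj
    decide +revert
  have hne : ∀ l : Fin 3, l.val < k → l ≠ i → l ≠ j → c.chart p l ≠ 0 := fun l hl hli hlj => by
    obtain rfl := hthird l hli hlj
    exact hpa hl
  obtain ⟨xo, hxo, xu, hxu, hd⟩ := c.exists_isDouble hij hj hp (hpl i hai.symm) (hpl j haj.symm) hne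
  obtain ⟨ℓ, x, y, h⟩ := exists_hasLabel L C hd
  obtain ⟨rfl, rfl, rfl⟩ := h.eq c hij hj hp (hpl i hai.symm) (hpl j haj.symm) hne hq hqi hqj
    (fun l hl hli hlj => by obtain rfl := hthird l hli hlj; exact hqa hl) hu hui
    (fun l hl hli hlj => by obtain rfl := hthird l hli hlj; exact hua hl) ho hoj
    (fun l hl hli hlj => by obtain rfl := hthird l hli hlj; exact hoa hl)
  exact h

/-- The weight is constant along each branch of a double curve in a local picture. -/
theorem doubleWeight_congr (L : D.AlexanderNumbering) (n : ℤ) (η : B.Cochain 2 M)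
    (C : D.Coloring B) {k : ℕ} (c : D.SheetChart k)
    {a i j : Fin 3} (hij : i < j) (hai : a ≠ i) (haj : a ≠ j) (hj : j.val < k) {p p' : E3}
    (hp : p ∈ c.chart.source) (hpl : ∀ l, l ≠ a → c.chart p l = 0)
    (hp' : p' ∈ c.chart.source) (hpl' : ∀ l, l ≠ a → c.chart p' l = 0)
    (hpa : a.val < k → c.chart p a ≠ 0 ∧
      SignType.sign (c.chart p a) = SignType.sign (c.chart p' a)) :
    doubleWeight L n η C p = doubleWeight L n η C p' := by
  have hne : ∀ l : Fin 3, l.val < k → l ≠ i → l ≠ j → c.chart p l ≠ 0 := fun l hl hli hlj => by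
    obtain rfl : l = a := by
      clear * - hij hai haj hli hlj
      decide +revert
    exact (hpa hl).1
  have hpa' : a.val < k → c.chart p' a ≠ 0 := fun hk h0 => by
    have := (hpa hk).2
    rw [h0, sign_zero, sign_eq_zero_iff] at this
    exact (hpa hk).1 this
  obtain ⟨xo, hxo, xu, hxu, hd⟩ := c.exists_isDouble hij hj hp (hpl i hai.symm) (hpl j haj.symm) hne
  obtain ⟨c', -, ho', hu'⟩ := D.exists_chart_two hd
  have hpo := hd.proj_over
  subst hpo
  obtain ⟨⟨q, hq, -, hqi, hqj, -, -, hql⟩, hO, hU⟩ :=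
    exists_common_points c hij.ne hxo hxu hd.proj_under.symm hne c' ho' hu'
  obtain ⟨o, ho, -, hoj, -, hol⟩ := hO 1
  obtain ⟨u, hu, -, hui, -, hul⟩ := hU (-1)
  rw [sign_one, sign_eq_one_iff] at hoj
  rw [sign_neg (by norm_num : (-1 : ℝ) < 0), sign_eq_neg_one_iff] at hui
  rw [(hasLabel_axis L C c hij hai haj hj hp hpl (fun hk => (hpa hk).1) hq hqi hqj
      (fun hk => hql a hk hai haj) hu hui (fun hk => hul a hk hai haj) ho hoj
      fun hk => hol a hk hai haj).doubleWeight_eq,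
    (hasLabel_axis L C c hij hai haj hj hp' hpl' hpa' hq hqi hqj
      (fun hk => (hql a hk hai haj).trans (hpa hk).2) hu hui
      (fun hk => (hul a hk hai haj).trans (hpa hk).2) ho hoj
      fun hk => (hol a hk hai haj).trans (hpa hk).2).doubleWeight_eq]

theorem doubleWeight_axis_congr (L : D.AlexanderNumbering) (n : ℤ) (η : B.Cochain 2 M)
    (C : D.Coloring B) {k : ℕ} (c : D.SheetChart k)
    {a i j : Fin 3} (hij : i < j) (hai : a ≠ i) (haj : a ≠ j) (hj : j.val < k) {s t t' : ℝ}
    (hs : s * s = 1) (ht : |t| < 1) (ht' : |t'| < 1) (ha : a.val < k → 0 < t ∧ 0 < t') :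
    doubleWeight L n η C (c.axis a s t) = doubleWeight L n η C (c.axis a s t') := by
  refine doubleWeight_congr L n η C c hij hai haj hj (c.axis_mem_source hs ht)
    (fun l hl => ?_) (c.axis_mem_source hs ht') (fun l hl => ?_) fun hk => ?_
  · rw [c.chart_axis hs ht, KnottedSurface.axisVector_apply_of_ne hl]
  · rw [c.chart_axis hs ht', KnottedSurface.axisVector_apply_of_ne hl]
  · obtain ⟨h1, h2⟩ := ha hk
    rw [c.chart_axis hs ht, c.chart_axis hs ht', KnottedSurface.axisVector_apply_self,
      KnottedSurface.axisVector_apply_self]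
    refine ⟨mul_ne_zero (left_ne_zero_of_mul (hs.symm ▸ one_ne_zero)) h1.ne', ?_⟩
    rw [sign_mul, sign_mul, sign_pos h1, sign_pos h2]

/-- The weight vanishes near a branch point, because the colours there are degenerate. -/
theorem doubleWeight_branch (L : D.AlexanderNumbering) (n : ℤ) (η : B.Cochain 2 M)
    (C : D.Coloring B) (b : D.BranchChart) {δ : ℝ} (hδ : 0 < δ)
    (hball : Metric.ball (0 : E2) δ ⊆ b.surfaceChart.target) {p : E3} (hp : p ∈ b.chart.source)
    (hpδ : 4 * b.chart p 1 < δ ^ 2) (hd : p ∈ D.doubleLocus) : doubleWeight L n η C p = 0 := by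
  obtain ⟨xo, xu, hd⟩ := hd
  obtain ⟨ℓ, x, y, h⟩ := exists_hasLabel L C hd
  rw [h.doubleWeight_eq, TwistedBiquandle.evalChain_degenerate η
    (h.degenerate b hδ hball hp hpδ), smul_zero]

end BrokenSurfaceDiagram

namespace BrokenSurfaceDiagram

variable {F : Type*} [TopologicalSpace F] [ChartedSpace (EuclideanSpace ℝ (Fin 2)) F]
  {D : BrokenSurfaceDiagram F}

/-! ### The flow of weights through a ball -/

theorem center_mem_chartBall {k : ℕ} (c : D.SheetChart k) {r : ℝ} (hr0 : 0 < r) :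
    c.center ∈ chartBall c.chart r :=
  ⟨0, by simpa using hr0, rfl⟩

theorem notMem_closure_chartBall {k : ℕ} (c : D.SheetChart k) {r : ℝ} (hr : r < 1) {τ : E3}
    (hτ : τ ∈ D.triplePoints) (hne : τ ≠ c.center) : τ ∉ closure (chartBall c.chart r) :=
  fun h => hne (eq_center_of_triple c hτ (closure_chartBall_subset c.target_eq hr h).1).2

variable [IsManifold (𝓡 2) ∞ F] {M : Type*} [AddCommGroup M]

variable (D) in
/-- A neighbourhood `U` of the point `p`, through the boundary of which the weights `w` of the
double curves flow out with total `flow`: for every piecewise constant cut-off function `g`, which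
is `1` near `p` if `p` is a triple point, the jumps of `g` on `U`, continued by zero, have total
weight `-flow`. -/
structure IsPatch (w : E3 → M) (flow : M) (p : E3) (U : Set E3) : Prop where
  isOpen : IsOpen U
  mem : p ∈ U
  piecewiseConstant : D.doubleCurves.PiecewiseConstant (U.indicator 1)
  notMem_closure : ∀ τ ∈ D.triplePoints, τ ≠ p → τ ∉ closure U
  totalJump_eq : ∀ g : E3 → ℤ, D.doubleCurves.PiecewiseConstant g →
    (p ∈ D.triplePoints → ∀ᶠ x in 𝓝 p, g x = 1) →
    D.doubleCurves.totalJump w (fun x => g x * U.indicator 1 x) = -flow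

theorem isPatch_one (c : D.SheetChart 1) (w : E3 → M) :
    D.IsPatch w 0 c.center (chartBall c.chart (1 / 2)) where
  isOpen := isOpen_chartBall c.target_eq (by norm_num)
  mem := center_mem_chartBall c (by norm_num)
  piecewiseConstant := piecewiseConstant_indicator_sheetChart c (by norm_num) (by norm_num)
  notMem_closure _ hτ hne := notMem_closure_chartBall c (by norm_num) hτ hne
  totalJump_eq g hg _ := by
    rw [neg_zero]
    refine OrientedCurves.totalJump_eq_zero fun q hq => Or.inl ?_
    refine jump_mul_indicator_eq_zero hq (fun hcl => ?_) g
    have hs := (closure_chartBall_subset c.target_eq (by norm_num) hcl).1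
    obtain ⟨-, i, j, hij, -, -, hj, -⟩ := exists_axis_of_mem_doubleLocus c hq hs
    have : i.val < j.val := hij
    omega

/-- The weights that enter along a double curve leave along it. -/
theorem isPatch_two (c : D.SheetChart 2) (w : E3 → M)
    (hw : ∀ t : ℝ, |t| < 1 → w (c.axis 2 1 t) = w (c.axis 2 1 0)) :
    D.IsPatch w 0 c.center (chartBall c.chart (1 / 2)) where
  isOpen := isOpen_chartBall c.target_eq (by norm_num)
  mem := center_mem_chartBall c (by norm_num)
  piecewiseConstant := piecewiseConstant_indicator_sheetChart c (by norm_num) (by norm_num)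
  notMem_closure _ hτ hne := notMem_closure_chartBall c (by norm_num) hτ hne
  totalJump_eq g hg _ := by
    have hone : (1 : ℝ) * 1 = 1 := one_mul 1
    have hr : (1 / 2 : ℝ) < 1 := by norm_num
    have hcast : ((1 : ℤ) : ℝ) = 1 := Int.cast_one
    have harc := isArc_axis c (a := 2) (i := 0) (j := 1) (s := 1) (α := -1) (β := 1) (by decide)
      (by decide) (by decide) (by decide) (by norm_num) (by norm_num) le_rfl le_rfl
      (fun h => absurd h (by decide))
    rw [hcast] at harc
    have hend (t : ℝ) (ht : |t| < 1) (ht' : 1 / 2 < |t|) :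
        g (c.axis 2 1 t) * (chartBall c.chart (1 / 2)).indicator 1 (c.axis 2 1 t) = 0 := by
      rw [indicator_of_notMem, mul_zero]
      rw [mem_chartBall_iff c.target_eq hr (c.axis_mem_source hone ht), c.chart_axis hone ht,
        KnottedSurface.norm_axisVector hone]
      exact ht'.not_gt
    rw [OrientedCurves.totalJump_eq_sum_arcs (ι := Unit) (γ := fun _ => c.axis 2 1)
      (α := fun _ => 0) (β := fun _ => 0) (W := fun _ => w (c.axis 2 1 0)) (fun _ => harc)
      (fun _ _ _ _ _ _ _ => rfl) (fun _ t ht => hw t (abs_lt.2 ht))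
      (hg.map₂ (piecewiseConstant_indicator_sheetChart c (by norm_num) hr) (· * ·))]
    · simp
    · intro _
      filter_upwards [Ioo_mem_nhdsGT (by norm_num : (-1 : ℝ) < -1 / 2)] with t ht
      have : |t| = -t := abs_of_neg (by linarith [ht.2])
      exact hend t (by linarith [ht.1]) (by linarith [ht.2])
    · intro _
      filter_upwards [Ioo_mem_nhdsLT (by norm_num : (1 / 2 : ℝ) < 1)] with t ht
      have : |t| = t := abs_of_pos (by linarith [ht.1])
      exact hend t (by linarith [ht.2]) (by linarith [ht.1])
    · intro q hq hj
      refine ⟨(), c.chart q 2, ?_⟩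
      have hcl : q ∈ closure (chartBall c.chart (1 / 2)) := by
        by_contra hcl
        exact hj (jump_mul_indicator_eq_zero hq hcl g)
      obtain ⟨hs, hqr⟩ := closure_chartBall_subset c.target_eq hr hcl
      have hl := (c.mem_doubleLocus_iff (a := 2) (i := 0) (j := 1) (by decide) (by decide)
        (by decide) (by decide) hs (fun h => absurd h (by decide))).1 hq
      have h1 := KnottedSurface.eq_axisVector hl hone
      rw [one_mul] at h1
      refine ⟨abs_lt.1 ?_, ?_⟩
      · have := c.norm_chart_lt hs
        rwa [h1, KnottedSurface.norm_axisVector hone] at this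
      · rw [KnottedSurface.SheetChart.axis, ← h1, c.chart.left_inv hs]

/-- At a triple point, the weights flow out along the six half-axes. -/
theorem isPatch_three (c : D.SheetChart 3) (w : E3 → M) (W : Fin 3 × Bool → M)
    (hw : ∀ a s, ∀ t ∈ Ioo (0 : ℝ) 1, w (c.axis a (boolSign s) t) = W (a, s)) :
    D.IsPatch w (∑ x, (boolSign x.2 * axisSign x.1 * c.orientationSign) • W x) c.center
      (chartBall c.chart (1 / 2)) where
  isOpen := isOpen_chartBall c.target_eq (by norm_num)
  mem := center_mem_chartBall c (by norm_num)
  piecewiseConstant := piecewiseConstant_indicator_sheetChart c (by norm_num) (by norm_num)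
  notMem_closure _ hτ hne := notMem_closure_chartBall c (by norm_num) hτ hne
  totalJump_eq g hg hg1 := by
    have hr : (1 / 2 : ℝ) < 1 := by norm_num
    have habs (t : ℝ) (ht : t ∈ Ioo (0 : ℝ) 1) : |t| < 1 := by rw [abs_of_pos ht.1]; exact ht.2
    have hbs := boolSign_mul_self_real
    have harc (x : Fin 3 × Bool) : D.doubleCurves.IsArc (c.axis x.1 (boolSign x.2)) 0 1
        (boolSign x.2 * axisSign x.1 * c.orientationSign) := by
      obtain ⟨a, s⟩ := x
      obtain ⟨i, j, hij, hai, haj⟩ : ∃ i j : Fin 3, i < j ∧ a ≠ i ∧ a ≠ j := by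
        clear * -
        decide +revert
      exact isArc_axis c hij hai haj j.isLt (boolSign_mul_self s) one_pos (by norm_num) le_rfl
        fun _ => le_rfl
    rw [OrientedCurves.totalJump_eq_sum_arcs (α := fun _ => 1) (β := fun _ => 0) (W := W) harc
      ?_ (fun x t ht => hw x.1 x.2 t ht)
      (hg.map₂ (piecewiseConstant_indicator_sheetChart c (by norm_num) hr) (· * ·))]
    · simp
    · intro x
      have hcont : ContinuousAt (c.axis x.1 (boolSign x.2)) 0 :=
        (c.hasDerivAt_axis (hbs x.2) (by simp)).continuousAt
      have h1 : ∀ᶠ q in 𝓝 c.center, g q * (chartBall c.chart (1 / 2)).indicator 1 q = 1 := by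
        filter_upwards [hg1 ⟨c, rfl⟩, (isOpen_chartBall c.target_eq hr).mem_nhds
          (center_mem_chartBall c (by norm_num))] with q h1 h2
        rw [h1, indicator_of_mem h2, Pi.one_apply, one_mul]
      rw [← axis_zero c x.1 (boolSign x.2)] at h1
      exact (hcont.eventually h1).filter_mono nhdsWithin_le_nhds
    · intro x
      filter_upwards [Ioo_mem_nhdsLT (by norm_num : (1 / 2 : ℝ) < 1)] with t ht
      have ht' : |t| = t := abs_of_pos (by linarith [ht.1])
      have hlt : |t| < 1 := ht'.trans_lt ht.2
      rw [indicator_of_notMem, mul_zero]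
      rw [mem_chartBall_iff c.target_eq hr (c.axis_mem_source (hbs x.2) hlt),
        c.chart_axis (hbs x.2) hlt, KnottedSurface.norm_axisVector (hbs x.2), ht']
      exact ht.1.not_gt
    · intro q hq hj
      have hcl : q ∈ closure (chartBall c.chart (1 / 2)) := by
        by_contra hcl
        exact hj (jump_mul_indicator_eq_zero hq hcl g)
      obtain ⟨hs, -⟩ := closure_chartBall_subset c.target_eq hr hcl
      obtain ⟨a, i, j, hij, hai, haj, hj', hl, ha⟩ := exists_axis_of_mem_doubleLocus c hq hs
      obtain ⟨s, hqs, hqn⟩ := eq_axis c hs hl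
      exact ⟨(a, s), |c.chart q a|, ⟨abs_pos.2 (ha a.isLt), hqn ▸ c.norm_chart_lt hs⟩, hqs.symm⟩
    · rintro ⟨a, s⟩ ⟨a', s'⟩ t ht u hu htu
      have h1 : KnottedSurface.axisVector a (boolSign s) t =
          KnottedSurface.axisVector a' (boolSign s') u := by
        rw [← c.chart_axis (hbs s) (habs t ht), ← c.chart_axis (hbs s') (habs u hu)]
        exact congrArg c.chart htu
      have h2 : (boolSign s : ℝ) * t = KnottedSurface.axisVector a' (boolSign s') u a := by
        rw [← h1, KnottedSurface.axisVector_apply_self]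
      have haa : a = a' := by
        by_contra hne
        rw [KnottedSurface.axisVector_apply_of_ne hne] at h2
        exact mul_ne_zero (left_ne_zero_of_mul ((hbs s).symm ▸ one_ne_zero)) ht.1.ne' h2
      subst haa
      rw [KnottedSurface.axisVector_apply_self] at h2
      have ht0 := ht.1
      have hu0 := hu.1
      cases s <;> cases s' <;> simp [boolSign] at h2 ⊢ <;> linarith

/-- No weight flows out of a neighbourhood of a branch point in which the weights vanish. -/
theorem isPatch_branch (b : D.BranchChart) (w : E3 → M)
    (hw : ∀ (δ : ℝ), 0 < δ → Metric.ball (0 : E2) δ ⊆ b.surfaceChart.target →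
      ∀ q ∈ b.chart.source, 4 * b.chart q 1 < δ ^ 2 → q ∈ D.doubleLocus → w q = 0) :
    ∃ U, D.IsPatch w 0 b.center U := by
  obtain ⟨ε, hε, hεb⟩ := Metric.isOpen_iff.1 b.surfaceChart.open_target 0 b.zero_mem
  set δ := min ε 1 with hδ'
  have hδ : 0 < δ := lt_min hε one_pos
  have hδ1 : δ ≤ 1 := min_le_right _ _
  have hball : Metric.ball (0 : E2) δ ⊆ b.surfaceChart.target :=
    (Metric.ball_subset_ball (min_le_left _ _)).trans hεb
  have hδ2 : 0 < δ ^ 2 := by positivity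
  have hδ3 : δ ^ 2 ≤ 1 := pow_le_one₀ hδ.le hδ1
  have hr0 : 0 < δ ^ 2 / 8 := by positivity
  have hr : δ ^ 2 / 8 < 1 := by linarith
  have hcl := closure_chartBall_subset b.target_eq hr
  refine ⟨chartBall b.chart (δ ^ 2 / 8), isOpen_chartBall b.target_eq hr,
    ⟨0, by simpa using hr0, rfl⟩,
    piecewiseConstant_indicator_branchChart b hδ hball hr0 hr (by linarith),
    fun τ hτ _ h => triple_notMem_branch b hτ (hcl h).1, fun g hg _ => ?_⟩
  rw [neg_zero]
  refine OrientedCurves.totalJump_eq_zero fun q hq => ?_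
  by_cases hqc : q ∈ closure (chartBall b.chart (δ ^ 2 / 8))
  · obtain ⟨hs, hqr⟩ := hcl hqc
    have h1 : b.chart q 1 ≤ ‖b.chart q‖ :=
      (le_abs_self _).trans (PiLp.norm_apply_le (b.chart q) 1)
    -- the radius `δ² / 8` ensures that `4 v² < δ²` on the double curve in the closed ball
    exact Or.inr (hw δ hδ hball q hs (by linarith) hq)
  · exact Or.inl (jump_mul_indicator_eq_zero hq hqc g)

/-- If the projected surface is covered by patches, then the weights that flow out of the triple
points add up to zero. -/
theorem finsum_flow_eq_zero [CompactSpace F] (w : E3 → M) (flow : E3 → M)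
    (hflow : ∀ p ∉ D.triplePoints, flow p = 0)
    (h : ∀ p ∈ range D.proj, ∃ U, D.IsPatch w (flow p) p U) :
    ∑ᶠ τ : D.triplePoints, flow τ = 0 := by
  classical
  have htriple : D.triplePoints ⊆ range D.proj := by
    rintro p ⟨c, rfl⟩
    obtain ⟨x, -, hx⟩ := exists_three_preimages c
    exact ⟨x 0, hx 0⟩
  choose! U hU using h
  have hcpt : IsCompact (range D.proj) := isCompact_range D.continuous_proj
  obtain ⟨t, htr, hcov⟩ := hcpt.elim_nhds_subcover U fun p hp =>
    (hU p hp).isOpen.mem_nhds (hU p hp).mem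
  have hsum : ∑ p ∈ t, flow p = 0 := by
    refine OrientedCurves.sum_flow_eq_zero (S := D.doubleCurves) (w := w) t D.triplePoints
      (fun p hp => (hU p (htr p hp)).isOpen) ?_ (fun p hp => (hU p (htr p hp)).piecewiseConstant)
      (fun p hp => (hU p (htr p hp)).totalJump_eq) fun p _ hpV p' hp' hne =>
        (hU p' (htr p' hp')).notMem_closure p hpV hne.symm
    rintro q ⟨xo, xu, hd⟩
    exact hcov ⟨xo, hd.proj_over⟩
  have hsub : D.triplePoints ⊆ t := by
    intro τ hτ
    obtain ⟨p, hp, hτp⟩ := mem_iUnion₂.1 (hcov (htriple hτ))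
    by_contra hne
    exact (hU p (htr p hp)).notMem_closure τ hτ (fun h => hne (h ▸ hp)) (subset_closure hτp)
  rw [finsum_set_coe_eq_finsum_mem, finsum_mem_eq_sum_of_inter_support_eq flow (t := t), hsum]
  ext p
  exact ⟨fun hp => ⟨hsub hp.1, hp.2⟩, fun hp => ⟨not_not.1 fun h => hp.2 (hflow p h), hp.2⟩⟩

end BrokenSurfaceDiagram

namespace KnottedSurface.SheetChart

variable {F : Type*} [TopologicalSpace F] [ChartedSpace (EuclideanSpace ℝ (Fin 2)) F]
  {K : KnottedSurface F} {k : ℕ}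

/-! ### The weight of a triple point -/

theorem value_region (c : K.SheetChart k) (L : K.Region → ℤ) {v : E3} (hv : ‖v‖ < 1)
    (h : ∀ j, v j ≠ 0) {q : E3} (hq : q ∈ c.chart.source)
    (hqv : ∀ j, SignType.sign (c.chart q j) = SignType.sign (v j)) :
    L (c.region hv h) = K.regionValue L q := by
  have ht : v ∈ c.chart.target := c.mem_target hv
  have hmem : c.chart.symm v ∈ (Set.range K.proj)ᶜ := by
    refine c.notMem_range_of_coord_ne_zero (c.chart.map_target ht) fun l _ => ?_
    rw [c.chart.right_inv ht]
    exact h l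
  refine (regionValue_eq L hmem).symm.trans
    (c.regionValue_congr L (c.chart.map_target ht) hq fun l _ => ?_)
  rw [c.chart.right_inv ht]
  exact ⟨h l, (hqv l).symm⟩

variable [IsManifold (𝓡 2) ∞ F]

theorem color_semiSheet [CompactSpace F] {X : Type*} [Nonempty X] (c : K.SheetChart k) (C : K.SemiSheet → X)
    {i : Fin 3} (hi : i.val < k) {v : E3} (hv : ‖v‖ < 1) (hvi : v i = 0)
    (h : ∀ j, j ≠ i → v j ≠ 0) {x : F} (hx : x ∈ c.sheet i)
    (hxv : ∀ j, j ≠ i → SignType.sign (c.coord x j) = SignType.sign (v j)) :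
    C (c.semiSheet hi hv hvi h) = K.colorAt C x := by
  have hp := (c.exists_point hi hv hvi).choose_spec
  have hreg : c.point hi hv hvi ∈ K.regularSet :=
    c.mem_regularSet hp.1 fun j hj => by
      unfold point
      rw [hp.2]
      exact h j hj
  refine (colorAt_eq C hreg).symm.trans (c.colorAt_congr C hp.1 hx fun l _ hl => ?_)
  unfold point
  rw [hp.2]
  exact ⟨h l hl, (hxv l hl).symm⟩

theorem tripleSign_eq (c : K.SheetChart 3) : c.tripleSign = c.orientationSign := by
  have hzero (i : Fin 3) : ‖(0 : E3)‖ < 1 ∧ (0 : E3) i = 0 := by simp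
  set x : Fin 3 → F := fun i => c.point i.isLt (hzero i).1 (hzero i).2 with hx
  have hxs (i : Fin 3) : x i ∈ c.sheet i :=
    (c.exists_point i.isLt (hzero i).1 (hzero i).2).choose_spec.1
  have hxc (i : Fin 3) : K.proj (x i) = c.center := by
    rw [← c.symm_coord (hxs i), show c.coord (x i) = 0 from
      (c.exists_point i.isLt (hzero i).1 (hzero i).2).choose_spec.2]
    rfl
  -- the rows of the Jacobian matrix are positive multiples of the normals
  set lam : Fin 3 → ℝ := fun i => fderiv ℝ c.chart (K.proj (x i)) (K.normal (x i)) i with hlam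
  have hlam0 (i : Fin 3) : 0 < lam i := c.normal_pos i _ (hxs i)
  set N : Matrix (Fin 3) (Fin 3) ℝ := Matrix.of fun i => (K.normal (x i)).ofLp with hN
  have hJ : c.jacobian c.center = Matrix.diagonal lam * N := by
    ext i m
    rw [Matrix.diagonal_mul]
    have h1 := c.jacobian_row (hxs i)
    rw [hxc i] at h1
    have h2 := congrArg (fun v : E3 => v m) h1
    simp only [PiLp.smul_apply, smul_eq_mul] at h2
    rw [h2, hlam, hN]
    simp only [hxc i, Matrix.of_apply]
  have hdet : (c.jacobian c.center).det = (∏ i, lam i) * N.det := by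
    rw [hJ, Matrix.det_mul, Matrix.det_diagonal]
  rw [orientationSign, hdet, sign_mul, sign_pos (Finset.prod_pos fun i _ => hlam0 i), one_mul]
  rfl

end KnottedSurface.SheetChart

namespace BrokenSurfaceDiagram

variable {F : Type*} [TopologicalSpace F] [ChartedSpace (EuclideanSpace ℝ (Fin 2)) F]
  {D : BrokenSurfaceDiagram F} {X : Type*} [Nonempty X] {B : TwistedBiquandle X}
  {M : Type*} [AddCommGroup M] [Module ℤ[T;T⁻¹] M]

theorem norm_lt_one_of_abs_le_half {v : E3} (h : ∀ l, |v l| ≤ 1 / 2) : ‖v‖ < 1 := by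
  have h1 := KnottedSurface.norm_half_lt (v 0) (v 1) (v 2) (h 0) (h 1) (h 2)
  have h2 : (!₂[v 0, v 1, v 2] : E3) = v := by
    ext l
    fin_cases l <;> rfl
  rwa [h2] at h1

theorem abs_boolSign_div_two (s : Bool) : |(boolSign s : ℝ) / 2| ≤ 1 / 2 := by
  cases s <;> simp [boolSign, abs_div]

theorem sign_boolSign_div_two (s : Bool) :
    SignType.sign ((boolSign s : ℝ) / 2) = SignType.sign (boolSign s : ℝ) := by
  rw [div_eq_mul_inv, sign_mul, sign_pos (by norm_num : (0 : ℝ) < 2⁻¹), mul_one]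

theorem sign_boolSign_ne_zero (s : Bool) : SignType.sign (boolSign s : ℝ) ≠ 0 := by
  rw [Ne, sign_eq_zero_iff]
  cases s <;> simp [boolSign]

theorem exists_sheet_point (c : D.SheetChart 3) (i : Fin 3) (s : Fin 3 → Bool) :
    ∃ x ∈ c.sheet i, ∀ l, l ≠ i →
      SignType.sign (c.coord x l) = SignType.sign (boolSign (s l) : ℝ) := by
  set v : E3 := WithLp.toLp 2 fun l => if l = i then 0 else (boolSign (s l) : ℝ) / 2 with hv
  have hvl (l : Fin 3) : v l = if l = i then 0 else (boolSign (s l) : ℝ) / 2 := rfl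
  have hvlt : ‖v‖ < 1 := norm_lt_one_of_abs_le_half fun l => by
    rw [hvl]
    split_ifs
    · simp
    · exact abs_boolSign_div_two _
  obtain ⟨x, hx, hxv⟩ := c.exists_point i.isLt hvlt (by simp [hv])
  refine ⟨x, hx, fun l hl => ?_⟩
  rw [hxv, hvl, if_neg hl, sign_boolSign_div_two]

theorem exists_region_point (c : D.SheetChart 3) (s : Fin 3 → Bool) :
    ∃ q ∈ c.chart.source, ∀ l,
      SignType.sign (c.chart q l) = SignType.sign (boolSign (s l) : ℝ) := by
  set v : E3 := WithLp.toLp 2 fun l => (boolSign (s l) : ℝ) / 2 with hv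
  have hvlt : ‖v‖ < 1 := norm_lt_one_of_abs_le_half fun l => abs_boolSign_div_two _
  have ht := c.mem_target hvlt
  refine ⟨c.chart.symm v, c.chart.map_target ht, fun l => ?_⟩
  rw [c.chart.right_inv ht]
  exact sign_boolSign_div_two _

/-- The colour, near a triple point, of the semi-sheet of the `i`-th sheet on which the other
coordinates have the signs `s`. -/
noncomputable def sheetColor (C : D.Coloring B) (c : D.SheetChart 3) (i : Fin 3)
    (s : Fin 3 → Bool) : X :=
  D.colorAt C.val (exists_sheet_point c i s).choose

/-- The Alexander number, near a triple point, of the region in which the coordinates have the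
signs `s`. -/
noncomputable def octantValue (L : D.AlexanderNumbering) (c : D.SheetChart 3)
    (s : Fin 3 → Bool) : ℤ :=
  D.regionValue L.toFun (exists_region_point c s).choose

theorem octantValue_update (L : D.AlexanderNumbering) (c : D.SheetChart 3) [IsManifold (𝓡 2) ∞ F]
    [CompactSpace F] (s : Fin 3 → Bool) (i : Fin 3) :
    octantValue L c (Function.update s i true) =
      octantValue L c (Function.update s i false) + 1 := by
  obtain ⟨h1, h1'⟩ := (exists_region_point c (Function.update s i false)).choose_spec
  obtain ⟨h2, h2'⟩ := (exists_region_point c (Function.update s i true)).choose_spec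
  refine regionValue_crossing L c i.isLt h1 h2 ?_ ?_ fun l _ hl => ⟨?_, ?_⟩
  · rw [← sign_eq_neg_one_iff, h1' i]
    simp [boolSign, sign_neg]
  · rw [← sign_eq_one_iff, h2' i]
    simp [boolSign]
  · rw [Ne, ← sign_eq_zero_iff, h1' l]
    exact sign_boolSign_ne_zero _
  · rw [h1' l, h2' l, Function.update_of_ne hl, Function.update_of_ne hl]

variable [IsManifold (𝓡 2) ∞ F] [CompactSpace F]

theorem sheetColor_congr (C : D.Coloring B) (c : D.SheetChart 3) {i : Fin 3} {s s' : Fin 3 → Bool}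
    (h : ∀ l, l ≠ i → s l = s' l) : sheetColor C c i s = sheetColor C c i s' := by
  obtain ⟨h1, h1'⟩ := (exists_sheet_point c i s).choose_spec
  obtain ⟨h2, h2'⟩ := (exists_sheet_point c i s').choose_spec
  refine c.colorAt_congr C.val h1 h2 fun l _ hl => ⟨?_, ?_⟩
  · rw [Ne, ← sign_eq_zero_iff, h1' l hl]
    exact sign_boolSign_ne_zero _
  · rw [h1' l hl, h2' l hl, h l hl]

/-- The colouring rule along the half-axis on which the remaining coordinate has sign `s a`. -/
theorem sheetColor_rule (C : D.Coloring B) (c : D.SheetChart 3) {a i j : Fin 3} (hij : i < j)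
    (hai : a ≠ i) (haj : a ≠ j) (s : Fin 3 → Bool) :
    B.R (sheetColor C c j (Function.update s i false),
        sheetColor C c i (Function.update s j true)) =
      (sheetColor C c i (Function.update s j false),
        sheetColor C c j (Function.update s i true)) := by
  have hthird : ∀ l, l ≠ i → l ≠ j → l = a := by
    clear * - hij hai haj
    decide +revert
  have hs := boolSign_mul_self_real (s a)
  have ht : |(1 / 2 : ℝ)| < 1 := by norm_num [abs_of_pos]
  have hpa : SignType.sign (c.chart (c.axis a (boolSign (s a)) (1 / 2)) a) =
      SignType.sign (boolSign (s a) : ℝ) := by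
    rw [c.chart_axis hs ht, KnottedSurface.axisVector_apply_self, mul_one_div,
      sign_boolSign_div_two]
  have hpl (l : Fin 3) (hl : l ≠ a) : c.chart (c.axis a (boolSign (s a)) (1 / 2)) l = 0 := by
    rw [c.chart_axis hs ht, KnottedSurface.axisVector_apply_of_ne hl]
  obtain ⟨h1, h1'⟩ := (exists_sheet_point c i (Function.update s j true)).choose_spec
  obtain ⟨h2, h2'⟩ := (exists_sheet_point c i (Function.update s j false)).choose_spec
  obtain ⟨h3, h3'⟩ := (exists_sheet_point c j (Function.update s i true)).choose_spec
  obtain ⟨h4, h4'⟩ := (exists_sheet_point c j (Function.update s i false)).choose_spec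
  refine coloring_rule C c hij j.isLt (c.axis_mem_source (a := a) hs ht) (hpl i hai.symm)
    (hpl j haj.symm) (fun l _ hli hlj => ?_) h1 ?_ h2 ?_ h3 ?_ h4 ?_ ?_
  · obtain rfl := hthird l hli hlj
    rw [Ne, ← sign_eq_zero_iff, hpa]
    exact sign_boolSign_ne_zero _
  · rw [← sign_eq_one_iff, h1' j hij.ne']
    simp [boolSign]
  · rw [← sign_eq_neg_one_iff, h2' j hij.ne']
    simp [boolSign, sign_neg]
  · rw [← sign_eq_one_iff, h3' i hij.ne]
    simp [boolSign]
  · rw [← sign_eq_neg_one_iff, h4' i hij.ne]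
    simp [boolSign, sign_neg]
  · intro x hx l _ hli hlj
    obtain rfl := hthird l hli hlj
    rw [hpa]
    rcases hx with rfl | rfl | rfl | rfl
    · rw [h1' l hai, Function.update_of_ne haj]
    · rw [h2' l hai, Function.update_of_ne haj]
    · rw [h3' l haj, Function.update_of_ne hai]
    · rw [h4' l haj, Function.update_of_ne hai]

theorem hasLabel_sheetColor (L : D.AlexanderNumbering) (C : D.Coloring B) (c : D.SheetChart 3)
    {a i j : Fin 3} (hij : i < j) (hai : a ≠ i) (haj : a ≠ j) (s : Fin 3 → Bool) {t : ℝ}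
    (ht0 : 0 < t) (ht1 : t < 1) :
    HasLabel L C (c.axis a (boolSign (s a)) t)
      (octantValue L c (Function.update (Function.update s i false) j false))
      (sheetColor C c j (Function.update s i false))
      (sheetColor C c i (Function.update s j true)) := by
  have hs := boolSign_mul_self_real (s a)
  have ht : |t| < 1 := by rwa [abs_of_pos ht0]
  have hpa : SignType.sign (c.chart (c.axis a (boolSign (s a)) t) a) =
      SignType.sign (boolSign (s a) : ℝ) := by
    rw [c.chart_axis hs ht, KnottedSurface.axisVector_apply_self, sign_mul, sign_pos ht0, mul_one]
  obtain ⟨h1, h1'⟩ := (exists_sheet_point c i (Function.update s j true)).choose_spec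
  obtain ⟨h2, h2'⟩ := (exists_region_point c
    (Function.update (Function.update s i false) j false)).choose_spec
  obtain ⟨h4, h4'⟩ := (exists_sheet_point c j (Function.update s i false)).choose_spec
  refine hasLabel_axis L C c hij hai haj j.isLt (c.axis_mem_source hs ht) (fun l hl => ?_)
    (fun _ => ?_) h2 ?_ ?_ (fun _ => ?_) h4 ?_ (fun _ => ?_) h1 ?_ fun _ => ?_
  · rw [c.chart_axis hs ht, KnottedSurface.axisVector_apply_of_ne hl]
  · rw [Ne, ← sign_eq_zero_iff, hpa]
    exact sign_boolSign_ne_zero _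
  · rw [← sign_eq_neg_one_iff, h2' i]
    simp [boolSign, sign_neg, hij.ne]
  · rw [← sign_eq_neg_one_iff, h2' j]
    simp [boolSign, sign_neg]
  · rw [h2' a, hpa, Function.update_of_ne haj, Function.update_of_ne hai]
  · rw [← sign_eq_neg_one_iff, h4' i hij.ne]
    simp [boolSign, sign_neg]
  · rw [h4' a haj, hpa, Function.update_of_ne hai]
  · rw [← sign_eq_one_iff, h1' j hij.ne']
    simp [boolSign]
  · rw [h1' a hai, hpa, Function.update_of_ne haj]

end BrokenSurfaceDiagram

namespace BrokenSurfaceDiagram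

variable {F : Type*} [TopologicalSpace F] [ChartedSpace (EuclideanSpace ℝ (Fin 2)) F]
  [IsManifold (𝓡 2) ∞ F] [CompactSpace F] {D : BrokenSurfaceDiagram F}
  {X : Type*} [Nonempty X] {B : TwistedBiquandle X}
  {M : Type*} [AddCommGroup M] [Module ℤ[T;T⁻¹] M]

/-- The labels of the six half-axes at a triple point, in terms of the colours `x`, `y`, `z` of the
bottom, middle and top semi-sheets and of the Alexander number `ℓ` of the source region: they are
the pairs that occur in the boundary of `(x, y, z)`. -/
theorem hasLabel_axis_triple (L : D.AlexanderNumbering) (C : D.Coloring B) (c : D.SheetChart 3)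
    {t : ℝ} (ht0 : 0 < t) (ht1 : t < 1) :
    let x := C.val c.bottomSemiSheet
    let y := C.val c.middleSemiSheet
    let z := C.val c.topSemiSheet
    let ℓ := L.toFun c.sourceRegion
    HasLabel L C (c.axis 0 (boolSign false) t) ℓ x y ∧
    HasLabel L C (c.axis 0 (boolSign true) t) (ℓ + 1)
      (B.R (x, (B.R (y, z)).1)).2 (B.R (y, z)).2 ∧
    HasLabel L C (c.axis 1 (boolSign false) t) ℓ x (B.R (y, z)).1 ∧
    HasLabel L C (c.axis 1 (boolSign true) t) (ℓ + 1) (B.R (x, y)).2 z ∧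
    HasLabel L C (c.axis 2 (boolSign false) t) ℓ (B.R (x, y)).1 (B.R ((B.R (x, y)).2, z)).1 ∧
    HasLabel L C (c.axis 2 (boolSign true) t) (ℓ + 1) y z := by
  intro x y z ℓ
  -- the colours of the bottom, middle and top sheet, by the signs of the two other coordinates
  set b : Bool → Bool → X := fun s₀ s₁ => sheetColor C c 2 ![s₀, s₁, false] with hb
  set m : Bool → Bool → X := fun s₀ s₂ => sheetColor C c 1 ![s₀, false, s₂] with hm
  set u : Bool → Bool → X := fun s₁ s₂ => sheetColor C c 0 ![false, s₁, s₂] with hu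
  have hx : x = b false false := by
    obtain ⟨h1, h2⟩ := (exists_sheet_point c 2 ![false, false, false]).choose_spec
    refine c.color_semiSheet C.val _ _ _ _ h1 fun j hj => (h2 j hj).trans ?_
    fin_cases j
    · simp [boolSign, sign_neg, neg_div]
    · simp [boolSign, sign_neg, neg_div]
    · exact absurd rfl hj
  have hy : y = m false true := by
    obtain ⟨h1, h2⟩ := (exists_sheet_point c 1 ![false, false, true]).choose_spec
    refine c.color_semiSheet C.val _ _ _ _ h1 fun j hj => (h2 j hj).trans ?_
    fin_cases j
    · simp [boolSign, sign_neg, neg_div]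
    · exact absurd rfl hj
    · simp [boolSign]
  have hz : z = u true true := by
    obtain ⟨h1, h2⟩ := (exists_sheet_point c 0 ![false, true, true]).choose_spec
    refine c.color_semiSheet C.val _ _ _ _ h1 fun j hj => (h2 j hj).trans ?_
    fin_cases j
    · exact absurd rfl hj
    · simp [boolSign]
    · simp [boolSign]
  have hℓ : ℓ = octantValue L c ![false, false, false] := by
    obtain ⟨h1, h2⟩ := (exists_region_point c ![false, false, false]).choose_spec
    refine c.value_region L.toFun _ _ h1 fun j => (h2 j).trans ?_
    fin_cases j <;> simp [boolSign, sign_neg, neg_div]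
  have hℓ' (a : Fin 3) :
      octantValue L c (Function.update ![false, false, false] a true) = ℓ + 1 := by
    rw [octantValue_update, hℓ]
    congr 2
    fin_cases a <;> decide
  have hbu (s₀ s₁ : Bool) {s : Fin 3 → Bool} (h0 : s 0 = s₀) (h1 : s 1 = s₁) :
      sheetColor C c 2 s = b s₀ s₁ := by
    refine sheetColor_congr C c fun l hl => ?_
    fin_cases l
    · exact h0
    · exact h1
    · exact absurd rfl hl
  have hmu (s₀ s₂ : Bool) {s : Fin 3 → Bool} (h0 : s 0 = s₀) (h2 : s 2 = s₂) :
      sheetColor C c 1 s = m s₀ s₂ := by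
    refine sheetColor_congr C c fun l hl => ?_
    fin_cases l
    · exact h0
    · exact absurd rfl hl
    · exact h2
  have huu (s₁ s₂ : Bool) {s : Fin 3 → Bool} (h1 : s 1 = s₁) (h2 : s 2 = s₂) :
      sheetColor C c 0 s = u s₁ s₂ := by
    refine sheetColor_congr C c fun l hl => ?_
    fin_cases l
    · exact absurd rfl hl
    · exact h1
    · exact h2
  -- the colouring rule along the three axes
  have r0 (s : Bool) : B.R (b s false, m s true) = (m s false, b s true) := by
    have h := sheetColor_rule C c (a := 0) (i := 1) (j := 2) (by decide) (by decide) (by decide)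
      ![s, false, false]
    rwa [hbu s false rfl rfl, hmu s true rfl rfl, hmu s false rfl rfl, hbu s true rfl rfl] at h
  have r1 (s : Bool) : B.R (b false s, u s true) = (u s false, b true s) := by
    have h := sheetColor_rule C c (a := 1) (i := 0) (j := 2) (by decide) (by decide) (by decide)
      ![false, s, false]
    rwa [hbu false s rfl rfl, huu s true rfl rfl, huu s false rfl rfl, hbu true s rfl rfl] at h
  have r2 (s : Bool) : B.R (m false s, u true s) = (u false s, m true s) := by
    have h := sheetColor_rule C c (a := 2) (i := 0) (j := 1) (by decide) (by decide) (by decide)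
      ![false, false, s]
    rwa [hmu false s rfl rfl, huu true s rfl rfl, huu false s rfl rfl, hmu true s rfl rfl] at h
  have l0 (s : Bool) : HasLabel L C (c.axis 0 (boolSign s) t)
      (octantValue L c ![s, false, false]) (b s false) (m s true) := by
    have h := hasLabel_sheetColor L C c (a := 0) (i := 1) (j := 2) (by decide) (by decide)
      (by decide) ![s, false, false] ht0 ht1
    rw [hbu s false rfl rfl, hmu s true rfl rfl] at h
    have hv : Function.update (Function.update ![s, false, false] 1 false) 2 false = ![s, false, false] := by
      cases s <;> decide
    rw [hv] at h
    exact h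
  have l1 (s : Bool) : HasLabel L C (c.axis 1 (boolSign s) t)
      (octantValue L c ![false, s, false]) (b false s) (u s true) := by
    have h := hasLabel_sheetColor L C c (a := 1) (i := 0) (j := 2) (by decide) (by decide)
      (by decide) ![false, s, false] ht0 ht1
    rw [hbu false s rfl rfl, huu s true rfl rfl] at h
    have hv : Function.update (Function.update ![false, s, false] 0 false) 2 false = ![false, s, false] := by
      cases s <;> decide
    rw [hv] at h
    exact h
  have l2 (s : Bool) : HasLabel L C (c.axis 2 (boolSign s) t)
      (octantValue L c ![false, false, s]) (m false s) (u true s) := by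
    have h := hasLabel_sheetColor L C c (a := 2) (i := 0) (j := 1) (by decide) (by decide)
      (by decide) ![false, false, s] ht0 ht1
    rw [hmu false s rfl rfl, huu true s rfl rfl] at h
    have hv : Function.update (Function.update ![false, false, s] 0 false) 1 false = ![false, false, s] := by
      cases s <;> decide
    rw [hv] at h
    exact h
  have v0 : octantValue L c ![true, false, false] = ℓ + 1 := by
    rw [← hℓ' 0]
    congr 1
    decide
  have v1 : octantValue L c ![false, true, false] = ℓ + 1 := by
    rw [← hℓ' 1]
    congr 1
    decide
  have v2 : octantValue L c ![false, false, true] = ℓ + 1 := by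
    rw [← hℓ' 2]
    congr 1
    decide
  have e0 := r0 false
  have e2 := r2 true
  rw [← hx, ← hy] at e0
  rw [← hy, ← hz] at e2
  have e1 := r1 false
  have e1' := r1 true
  have k2 : u false true = (B.R (y, z)).1 := by rw [e2]
  have k2' : m true true = (B.R (y, z)).2 := by rw [e2]
  have k0 : m false false = (B.R (x, y)).1 := by rw [e0]
  have k0' : b false true = (B.R (x, y)).2 := by rw [e0]
  rw [← hx, k2] at e1
  rw [k0', ← hz] at e1'
  have k1 : b true false = (B.R (x, (B.R (y, z)).1)).2 := by rw [e1]
  have k1' : u true false = (B.R ((B.R (x, y)).2, z)).1 := by rw [e1']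
  have q0 := l0 false
  have q0' := l0 true
  have q1 := l1 false
  have q1' := l1 true
  have q2 := l2 false
  have q2' := l2 true
  rw [← hℓ, ← hx, ← hy] at q0
  rw [v0, k1, k2'] at q0'
  rw [← hℓ, ← hx, k2] at q1
  rw [v1, k0', ← hz] at q1'
  rw [← hℓ, k0, k1'] at q2
  rw [v2, ← hy, ← hz] at q2'
  exact ⟨q0, q0', q1, q1', q2, q2'⟩

/-- The weights that flow out of a triple point add up to the weight of the triple point, up to
sign, if the cocycle is the coboundary of `η`. -/
theorem sum_doubleWeight_axis (L : D.AlexanderNumbering) (n : ℤ) {φ : B.Cochain 3 M}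
    {η : B.Cochain 2 M} (hη : B.IsCoboundaryOf 0 n φ η) (C : D.Coloring B) (c : D.SheetChart 3) :
    ∑ x : Fin 3 × Bool, (boolSign x.2 * axisSign x.1 * c.orientationSign) •
        doubleWeight L n η C (c.axis x.1 (boolSign x.2) (1 / 2)) =
      -((LaurentPolynomial.T (-(n * L.toFun c.sourceRegion)) : ℤ[T;T⁻¹]) •
        (c.tripleSign • B.evalChain φ
          (B.gen ![C.val c.bottomSemiSheet, C.val c.middleSemiSheet, C.val c.topSemiSheet]))) := by
  obtain ⟨q0, q0', q1, q1', q2, q2'⟩ :=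
    hasLabel_axis_triple L C c (t := 1 / 2) (by norm_num) (by norm_num)
  rw [Fintype.sum_prod_type, Fin.sum_univ_three]
  simp only [Fintype.sum_bool]
  rw [q0.doubleWeight_eq, q0'.doubleWeight_eq, q1.doubleWeight_eq, q1'.doubleWeight_eq,
    q2.doubleWeight_eq, q2'.doubleWeight_eq, hη, B.boundary_gen_three, c.tripleSign_eq,
    smul_comm]
  simp only [TwistedBiquandle.evalChain_add, TwistedBiquandle.evalChain_sub,
    TwistedBiquandle.evalChain_neg, TwistedBiquandle.evalChain_smul, smul_add, smul_sub, smul_neg]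
  have e1 (ℓ : ℤ) : -(n * (ℓ + 1 - 1)) = -(n * ℓ) := by ring
  have e2 (ℓ : ℤ) : -(n * (ℓ - 1)) = -(n * ℓ) + n := by ring
  have a0 : axisSign 0 = 1 := rfl
  have a1 : axisSign 1 = -1 := rfl
  have a2 : axisSign 2 = 1 := rfl
  have s0 : boolSign false = -1 := rfl
  have s1 : boolSign true = 1 := rfl
  simp only [e1, e2, LaurentPolynomial.T_add, a0, a1, a2, s0, s1]
  module

variable (D) in
/-- Every point of the projected surface has a patch; the flow out of it is minus the weight at a
triple point, and zero elsewhere. -/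
theorem exists_isPatch (L : D.AlexanderNumbering) (n : ℤ) {φ : B.Cochain 3 M}
    {η : B.Cochain 2 M} (hη : B.IsCoboundaryOf 0 n φ η) (C : D.Coloring B) {flow : E3 → M}
    (hflow : ∀ p ∉ D.triplePoints, flow p = 0)
    (hflow' : ∀ τ : D.triplePoints, flow τ = -weight L n φ C τ) {p : E3}
    (hp : p ∈ range D.proj) : ∃ U, D.IsPatch (doubleWeight L n η C) (flow p) p U := by
  by_cases hpt : p ∈ D.triplePoints
  · have hc := hpt.choose_spec
    have h := isPatch_three hpt.choose (doubleWeight L n η C)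
      (fun x => doubleWeight L n η C (hpt.choose.axis x.1 (boolSign x.2) (1 / 2))) fun a s t ht => by
        obtain ⟨i, j, hij, hai, haj⟩ : ∃ i j : Fin 3, i < j ∧ a ≠ i ∧ a ≠ j := by
          clear * -
          decide +revert
        exact doubleWeight_axis_congr L n η C _ hij hai haj j.isLt (boolSign_mul_self_real s)
          (by rw [abs_of_pos ht.1]; exact ht.2) (by norm_num [abs_of_pos])
          fun _ => ⟨ht.1, by norm_num⟩
    rw [sum_doubleWeight_axis L n hη, hc] at h
    exact ⟨_, (hflow' ⟨p, hpt⟩).symm ▸ h⟩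
  rw [hflow p hpt]
  rcases D.generic p hp with ⟨k, hk, c, rfl⟩ | ⟨b, rfl⟩
  · obtain ⟨h1, h3⟩ := hk
    interval_cases k
    · exact ⟨_, isPatch_one c _⟩
    · refine ⟨_, isPatch_two c _ fun t ht => ?_⟩
      exact doubleWeight_axis_congr L n η C c (i := 0) (j := 1) (by decide) (by decide) (by decide)
        (by decide) (one_mul 1) ht (by simp) fun h => absurd h (by decide)
    · exact absurd ⟨c, rfl⟩ hpt
  · exact isPatch_branch b _ fun δ hδ hball q hq hqδ hqd =>
      doubleWeight_branch L n η C b hδ hball hq hqδ hqd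

/-- For a coboundary, the weights of the triple points add up to zero. -/
theorem finsum_weight_eq_zero (L : D.AlexanderNumbering) (n : ℤ) {φ : B.Cochain 3 M}
    {η : B.Cochain 2 M} (hη : B.IsCoboundaryOf 0 n φ η) (C : D.Coloring B) :
    ∑ᶠ τ : D.triplePoints, weight L n φ C τ = 0 := by
  classical
  set flow : E3 → M := fun p => if h : p ∈ D.triplePoints then -weight L n φ C ⟨p, h⟩ else 0
    with hflow
  have h0 : ∀ p ∉ D.triplePoints, flow p = 0 := fun p hp => dif_neg hp
  have h1 (τ : D.triplePoints) : flow τ = -weight L n φ C τ := dif_pos τ.property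
  have h2 := finsum_flow_eq_zero (doubleWeight L n η C) flow h0
    fun p hp => exists_isPatch D L n hη C h0 h1 hp
  rw [finsum_congr h1, finsum_neg_distrib, neg_eq_zero] at h2
  exact h2

end BrokenSurfaceDiagram

theorem mainTheorem8 {X : Type*} [Finite X] (B : TwistedBiquandle X)
    {M : Type*} [AddCommGroup M] [Module ℤ[T;T⁻¹] M] [Finite M] (n : ℤ)
    (φ : B.Cochain 3 M) (hφ : B.IsCocycle 0 n φ)
    (η : B.Cochain 2 M) (hη : B.IsCoboundaryOf 0 n φ η)
    {F : Type*} [TopologicalSpace F] [T2Space F] [CompactSpace F]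
    [ChartedSpace (EuclideanSpace ℝ (Fin 2)) F] [IsManifold (𝓡 2) ∞ F]
    (D : BrokenSurfaceDiagram F) (L : D.AlexanderNumbering) :
    Finite (D.Coloring B) ∧ D.triplePoints.Finite ∧
      BrokenSurfaceDiagram.stateSum (B := B) L n φ = (Nat.card (D.Coloring B) : AddMonoidAlgebra ℤ M) := by
  have hfin : Finite (D.Coloring B) := D.finite_coloring B
  refine ⟨hfin, D.finite_triplePoints, ?_⟩
  have hweight (C : D.Coloring B) :
      ∑ᶠ τ : D.triplePoints, BrokenSurfaceDiagram.weight L n φ C τ = 0 := by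
    rcases isEmpty_or_nonempty X with hX | hX
    · -- a diagram with a triple point has semi-sheets, hence no colourings by the empty set
      have : IsEmpty D.triplePoints :=
        ⟨fun τ => hX.elim (C.val τ.property.choose.bottomSemiSheet)⟩
      exact finsum_of_isEmpty _
    · exact BrokenSurfaceDiagram.finsum_weight_eq_zero L n hη C
  have := Fintype.ofFinite (D.Coloring B)
  rw [BrokenSurfaceDiagram.stateSum, finsum_congr fun C => by rw [hweight C],
    finsum_eq_sum_of_fintype, Finset.sum_const, Finset.card_univ, Nat.card_eq_fintype_card,
    ← AddMonoidAlgebra.one_def, nsmul_one]
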